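/- Let $X$ be a smooth manifold (finite-dimensional, without boundary, Hausdorff, $\sigma$-compact), and let $L$ be a Lie algebroid on $X$: a vector bundle of finite rank, identified with its locally free sheaf of smooth sections, with a Lie bracket and a $C^\infty_X$-linear anchor $\rho\colon L\to T_X$ which respects brackets and satisfies $[x,fy]=f[x,y]+\rho(x)(f)\,y$. Let $\mathcal U_L$ be the sheaf of universal enveloping algebras of $L$. For a $C^\infty_X$-module $\mathcal E$ let $J_L(\mathcal E)=\mathcal Hom_{C^\infty_X}(\mathcal U_L,\mathcal E)$ be the sheaf of left $C^\infty_X$-linear maps, and $J_L=J_L(C^\infty_X)$. Let $p\colon J_L(\mathcal E)\to\mathcal E$, $p(\varphi)=\varphi(1)$, be the quotient map. The sheaf $J_L(\mathcal E)$ is a left $\mathcal U_L$-module by $(D'\varphi)(D)=\varphi(DD')$; in particular $(f\varphi)(D)=\varphi(Df)$ for $f\in C^\infty_X$, and $p$ is $C^\infty_X$-linear. (For $\mathcal E=C^\infty_X$ the antipode identifies this, compatibly with $p$, with the $C^\infty_X$-module structure $(f\varphi)(D)=f\varphi(D)$ and the flat $L$-connection $\nabla_x\varphi(D)=\rho(x)(\varphi(D))-\varphi(xD)$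 on $J_L$.) The coproduct $\Delta(D)=\sum D_{(1)}\otimes D_{(2)}$ of $\mathcal U_L$ defines a product $J_L\times J_L(\mathcal E)\to J_L(\mathcal E)$, $(a\varphi)(D)=\sum a(D_{(1)})\varphi(D_{(2)})$. For a left $\mathcal U_L$-module $\mathcal N$, let $dR_L(\mathcal N)$ be the complex $\Lambda^\bullet L^\vee\otimes\mathcal N$ of $\mathcal N$-valued $L$-forms with the Chevalley--Eilenberg differential. It is a module over $C^*L=(\Lambda^\bullet L^\vee,d_L)$ by the wedge product. Every $C^\infty_X$-module is a $C^*L$-module, concentrated in degree $0$, through the augmentation $C^*L\to C^\infty_X$ that is the identity in degree $0$ and zero in positive degrees. Let $\mathcal E$ be a locally free $C^\infty_X$-module of finite rank, and let $\nu\colon\mathcal E\to J_L(\mathcal E)$ be a $C^\infty_X$-linear map with $p\circ\nu=\mathrm{id}_{\mathcal E}$. Then: 1. The map $dR_L(J_L(\mathcal E))\to\mathcal E$ that is $p$ in degree $0$ and zero in positive degrees is a quasi-isomorphism (even on sections over every open subset of $X$), and it is $C^*L$-linear; thus $dR_L(J_L(\mathcal E))\simeq\mathcal E$ as $C^*L$-modules.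 2. The morphism of sheaves of $C^\infty_X$-modules $i_\nu\colon J_L\otimes_{C^\infty_X}\mathcal E\to J_L(\mathcal E)$, $a\otimes e\mapsto a\,\nu(e)$, is an isomorphism. -/

import Mathlib

set_option linter.unusedSectionVars false

namespace LieAlgebroidJets

section Envelope

variable (A 𝔤 : Type*) [CommRing A] [LieRing 𝔤] [Module A 𝔤] [LieRingModule 𝔤 A]

/-- The defining relations of the universal enveloping algebra of the Lie--Rinehart algebra
`(A, 𝔤)`. -/
inductive EnvRel : FreeRing (A ⊕ 𝔤) → FreeRing (A ⊕ 𝔤) → Prop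
  | one : EnvRel (.of (.inl 1)) 1
  | add_fun (a b : A) : EnvRel (.of (.inl (a + b))) (.of (.inl a) + .of (.inl b))
  | mul_fun (a b : A) : EnvRel (.of (.inl (a * b))) (.of (.inl a) * .of (.inl b))
  | add_vec (x y : 𝔤) : EnvRel (.of (.inr (x + y))) (.of (.inr x) + .of (.inr y))
  | smul_vec (a : A) (x : 𝔤) : EnvRel (.of (.inr (a • x))) (.of (.inl a) * .of (.inr x))
  | lie_vec (x y : 𝔤) :
      EnvRel (.of (.inr ⁅x, y⁆)) (.of (.inr x) * .of (.inr y) - .of (.inr y) * .of (.inr x))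
  | lie_fun (x : 𝔤) (a : A) :
      EnvRel (.of (.inl ⁅x, a⁆)) (.of (.inr x) * .of (.inl a) - .of (.inl a) * .of (.inr x))

/-- The universal enveloping algebra of a Lie--Rinehart algebra `(A, 𝔤)`: the ring generated by
`A` and `𝔤` subject to the relations that `A` is a subring, that the left product of `a ∈ A` with
`x ∈ 𝔤` is `a • x`, that the commutator of `x, y ∈ 𝔤` is `⁅x, y⁆`, and that the commutator of
`x ∈ 𝔤` with `a ∈ A` is the derivative `⁅x, a⁆` of `a` along `x`. -/
def Env : Type _ := RingQuot (EnvRel A 𝔤)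

noncomputable instance : Ring (Env A 𝔤) := inferInstanceAs (Ring (RingQuot (EnvRel A 𝔤)))

variable {A 𝔤}

namespace Env

/-- The quotient map from the free ring. -/
noncomputable def mk : FreeRing (A ⊕ 𝔤) →+* Env A 𝔤 := RingQuot.mkRingHom (EnvRel A 𝔤)

lemma mk_rel {u v : FreeRing (A ⊕ 𝔤)} (h : EnvRel A 𝔤 u v) : mk u = mk v :=
  RingQuot.mkRingHom_rel h

/-- The inclusion of functions. -/
noncomputable def fn : A →+* Env A 𝔤 where
  toFun a := mk (.of (.inl a))
  map_one' := by rw [mk_rel EnvRel.one, map_one]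
  map_mul' a b := by rw [mk_rel (EnvRel.mul_fun a b), map_mul]
  map_add' a b := by rw [mk_rel (EnvRel.add_fun a b), map_add]
  map_zero' := by
    have h := mk_rel (EnvRel.add_fun (A := A) (𝔤 := 𝔤) 0 0)
    rw [map_add, add_zero] at h
    exact left_eq_add.mp h

/-- The left `A`-module structure of the enveloping algebra. -/
noncomputable instance : Module A (Env A 𝔤) := Module.compHom _ (fn (A := A) (𝔤 := 𝔤))

lemma smul_eq (a : A) (D : Env A 𝔤) : a • D = fn a * D := rfl

/-- The inclusion of the Lie algebra. -/
noncomputable def vec : 𝔤 →ₗ[A] Env A 𝔤 where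
  toFun x := mk (.of (.inr x))
  map_add' x y := by rw [mk_rel (EnvRel.add_vec x y), map_add]
  map_smul' a x := by
    rw [mk_rel (EnvRel.smul_vec a x), map_mul]
    rfl

lemma vec_lie (x y : 𝔤) : (vec ⁅x, y⁆ : Env A 𝔤) = vec x * vec y - vec y * vec x :=
  (mk_rel (EnvRel.lie_vec (A := A) x y)).trans (by rw [map_sub, map_mul, map_mul]; rfl)

lemma fn_lie (x : 𝔤) (a : A) : (fn ⁅x, a⁆ : Env A 𝔤) = vec x * fn a - fn a * vec x :=
  (mk_rel (EnvRel.lie_fun x a)).trans (by rw [map_sub, map_mul, map_mul]; rfl)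

lemma vec_mul_fn (x : 𝔤) (a : A) : (vec x * fn a : Env A 𝔤) = fn a * vec x + fn ⁅x, a⁆ := by
  rw [fn_lie]; abel

lemma smul_mul (a : A) (D D' : Env A 𝔤) : (a • D) * D' = a • (D * D') := mul_assoc _ _ _

lemma vec_mul_smul (x : 𝔤) (a : A) (D : Env A 𝔤) :
    (vec x : Env A 𝔤) * (a • D) = a • (vec x * D) + ⁅x, a⁆ • D := by
  rw [smul_eq, ← mul_assoc, vec_mul_fn, add_mul, mul_assoc]
  rfl

/-- The universal property of the enveloping algebra. -/
noncomputable def lift {B : Type*} [Ring B] (f : A →+* B) (g : 𝔤 →+ B)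
    (hs : ∀ a x, g (a • x) = f a * g x) (hv : ∀ x y, g ⁅x, y⁆ = g x * g y - g y * g x)
    (hf : ∀ x a, f ⁅x, a⁆ = g x * f a - f a * g x) : Env A 𝔤 →+* B :=
  RingQuot.lift ⟨FreeRing.lift (Sum.elim f g), by
    rintro _ _ (_ | _ | _ | _ | _ | _ | _) <;> simp [*]⟩

section lift

variable {B : Type*} [Ring B] (f : A →+* B) (g : 𝔤 →+ B)
    (hs : ∀ a x, g (a • x) = f a * g x) (hv : ∀ x y, g ⁅x, y⁆ = g x * g y - g y * g x)
    (hf : ∀ x a, f ⁅x, a⁆ = g x * f a - f a * g x)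

@[simp] lemma lift_fn (a : A) : lift f g hs hv hf (fn a) = f a := by
  refine (RingQuot.lift_mkRingHom_apply _ _ _).trans ?_
  simp

@[simp] lemma lift_vec (x : 𝔤) : lift f g hs hv hf (vec x) = g x := by
  refine (RingQuot.lift_mkRingHom_apply _ _ _).trans ?_
  simp

end lift

/-- Induction on words in functions and vectors, multiplying from the left. -/
lemma induction {P : Env A 𝔤 → Prop} (one : P 1) (add : ∀ D D', P D → P D' → P (D + D'))
    (fn_mul : ∀ a D, P D → P (fn a * D)) (vec_mul : ∀ x D, P D → P (vec x * D)) (D : Env A 𝔤) :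
    P D := by
  suffices h : ∀ D' : Env A 𝔤, P D' → P (D * D') by simpa using h 1 one
  obtain ⟨w, rfl⟩ : ∃ w, mk w = D := RingQuot.mkRingHom_surjective (EnvRel A 𝔤) D
  induction w using FreeRing.induction_on with
  | hn1 =>
    intro D' h
    have := fn_mul (-1) D' h
    simpa using this
  | hb z =>
    intro D' h
    rcases z with a | x
    · exact fn_mul a D' h
    · exact vec_mul x D' h
  | ha u v hu hv =>
    intro D' h
    rw [map_add, add_mul]
    exact add _ _ (hu D' h) (hv D' h)
  | hm u v hu hv =>
    intro D' h
    rw [map_mul, mul_assoc]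
    exact hu _ (hv D' h)

/-- Two ring homomorphisms from the enveloping algebra agree if they agree on functions and on vectors. -/
lemma ringHom_ext {B : Type*} [Ring B] {f g : Env A 𝔤 →+* B} (hf : ∀ a, f (fn a) = g (fn a))
    (hv : ∀ x, f (vec x) = g (vec x)) : f = g := by
  ext D
  induction D using Env.induction with
  | one => simp
  | add D D' h h' => simp [h, h']
  | fn_mul a D h => simp [h, hf]
  | vec_mul x D h => simp [h, hv]

/-- Right multiplication by a function, as a map linear for the left module structure. -/
noncomputable def mulFn (a : A) : Env A 𝔤 →ₗ[A] Env A 𝔤 where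
  toFun D := D * fn a
  map_add' _ _ := add_mul _ _ _
  map_smul' _ _ := mul_assoc _ _ _

/-- Right multiplication by a vector, as a map linear for the left module structure. -/
noncomputable def mulVec (x : 𝔤) : Env A 𝔤 →ₗ[A] Env A 𝔤 where
  toFun D := D * vec x
  map_add' _ _ := add_mul _ _ _
  map_smul' _ _ := mul_assoc _ _ _

section Coproduct

open scoped TensorProduct

/-- Additive maps out of a tensor product agree if they agree on pure tensors. -/
lemma tensor_addHom_ext {M N P : Type*} [AddCommGroup M] [AddCommGroup N] [AddCommGroup P]
    [Module A M] [Module A N] {f g : M ⊗[A] N →+ P} (h : ∀ m n, f (m ⊗ₜ n) = g (m ⊗ₜ n)) :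
    f = g := by
  ext t
  induction t with
  | zero => simp
  | add s t hs ht => simp only [map_add, hs, ht]
  | tmul m n => exact h m n

/-- The action of a vector `x` on the tensor product over `A` of two copies of the enveloping
algebra: `x (D ⊗ D') = x D ⊗ D' + D ⊗ x D'`. -/
noncomputable def vecTensor (x : 𝔤) : Env A 𝔤 ⊗[A] Env A 𝔤 →+ Env A 𝔤 ⊗[A] Env A 𝔤 :=
  TensorProduct.liftAddHom
    (AddMonoidHom.mk' (fun D : Env A 𝔤 => AddMonoidHom.mk'
      (fun D' : Env A 𝔤 => ((vec x : Env A 𝔤) * D) ⊗ₜ[A] D' + D ⊗ₜ[A] ((vec x : Env A 𝔤) * D'))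
      (fun D' D'' => by rw [mul_add, TensorProduct.tmul_add, TensorProduct.tmul_add]; abel))
      (fun D D'' => by
        ext D'
        simp only [AddMonoidHom.mk'_apply, AddMonoidHom.add_apply, mul_add,
          TensorProduct.add_tmul]
        abel))
    (fun a D D' => by
      change ((vec x : Env A 𝔤) * (a • D)) ⊗ₜ[A] D' + (a • D) ⊗ₜ[A] ((vec x : Env A 𝔤) * D') =
        ((vec x : Env A 𝔤) * D) ⊗ₜ[A] (a • D') + D ⊗ₜ[A] ((vec x : Env A 𝔤) * (a • D'))
      rw [vec_mul_smul, vec_mul_smul, TensorProduct.add_tmul, TensorProduct.tmul_add,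
        TensorProduct.smul_tmul, TensorProduct.smul_tmul, TensorProduct.smul_tmul]
      abel)

@[simp] lemma vecTensor_tmul (x : 𝔤) (D D' : Env A 𝔤) :
    vecTensor x (D ⊗ₜ[A] D') =
      ((vec x : Env A 𝔤) * D) ⊗ₜ D' + D ⊗ₜ ((vec x : Env A 𝔤) * D') := rfl

/-- The action of vectors on the tensor product, as an additive map to endomorphisms. -/
noncomputable def vecTensorHom : 𝔤 →+ AddMonoid.End (Env A 𝔤 ⊗[A] Env A 𝔤) where
  toFun := vecTensor
  map_zero' := by
    refine tensor_addHom_ext fun D D' => ?_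
    change vecTensor 0 (D ⊗ₜ[A] D') = 0
    simp
  map_add' x y := by
    refine tensor_addHom_ext fun D D' => ?_
    change vecTensor (x + y) (D ⊗ₜ[A] D') = vecTensor x (D ⊗ₜ D') + vecTensor y (D ⊗ₜ D')
    simp only [vecTensor_tmul, map_add, add_mul, TensorProduct.add_tmul, TensorProduct.tmul_add]
    abel

/-- The left module structure over the enveloping algebra on the tensor product over `A` of two
copies of the enveloping algebra: functions act on either factor, vectors by the Leibniz rule. -/
noncomputable def actTensor : Env A 𝔤 →+* AddMonoid.End (Env A 𝔤 ⊗[A] Env A 𝔤) :=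
  lift (B := AddMonoid.End (Env A 𝔤 ⊗[A] Env A 𝔤))
    (Module.toAddMonoidEnd A (Env A 𝔤 ⊗[A] Env A 𝔤)) (vecTensorHom (A := A) (𝔤 := 𝔤))
    (fun a x => by
      refine DFunLike.ext _ _ (DFunLike.congr_fun (tensor_addHom_ext fun D D' => ?_))
      change vecTensor (a • x) (D ⊗ₜ[A] D') = a • vecTensor x (D ⊗ₜ D')
      rw [vecTensor_tmul, vecTensor_tmul, smul_add, map_smul, smul_mul, smul_mul,
        TensorProduct.smul_tmul', TensorProduct.tmul_smul])
    (fun x y => by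
      refine DFunLike.ext _ _ (DFunLike.congr_fun (tensor_addHom_ext fun D D' => ?_))
      change vecTensor ⁅x, y⁆ (D ⊗ₜ[A] D') =
        vecTensor x (vecTensor y (D ⊗ₜ D')) - vecTensor y (vecTensor x (D ⊗ₜ D'))
      simp only [vecTensor_tmul, map_add, vec_lie, sub_mul, TensorProduct.sub_tmul,
        TensorProduct.tmul_sub, mul_assoc]
      abel)
    (fun x a => by
      refine DFunLike.ext _ _ (DFunLike.congr_fun (tensor_addHom_ext fun D D' => ?_))
      change ⁅x, a⁆ • (D ⊗ₜ[A] D') =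
        vecTensor x (a • (D ⊗ₜ D')) - a • vecTensor x (D ⊗ₜ D')
      simp only [vecTensor_tmul, smul_add, TensorProduct.smul_tmul', vec_mul_smul,
        TensorProduct.add_tmul]
      abel)

lemma actTensor_fn (a : A) (t : Env A 𝔤 ⊗[A] Env A 𝔤) : actTensor (fn a) t = a • t := by
  rw [actTensor, lift_fn]
  rfl

lemma actTensor_vec (x : 𝔤) (t : Env A 𝔤 ⊗[A] Env A 𝔤) :
    actTensor (vec x) t = vecTensor x t := by
  rw [actTensor, lift_vec]
  rfl

lemma actTensor_mul (D D' : Env A 𝔤) (t : Env A 𝔤 ⊗[A] Env A 𝔤) :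
    actTensor (D * D') t = actTensor D (actTensor D' t) := by
  rw [map_mul]
  rfl

/-- The coproduct of the enveloping algebra, `Δ(D) = D · (1 ⊗ 1)`; it is determined by
`Δ(1) = 1 ⊗ 1` and by `Δ(a D) = a Δ(D)` and `Δ(x D) = (x ⊗ 1 + 1 ⊗ x) Δ(D)` for functions `a` and
vectors `x`. -/
noncomputable def coprod : Env A 𝔤 →ₗ[A] Env A 𝔤 ⊗[A] Env A 𝔤 where
  toFun D := actTensor D (1 ⊗ₜ 1)
  map_add' D D' := by rw [map_add]; rfl
  map_smul' a D := by
    rw [smul_eq, actTensor_mul, actTensor_fn]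
    rfl

lemma coprod_one : coprod (1 : Env A 𝔤) = 1 ⊗ₜ 1 := by
  change actTensor 1 _ = _
  rw [map_one]; rfl

lemma coprod_fn_mul (a : A) (D : Env A 𝔤) : coprod (fn a * D) = a • coprod D :=
  map_smul coprod a D

lemma coprod_vec_mul (x : 𝔤) (D : Env A 𝔤) : coprod (vec x * D) = vecTensor x (coprod D) := by
  change actTensor (vec x * D) _ = vecTensor x (actTensor D _)
  rw [actTensor_mul, actTensor_vec]

lemma vecTensor_map_id (x : 𝔤) (f : Env A 𝔤 →ₗ[A] Env A 𝔤) (hf : ∀ D, f (vec x * D) = vec x * f D)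
    (t : Env A 𝔤 ⊗[A] Env A 𝔤) :
    vecTensor x (TensorProduct.map f .id t) = TensorProduct.map f .id (vecTensor x t) := by
  induction t with
  | zero => simp
  | add s t hs ht => simp only [map_add, hs, ht]
  | tmul D D' => simp [hf]

lemma vecTensor_map_id' (x : 𝔤) (f : Env A 𝔤 →ₗ[A] Env A 𝔤)
    (hf : ∀ D, f (vec x * D) = vec x * f D) (t : Env A 𝔤 ⊗[A] Env A 𝔤) :
    vecTensor x (TensorProduct.map .id f t) = TensorProduct.map .id f (vecTensor x t) := by
  induction t with
  | zero => simp
  | add s t hs ht => simp only [map_add, hs, ht]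
  | tmul D D' => simp [hf]

lemma coprod_mul_fn (D : Env A 𝔤) (a : A) :
    coprod (D * fn a) = TensorProduct.map (mulFn a) .id (coprod D) := by
  induction D using Env.induction with
  | one =>
    rw [one_mul, ← mul_one (fn a), coprod_fn_mul, coprod_one, TensorProduct.map_tmul,
      TensorProduct.smul_tmul', smul_eq]
    simp [mulFn]
  | add D D' h h' => rw [add_mul, map_add, map_add, h, h', map_add]
  | fn_mul b D h => rw [mul_assoc, coprod_fn_mul, h, coprod_fn_mul, map_smul]
  | vec_mul x D h =>
    rw [mul_assoc, coprod_vec_mul, h, coprod_vec_mul, vecTensor_map_id]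
    intro D; exact mul_assoc _ _ _

lemma coprod_mul_fn' (D : Env A 𝔤) (a : A) :
    coprod (D * fn a) = TensorProduct.map .id (mulFn a) (coprod D) := by
  induction D using Env.induction with
  | one =>
    rw [one_mul, ← mul_one (fn a), coprod_fn_mul, coprod_one, TensorProduct.map_tmul,
      ← TensorProduct.tmul_smul, smul_eq]
    simp [mulFn]
  | add D D' h h' => rw [add_mul, map_add, map_add, h, h', map_add]
  | fn_mul b D h => rw [mul_assoc, coprod_fn_mul, h, coprod_fn_mul, map_smul]
  | vec_mul x D h =>
    rw [mul_assoc, coprod_vec_mul, h, coprod_vec_mul, vecTensor_map_id']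
    intro D; exact mul_assoc _ _ _

end Coproduct

section Functoriality

variable {A' 𝔤' : Type*} [CommRing A'] [LieRing 𝔤'] [Module A' 𝔤'] [LieRingModule 𝔤' A']

/-- The ring homomorphism of enveloping algebras induced by compatible maps of functions and of
vectors. -/
noncomputable def map (f : A →+* A') (g : 𝔤 →+ 𝔤') (hs : ∀ a x, g (a • x) = f a • g x)
    (hv : ∀ x y, g ⁅x, y⁆ = ⁅g x, g y⁆) (hf : ∀ x a, f ⁅x, a⁆ = ⁅g x, f a⁆) :
    Env A 𝔤 →+* Env A' 𝔤' :=
  lift (fn.comp f) ((vec (A := A') (𝔤 := 𝔤')).toAddMonoidHom.comp g)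
    (fun a x => by simp [hs, smul_eq])
    (fun x y => by simp [hv, vec_lie])
    (fun x a => by simp [hf, fn_lie])

section map

variable (f : A →+* A') (g : 𝔤 →+ 𝔤') (hs : ∀ a x, g (a • x) = f a • g x)
    (hv : ∀ x y, g ⁅x, y⁆ = ⁅g x, g y⁆) (hf : ∀ x a, f ⁅x, a⁆ = ⁅g x, f a⁆)

lemma map_fn (a : A) : map f g hs hv hf (fn a) = fn (f a) := lift_fn _ _ _ _ _ a

lemma map_vec (x : 𝔤) : map f g hs hv hf (vec (A := A) x) = vec (A := A') (g x) :=
  lift_vec _ _ _ _ _ x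

lemma map_smul' (a : A) (D : Env A 𝔤) :
    map f g hs hv hf (a • D) = f a • map f g hs hv hf D := by
  rw [smul_eq, map_mul, map_fn, smul_eq]

open scoped TensorProduct

/-- The map induced on the tensor square of the enveloping algebra. -/
noncomputable def mapTensor : Env A 𝔤 ⊗[A] Env A 𝔤 →+ Env A' 𝔤' ⊗[A'] Env A' 𝔤' :=
  TensorProduct.liftAddHom
    (AddMonoidHom.mk' (fun D : Env A 𝔤 => AddMonoidHom.mk'
      (fun D' : Env A 𝔤 => map f g hs hv hf D ⊗ₜ[A'] map f g hs hv hf D')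
      (fun D' D'' => by rw [map_add, TensorProduct.tmul_add]))
      (fun D D'' => by
        ext D'
        simp only [AddMonoidHom.mk'_apply, AddMonoidHom.add_apply, map_add,
          TensorProduct.add_tmul]))
    (fun a D D' => by
      change map f g hs hv hf (a • D) ⊗ₜ[A'] map f g hs hv hf D' =
        map f g hs hv hf D ⊗ₜ[A'] map f g hs hv hf (a • D')
      rw [map_smul', map_smul', TensorProduct.smul_tmul])

lemma mapTensor_tmul (D D' : Env A 𝔤) : mapTensor f g hs hv hf (D ⊗ₜ[A] D') =
    map f g hs hv hf D ⊗ₜ[A'] map f g hs hv hf D' := rfl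

lemma mapTensor_coprod (D : Env A 𝔤) :
    mapTensor f g hs hv hf (coprod D) = coprod (map f g hs hv hf D) := by
  induction D using Env.induction with
  | one => rw [coprod_one, mapTensor_tmul, map_one, coprod_one]
  | add D D' h h' => rw [map_add, map_add, map_add, map_add, h, h']
  | fn_mul a D h =>
    have : ∀ t, mapTensor f g hs hv hf (a • t) = f a • mapTensor f g hs hv hf t := fun t => by
      induction t with
      | zero => simp
      | add s t hs ht => simp only [smul_add, map_add, hs, ht]
      | tmul D D' =>
        rw [TensorProduct.smul_tmul', mapTensor_tmul, map_smul', mapTensor_tmul,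
          TensorProduct.smul_tmul']
    rw [coprod_fn_mul, this, h, map_mul, map_fn, coprod_fn_mul]
  | vec_mul x D h =>
    have : ∀ t, mapTensor f g hs hv hf (vecTensor x t) =
        vecTensor (g x) (mapTensor f g hs hv hf t) := fun t => by
      induction t with
      | zero => simp
      | add s t hs ht => simp only [map_add, hs, ht]
      | tmul D D' =>
        rw [vecTensor_tmul, map_add, mapTensor_tmul, mapTensor_tmul, mapTensor_tmul,
          vecTensor_tmul, map_mul, map_mul, map_vec]
    rw [coprod_vec_mul, this, h, map_mul, map_vec, coprod_vec_mul]

end map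

end Functoriality

section Convolution

open scoped TensorProduct

variable {N : Type*} [AddCommGroup N] [Module A N]

/-- The product `(a φ)(D) = ∑ a(D₁) φ(D₂)`, where `Δ(D) = ∑ D₁ ⊗ D₂`, of a function-valued jet `a`
and an `N`-valued jet `φ`. -/
noncomputable def conv (a : Env A 𝔤 →ₗ[A] A) (φ : Env A 𝔤 →ₗ[A] N) : Env A 𝔤 →ₗ[A] N :=
  TensorProduct.lift ((LinearMap.lsmul A N).compl₁₂ a φ) ∘ₗ coprod

/-- The pairing used in the definition of the product of jets. -/
noncomputable abbrev pair (a : Env A 𝔤 →ₗ[A] A) (φ : Env A 𝔤 →ₗ[A] N) :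
    Env A 𝔤 ⊗[A] Env A 𝔤 →ₗ[A] N :=
  TensorProduct.lift ((LinearMap.lsmul A N).compl₁₂ a φ)

lemma pair_tmul (a : Env A 𝔤 →ₗ[A] A) (φ : Env A 𝔤 →ₗ[A] N) (D D' : Env A 𝔤) :
    pair a φ (D ⊗ₜ D') = a D • φ D' := by
  simp [pair]

lemma conv_apply (a : Env A 𝔤 →ₗ[A] A) (φ : Env A 𝔤 →ₗ[A] N) (D : Env A 𝔤) :
    conv a φ D = pair a φ (coprod D) := rfl

lemma conv_add (a : Env A 𝔤 →ₗ[A] A) (φ ψ : Env A 𝔤 →ₗ[A] N) :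
    conv a (φ + ψ) = conv a φ + conv a ψ := by
  ext D
  rw [LinearMap.add_apply, conv_apply, conv_apply, conv_apply]
  generalize coprod D = t
  induction t with
  | zero => simp
  | add s t hs ht => simp only [map_add, hs, ht]; abel
  | tmul D D' => simp

lemma add_conv (a b : Env A 𝔤 →ₗ[A] A) (φ : Env A 𝔤 →ₗ[A] N) :
    conv (a + b) φ = conv a φ + conv b φ := by
  ext D
  rw [LinearMap.add_apply, conv_apply, conv_apply, conv_apply]
  generalize coprod D = t
  induction t with
  | zero => simp
  | add s t hs ht => simp only [map_add, hs, ht]; abel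
  | tmul D D' => rw [pair_tmul, pair_tmul, pair_tmul, LinearMap.add_apply, add_smul]

lemma comp_mulFn_conv (f : A) (a : Env A 𝔤 →ₗ[A] A) (φ : Env A 𝔤 →ₗ[A] N) :
    conv (a ∘ₗ mulFn f) φ = conv a φ ∘ₗ mulFn f := by
  ext D
  change pair _ _ (coprod D) = pair _ _ (coprod (D * fn f))
  rw [coprod_mul_fn]
  generalize coprod D = t
  induction t with
  | zero => simp
  | add s t hs ht => simp only [map_add, hs, ht]
  | tmul D D' => simp

lemma conv_comp_mulFn (f : A) (a : Env A 𝔤 →ₗ[A] A) (φ : Env A 𝔤 →ₗ[A] N) :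
    conv a (φ ∘ₗ mulFn f) = conv a φ ∘ₗ mulFn f := by
  ext D
  change pair _ _ (coprod D) = pair _ _ (coprod (D * fn f))
  rw [coprod_mul_fn']
  generalize coprod D = t
  induction t with
  | zero => simp
  | add s t hs ht => simp only [map_add, hs, ht]
  | tmul D D' => simp

lemma conv_map {A' 𝔤' N' : Type*} [CommRing A'] [LieRing 𝔤'] [Module A' 𝔤']
    [LieRingModule 𝔤' A'] [AddCommGroup N'] [Module A' N'] (f : A →+* A') (g : 𝔤 →+ 𝔤')
    (hs : ∀ a x, g (a • x) = f a • g x) (hv : ∀ x y, g ⁅x, y⁆ = ⁅g x, g y⁆)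
    (hf : ∀ x a, f ⁅x, a⁆ = ⁅g x, f a⁆) (r : N →+ N') (hr : ∀ a n, r (a • n) = f a • r n)
    {a : Env A 𝔤 →ₗ[A] A} {φ : Env A 𝔤 →ₗ[A] N} {a' : Env A' 𝔤' →ₗ[A'] A'}
    {φ' : Env A' 𝔤' →ₗ[A'] N'} (ha : ∀ D, f (a D) = a' (map f g hs hv hf D))
    (hφ : ∀ D, r (φ D) = φ' (map f g hs hv hf D)) (D : Env A 𝔤) :
    r (conv a φ D) = conv a' φ' (map f g hs hv hf D) := by
  rw [conv_apply, conv_apply, ← mapTensor_coprod]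
  generalize coprod D = t
  induction t with
  | zero => simp
  | add s t hs ht => simp only [map_add, hs, ht]
  | tmul D D' => rw [pair_tmul, mapTensor_tmul, pair_tmul, hr, ha, hφ]

end Convolution

section Antipode

variable [LieRinehartRing A 𝔤]

/-- The flat connection `∇_x φ (D) = x (φ(D)) - φ(x D)` on function-valued jets; it is a connection
for the `A`-module structure `(a φ)(D) = a φ(D)`. -/
noncomputable def nabla (x : 𝔤) : AddMonoid.End (Env A 𝔤 →ₗ[A] A) where
  toFun φ :=
    { toFun := fun D => ⁅x, φ D⁆ - φ (vec x * D)
      map_add' := fun D D' => by simp only [map_add, lie_add, mul_add]; abel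
      map_smul' := fun a D => by
        rw [map_smul, vec_mul_smul, map_add, map_smul, map_smul, smul_eq_mul,
          LieRinehartRing.leibniz_mul_right]
        simp only [smul_eq_mul, RingHom.id_apply]
        ring }
  map_zero' := by ext D; simp
  map_add' φ ψ := by ext D; simp; abel

lemma nabla_apply (x : 𝔤) (φ : Env A 𝔤 →ₗ[A] A) (D : Env A 𝔤) :
    nabla x φ D = ⁅x, φ D⁆ - φ (vec x * D) := rfl

/-- `nabla` is additive in the vector. -/
noncomputable def nablaHom : 𝔤 →+ AddMonoid.End (Env A 𝔤 →ₗ[A] A) where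
  toFun := nabla
  map_zero' := by
    refine AddMonoidHom.ext fun φ => LinearMap.ext fun D => ?_
    change ⁅(0 : 𝔤), φ D⁆ - φ (vec (0 : 𝔤) * D) = 0
    rw [zero_lie, map_zero, zero_mul, map_zero, sub_zero]
  map_add' := fun x y => by
    refine AddMonoidHom.ext fun φ => LinearMap.ext fun D => ?_
    change ⁅x + y, φ D⁆ - φ (vec (x + y) * D) =
      (⁅x, φ D⁆ - φ (vec x * D)) + (⁅y, φ D⁆ - φ (vec y * D))
    rw [add_lie, map_add, add_mul, map_add]
    abel

/-- The action of the enveloping algebra on function-valued jets given by the flat connection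
`nabla` and the module structure `(a φ)(D) = a φ(D)`. -/
noncomputable def nablaAct : Env A 𝔤 →+* AddMonoid.End (Env A 𝔤 →ₗ[A] A) :=
  lift (B := AddMonoid.End (Env A 𝔤 →ₗ[A] A)) (Module.toAddMonoidEnd A (Env A 𝔤 →ₗ[A] A))
    (nablaHom (A := A) (𝔤 := 𝔤))
    (fun a x => by
      refine DFunLike.ext _ _ fun φ => LinearMap.ext fun D => ?_
      change ⁅a • x, φ D⁆ - φ (vec (a • x) * D) = a * (⁅x, φ D⁆ - φ (vec x * D))
      rw [LieRinehartRing.lie_smul_eq_mul, map_smul, smul_mul, map_smul, smul_eq_mul]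
      ring)
    (fun x y => by
      refine DFunLike.ext _ _ fun φ => LinearMap.ext fun D => ?_
      change ⁅⁅x, y⁆, φ D⁆ - φ (vec ⁅x, y⁆ * D) =
        (⁅x, ⁅y, φ D⁆ - φ (vec y * D)⁆ - (⁅y, φ (vec x * D)⁆ - φ (vec y * (vec x * D)))) -
        (⁅y, ⁅x, φ D⁆ - φ (vec x * D)⁆ - (⁅x, φ (vec y * D)⁆ - φ (vec x * (vec y * D))))
      rw [lie_lie, vec_lie, sub_mul, map_sub, mul_assoc, mul_assoc, lie_sub, lie_sub]
      abel)
    (fun x a => by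
      refine DFunLike.ext _ _ fun φ => LinearMap.ext fun D => ?_
      change ⁅x, a⁆ * φ D = (⁅x, a * φ D⁆ - a * φ (vec x * D)) - a * (⁅x, φ D⁆ - φ (vec x * D))
      rw [LieRinehartRing.leibniz_mul_right]
      simp only [smul_eq_mul]
      ring)

lemma nablaAct_fn (a : A) (φ : Env A 𝔤 →ₗ[A] A) : nablaAct (fn (𝔤 := 𝔤) a) φ = a • φ := by
  rw [nablaAct, lift_fn]; rfl

lemma nablaAct_vec (x : 𝔤) (φ : Env A 𝔤 →ₗ[A] A) :
    nablaAct (vec x : Env A 𝔤) φ = nabla x φ := by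
  rw [nablaAct, lift_vec]; rfl

lemma nablaAct_mul (D D' : Env A 𝔤) (φ : Env A 𝔤 →ₗ[A] A) :
    nablaAct (D * D') φ = nablaAct D (nablaAct D' φ) := by
  rw [map_mul]; rfl

/-- The antipode `S` on function-valued jets, `S(φ)(D) = (∇_D φ)(1)`. -/
noncomputable def antipode (φ : Env A 𝔤 →ₗ[A] A) : Env A 𝔤 →ₗ[A] A where
  toFun D := nablaAct D φ 1
  map_add' D D' := by rw [map_add]; rfl
  map_smul' a D := by rw [smul_eq, nablaAct_mul, nablaAct_fn]; rfl

lemma antipode_apply (φ : Env A 𝔤 →ₗ[A] A) (D : Env A 𝔤) : antipode φ D = nablaAct D φ 1 := rfl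

/-- The antipode does not change the value at `1`. -/
lemma antipode_one (φ : Env A 𝔤 →ₗ[A] A) : antipode φ 1 = φ 1 := by
  rw [antipode_apply, nablaAct.map_one]; rfl

/-- The antipode carries the module structure `(a φ)(D) = a φ(D)` to `(a φ)(D) = φ(D a)`. -/
lemma antipode_smul (a : A) (φ : Env A 𝔤 →ₗ[A] A) :
    antipode (a • φ) = antipode φ ∘ₗ mulFn a := by
  ext D
  change nablaAct D (a • φ) 1 = nablaAct (D * fn a) φ 1
  rw [nablaAct_mul, nablaAct_fn]

/-- The antipode carries the connection `∇_x φ (D) = x (φ(D)) - φ(x D)` to the connection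
`∇_x φ (D) = φ(D x)`. -/
lemma antipode_nabla (x : 𝔤) (φ : Env A 𝔤 →ₗ[A] A) :
    antipode (nabla x φ) = antipode φ ∘ₗ mulVec x := by
  ext D
  change nablaAct D (nabla x φ) 1 = nablaAct (D * vec x) φ 1
  rw [nablaAct_mul, nablaAct_vec]

/-- The antipode is an involution, in particular bijective. -/
lemma antipode_antipode (φ : Env A 𝔤 →ₗ[A] A) : antipode (antipode φ) = φ := by
  have key : ∀ D : Env A 𝔤, ∀ φ : Env A 𝔤 →ₗ[A] A, ∀ D', nablaAct D (antipode φ) D' =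
      nablaAct D' φ D := by
    intro D
    induction D using Env.induction with
    | one =>
      intro φ D'
      rw [nablaAct.map_one]; rfl
    | add D₁ D₂ h₁ h₂ =>
      intro φ D'
      rw [map_add, map_add]
      change nablaAct D₁ (antipode φ) D' + nablaAct D₂ (antipode φ) D' = _
      rw [h₁, h₂]
    | fn_mul a D h =>
      intro φ D'
      rw [nablaAct_mul, nablaAct_fn, LinearMap.smul_apply, h, ← smul_eq, map_smul]
    | vec_mul x D h =>
      intro φ D'
      rw [nablaAct_mul, nablaAct_vec, nabla_apply, h, h, nablaAct_mul, nablaAct_vec, nabla_apply]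
      abel
  ext D
  rw [antipode_apply, key, nablaAct.map_one]; rfl

end Antipode

end Env

end Envelope

section ChevalleyEilenberg

/-- A module over the Lie--Rinehart algebra `(A, 𝔤)`: an `A`-module `N` with a flat `𝔤`-connection
`n ↦ ⁅x, n⁆`. (Flatness, `⁅⁅x, y⁆, n⁆ = ⁅x, ⁅y, n⁆⁆ - ⁅y, ⁅x, n⁆⁆`, is part of `LieRingModule 𝔤 N`.)
This is the same as a left module over the universal enveloping algebra. -/
class LieRinehartModule (A 𝔤 N : Type*) [CommRing A] [LieRing 𝔤] [Module A 𝔤]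
    [LieRingModule 𝔤 A] [AddCommGroup N] [Module A N] [LieRingModule 𝔤 N] : Prop where
  smul_lie (a : A) (x : 𝔤) (n : N) : ⁅a • x, n⁆ = a • ⁅x, n⁆
  lie_smul (x : 𝔤) (a : A) (n : N) : ⁅x, a • n⁆ = a • ⁅x, n⁆ + ⁅x, a⁆ • n

instance (A 𝔤 : Type*) [CommRing A] [LieRing 𝔤] [Module A 𝔤] [LieRingModule 𝔤 A]
    [LieRinehartRing A 𝔤] : LieRinehartModule A 𝔤 A where
  smul_lie a x b := LieRinehartRing.lie_smul_eq_mul a b x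
  lie_smul x a b := LieRinehartRing.leibniz_mul_right x a b

variable {A 𝔤 N : Type*} [CommRing A] [LieRing 𝔤] [Module A 𝔤] [LieRingModule 𝔤 A]
  [LieRinehartRing A 𝔤] [AddCommGroup N] [Module A N] [LieRingModule 𝔤 N]
  [LieRinehartModule A 𝔤 N]

namespace CE

open Fin Function

/-- The Chevalley--Eilenberg differential, as a function:
`(d ω)(x₀, …, xₙ) = ∑ₗ (-1)ˡ xₗ · ω(…, x̂ₗ, …)
  + ∑ₖ<ₗ (-1)ˡ ω(x₀, …, [xₖ, xₗ], …, x̂ₗ, …, xₙ)`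
with `[xₖ, xₗ]` in the place of `xₖ`; moving it to the front gives the usual second summand
`∑ₖ<ₗ (-1)ᵏ⁺ˡ ω([xₖ, xₗ], x₀, …, x̂ₖ, …, x̂ₗ, …, xₙ)`. -/
def dFun {n : ℕ} (ω : 𝔤 [⋀^Fin n]→ₗ[A] N) (x : Fin (n + 1) → 𝔤) : N :=
  ∑ l : Fin (n + 1), (-1 : ℤ) ^ (l : ℕ) • (⁅x l, ω (l.removeNth x)⁆ +
    ∑ k : Fin n with k.castSucc < l,
      ω (update (l.removeNth x) k ⁅x k.castSucc, x l⁆))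

/-- The Lie derivative of a form, as a function. -/
def lieFun {n : ℕ} (y : 𝔤) (ω : 𝔤 [⋀^Fin n]→ₗ[A] N) (x : Fin n → 𝔤) : N :=
  ⁅y, ω x⁆ - ∑ j, ω (update x j ⁅y, x j⁆)

/-- The Lie derivative of a form along a vector. -/
def lieDer {n : ℕ} (y : 𝔤) (ω : 𝔤 [⋀^Fin n]→ₗ[A] N) : 𝔤 [⋀^Fin n]→ₗ[A] N where
  toFun := lieFun y ω
  map_update_add' := by
    intro inst x i u v
    have : inst = instDecidableEqFin n := Subsingleton.elim _ _
    subst this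
    simp only [lieFun]
    rw [ω.map_update_add, lie_add, ← Finset.add_sum_erase _ _ (Finset.mem_univ i),
      ← Finset.add_sum_erase _ (fun j => ω (update (update x i u) j _)) (Finset.mem_univ i),
      ← Finset.add_sum_erase _ (fun j => ω (update (update x i v) j _)) (Finset.mem_univ i)]
    have h : ∀ w : 𝔤, ∑ j ∈ Finset.univ.erase i, ω (update (update x i w) j ⁅y, update x i w j⁆)
        = ∑ j ∈ Finset.univ.erase i, ω (update (update x j ⁅y, x j⁆) i w) := fun w =>
      Finset.sum_congr rfl fun j hj => by
        rw [update_of_ne (Finset.ne_of_mem_erase hj), update_comm (Finset.ne_of_mem_erase hj).symm]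
    rw [h, h, h]
    simp only [update_idem, update_self, lie_add, ω.map_update_add, Finset.sum_add_distrib]
    abel
  map_update_smul' := by
    intro inst x i a u
    have : inst = instDecidableEqFin n := Subsingleton.elim _ _
    subst this
    simp only [lieFun]
    rw [ω.map_update_smul, LieRinehartModule.lie_smul,
      ← Finset.add_sum_erase _ _ (Finset.mem_univ i),
      ← Finset.add_sum_erase _ (fun j => ω (update (update x i u) j _)) (Finset.mem_univ i)]
    have h : ∀ w : 𝔤, ∑ j ∈ Finset.univ.erase i, ω (update (update x i w) j ⁅y, update x i w j⁆)
        = ∑ j ∈ Finset.univ.erase i, ω (update (update x j ⁅y, x j⁆) i w) := fun w =>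
      Finset.sum_congr rfl fun j hj => by
        rw [update_of_ne (Finset.ne_of_mem_erase hj), update_comm (Finset.ne_of_mem_erase hj).symm]
    rw [h, h]
    simp only [update_idem, update_self, LieRinehartRing.leibniz_smul_right, ω.map_update_add,
      ω.map_update_smul, smul_sub, smul_add, Finset.smul_sum]
    abel
  map_eq_zero_of_eq' := by
    intro x i j hij hne
    simp only [lieFun]
    rw [ω.map_eq_zero_of_eq x hij hne, lie_zero, zero_sub, neg_eq_zero,
      ← Finset.add_sum_erase _ _ (Finset.mem_univ i),
      ← Finset.add_sum_erase _ _ (Finset.mem_erase.2 ⟨hne.symm, Finset.mem_univ j⟩),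
      Finset.sum_eq_zero, add_zero]
    · have : update x j ⁅y, x j⁆ = update x i ⁅y, x i⁆ ∘ Equiv.swap i j := by
        ext k
        rcases eq_or_ne k i with rfl | hi
        · simp [hne, hij, hne.symm]
        · rcases eq_or_ne k j with rfl | hj
          · simp [hij]
          · simp [Equiv.swap_apply_of_ne_of_ne hi hj, hi, hj]
      rw [this, ω.map_swap _ hne, add_neg_cancel]
    · intro k hk
      simp only [Finset.mem_erase, Finset.mem_univ, and_true] at hk
      refine ω.map_eq_zero_of_eq _ ?_ hne
      rw [update_of_ne hk.2.symm, update_of_ne hk.1.symm, hij]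

lemma lieDer_apply {n : ℕ} (y : 𝔤) (ω : 𝔤 [⋀^Fin n]→ₗ[A] N) (x : Fin n → 𝔤) :
    lieDer y ω x = ⁅y, ω x⁆ - ∑ j, ω (update x j ⁅y, x j⁆) := rfl

/-- Contraction of a form with a vector. -/
def ι {n : ℕ} (y : 𝔤) (ω : 𝔤 [⋀^Fin (n + 1)]→ₗ[A] N) : 𝔤 [⋀^Fin n]→ₗ[A] N := ω.curryLeft y

lemma ι_apply {n : ℕ} (y : 𝔤) (ω : 𝔤 [⋀^Fin (n + 1)]→ₗ[A] N) (x : Fin n → 𝔤) :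
    ι y ω x = ω (cons y x) := rfl

lemma map_update_cons {n : ℕ} (ω : 𝔤 [⋀^Fin (n + 1)]→ₗ[A] N) (x : Fin (n + 1) → 𝔤)
    (j : Fin (n + 1)) (z : 𝔤) :
    ω (update x j z) = (-1 : ℤ) ^ (j : ℕ) • ω (cons z (j.removeNth x)) := by
  rw [← insertNth_removeNth, AlternatingMap.map_insertNth]
  rfl

/-- Cartan's formula in degree zero. -/
lemma dFun_zero (ω : 𝔤 [⋀^Fin 0]→ₗ[A] N) (x : Fin 1 → 𝔤) :
    dFun ω x = ⁅x 0, ω ![]⁆ := by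
  simp [dFun, Subsingleton.elim (removeNth (0 : Fin 1) x) ![]]

lemma dFun_cons_zero (ω : 𝔤 [⋀^Fin 0]→ₗ[A] N) (y : 𝔤) (x : Fin 0 → 𝔤) :
    dFun ω (cons y x) = lieDer y ω x := by
  rw [dFun_zero, lieDer_apply, Subsingleton.elim x ![]]
  simp

lemma removeNth_succ_cons {n : ℕ} (y : 𝔤) (x : Fin (n + 1) → 𝔤) (j : Fin (n + 1)) :
    removeNth j.succ (cons y x : Fin (n + 2) → 𝔤) = cons y (removeNth j x) := by
  ext i
  refine Fin.cases ?_ (fun i => ?_) i <;> simp [removeNth]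

/-- Cartan's formula. -/
lemma dFun_cons {n : ℕ} (ω : 𝔤 [⋀^Fin (n + 1)]→ₗ[A] N) (y : 𝔤) (x : Fin (n + 1) → 𝔤) :
    dFun ω (cons y x) = lieDer y ω x - dFun (ι y ω) x := by
  have e : removeNth (0 : Fin (n + 2)) (cons y x : Fin (n + 2) → 𝔤) = x := by
    ext i; simp [removeNth]
  have h0 : ∑ k : Fin (n + 1) with k.castSucc < 0, ω (update (removeNth (0 : Fin (n + 2))
      (cons y x : Fin (n + 2) → 𝔤)) k ⁅(cons y x : Fin (n + 2) → 𝔤) k.castSucc, y⁆) = 0 := by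
    simp
  have h : ∀ (F : Fin (n + 1) → N) (j : Fin (n + 1)),
      ∑ k : Fin (n + 1) with k.castSucc < j.succ, F k =
      F 0 + ∑ k : Fin n with k.castSucc < j, F k.succ := by
    intro F j
    simp only [Finset.sum_filter]
    rw [sum_univ_succ]
    simp
  rw [dFun, sum_univ_succ, lieDer_apply, sub_sub]
  simp only [val_zero, pow_zero, one_smul, cons_zero, val_succ, pow_succ, mul_neg, mul_one,
    neg_smul, Finset.sum_neg_distrib, cons_succ, removeNth_succ_cons]
  rw [h0, e, add_zero, ← sub_eq_add_neg]
  congr 1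
  rw [dFun, ← Finset.sum_add_distrib]
  refine Finset.sum_congr rfl fun j _ => ?_
  rw [h, castSucc_zero, cons_zero, map_update_cons ω x j, ← smul_add]
  congr 1
  rw [ι_apply, add_left_comm]
  congr 1
  · congr 1
    ext i
    refine Fin.cases ?_ (fun i => ?_) i <;> simp
  · congr 1
    refine Finset.sum_congr rfl fun k _ => ?_
    rw [ι_apply, cons_update]
    simp

lemma lieDer_cons {n : ℕ} (ω : 𝔤 [⋀^Fin (n + 1)]→ₗ[A] N) (z y : 𝔤) (x : Fin n → 𝔤) :
    lieDer z ω (cons y x) = lieDer z (ι y ω) x - ω (cons ⁅z, y⁆ x) := by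
  rw [lieDer_apply, lieDer_apply, sum_univ_succ, ι_apply]
  simp only [ι_apply, cons_update, cons_zero, cons_succ]
  have : update (cons y x : Fin (n + 1) → 𝔤) 0 ⁅z, y⁆ = cons ⁅z, y⁆ x := by
    ext i
    refine Fin.cases ?_ (fun i => ?_) i <;> simp
  rw [this]
  abel

lemma ι_lieDer {n : ℕ} (ω : 𝔤 [⋀^Fin (n + 1)]→ₗ[A] N) (z y : 𝔤) :
    ι y (lieDer z ω) = lieDer z (ι y ω) - ι ⁅z, y⁆ ω := by
  ext x
  exact lieDer_cons ω z y x

lemma ext_ι {n : ℕ} {ω η : 𝔤 [⋀^Fin (n + 1)]→ₗ[A] N} (h : ∀ y, ι y ω = ι y η) : ω = η := by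
  ext x
  have := DFunLike.congr_fun (h (x 0)) (tail x)
  rwa [ι_apply, ι_apply, cons_self_tail] at this

lemma ι_add {n : ℕ} (y : 𝔤) (ω η : 𝔤 [⋀^Fin (n + 1)]→ₗ[A] N) : ι y (ω + η) = ι y ω + ι y η := rfl

lemma ι_sub {n : ℕ} (y : 𝔤) (ω η : 𝔤 [⋀^Fin (n + 1)]→ₗ[A] N) : ι y (ω - η) = ι y ω - ι y η := rfl

lemma ι_zero {n : ℕ} (y : 𝔤) : ι y (0 : 𝔤 [⋀^Fin (n + 1)]→ₗ[A] N) = 0 := rfl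

lemma ι_add_left {n : ℕ} (y z : 𝔤) (ω : 𝔤 [⋀^Fin (n + 1)]→ₗ[A] N) :
    ι (y + z) ω = ι y ω + ι z ω := map_add ω.curryLeft y z

lemma ι_sub_left {n : ℕ} (y z : 𝔤) (ω : 𝔤 [⋀^Fin (n + 1)]→ₗ[A] N) :
    ι (y - z) ω = ι y ω - ι z ω := map_sub ω.curryLeft y z

lemma ι_smul_left {n : ℕ} (a : A) (y : 𝔤) (ω : 𝔤 [⋀^Fin (n + 1)]→ₗ[A] N) :
    ι (a • y) ω = a • ι y ω := map_smul ω.curryLeft a y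

lemma ι_ι {n : ℕ} (y : 𝔤) (ω : 𝔤 [⋀^Fin (n + 2)]→ₗ[A] N) : ι y (ι y ω) = 0 := by
  ext x
  exact ω.map_eq_zero_of_eq (i := 0) (j := 1) _ rfl (by simp)

lemma lieDer_sub {n : ℕ} (y : 𝔤) (ω η : 𝔤 [⋀^Fin n]→ₗ[A] N) :
    lieDer y (ω - η) = lieDer y ω - lieDer y η := by
  ext x
  simp only [lieDer_apply, AlternatingMap.sub_apply, lie_sub, Finset.sum_sub_distrib]
  abel

lemma lieDer_zero {n : ℕ} (y : 𝔤) : lieDer y (0 : 𝔤 [⋀^Fin n]→ₗ[A] N) = 0 := by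
  ext x
  simp [lieDer_apply]

lemma lieDer_lie {n : ℕ} (y z : 𝔤) (ω : 𝔤 [⋀^Fin n]→ₗ[A] N) :
    lieDer ⁅y, z⁆ ω = lieDer y (lieDer z ω) - lieDer z (lieDer y ω) := by
  induction n with
  | zero =>
    ext x
    simp [lieDer_apply]
  | succ n ih =>
    refine ext_ι fun w => ?_
    simp only [ι_sub, ι_lieDer, lieDer_sub, ih]
    rw [lie_lie y z w, ι_sub_left]
    abel

lemma dFun_add {n : ℕ} (ω η : 𝔤 [⋀^Fin n]→ₗ[A] N) (x : Fin (n + 1) → 𝔤) :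
    dFun (ω + η) x = dFun ω x + dFun η x := by
  simp only [dFun, AlternatingMap.add_apply, lie_add, Finset.sum_add_distrib, smul_add]
  abel

/-- Additivity of the Lie derivative in the vector. -/
lemma lieDer_add_left {n : ℕ} (y z : 𝔤) (ω : 𝔤 [⋀^Fin n]→ₗ[A] N) (x : Fin n → 𝔤) :
    lieDer (y + z) ω x = lieDer y ω x + lieDer z ω x := by
  simp only [lieDer_apply, add_lie, ω.map_update_add, Finset.sum_add_distrib]
  abel

lemma dFun_smul {n : ℕ} (a : A) (ω : 𝔤 [⋀^Fin n]→ₗ[A] N) (x : Fin (n + 1) → 𝔤) :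
    dFun (a • ω) x = a • dFun ω x +
      ∑ l : Fin (n + 1), (-1 : ℤ) ^ (l : ℕ) • ⁅x l, a⁆ • ω (l.removeNth x) := by
  simp only [dFun, AlternatingMap.smul_apply, LieRinehartModule.lie_smul, Finset.smul_sum,
    ← Finset.sum_add_distrib]
  refine Finset.sum_congr rfl fun l _ => ?_
  simp only [smul_add, Finset.smul_sum, smul_comm a]
  abel

lemma lieDer_smul_left {n : ℕ} (a : A) (y : 𝔤) (ω : 𝔤 [⋀^Fin n]→ₗ[A] N) (x : Fin n → 𝔤) :
    lieDer (a • y) ω x = a • lieDer y ω x + ∑ j, ⁅x j, a⁆ • ω (update x j y) := by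
  have h : ∀ z : 𝔤, ⁅a • y, z⁆ = a • ⁅y, z⁆ - ⁅z, a⁆ • y := fun z => by
    rw [← lie_skew, LieRinehartRing.leibniz_smul_right, ← lie_skew z y, smul_neg]
    abel
  simp only [lieDer_apply, h, LieRinehartModule.smul_lie, sub_eq_add_neg, ω.map_update_add,
    ← neg_smul, ω.map_update_smul, Finset.sum_add_distrib, smul_add]
  simp only [neg_smul, Finset.sum_neg_distrib, smul_neg, Finset.smul_sum]
  abel

lemma exists_alternating {n : ℕ} (F : 𝔤 →ₗ[A] 𝔤 [⋀^Fin n]→ₗ[A] N)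
    (hF : ∀ (x : Fin n → 𝔤) (j : Fin n), F (x j) x = 0) :
    ∃ η : 𝔤 [⋀^Fin (n + 1)]→ₗ[A] N, ∀ y x, η (cons y x) = F y x := by
  refine ⟨{ LinearMap.uncurryLeft (M := fun _ : Fin (n + 1) => 𝔤)
    (AlternatingMap.toMultilinearMapLM (S := A) ∘ₗ F) with
    map_eq_zero_of_eq' := ?_ }, fun y x => ?_⟩
  · intro v i j hij hne
    change F (v 0) (tail v) = 0
    induction i using Fin.cases with
    | zero =>
      induction j using Fin.cases with
      | zero => exact absurd rfl hne
      | succ j => rw [hij]; exact hF (tail v) j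
    | succ i =>
      induction j using Fin.cases with
      | zero => rw [← hij]; exact hF (tail v) i
      | succ j =>
        exact (F (v 0)).map_eq_zero_of_eq (tail v) hij fun h => hne (congrArg _ h)
  · rfl

lemma dFun_of_zero {n : ℕ} (x : Fin (n + 1) → 𝔤) :
    dFun (0 : 𝔤 [⋀^Fin n]→ₗ[A] N) x = 0 := by
  simp [dFun]

lemma ι_dFun_ι {n : ℕ} (y : 𝔤) (ω : 𝔤 [⋀^Fin (n + 1)]→ₗ[A] N) (x : Fin n → 𝔤) :
    dFun (ι y ω) (cons y x) = lieDer y (ι y ω) x := by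
  cases n with
  | zero => exact dFun_cons_zero _ _ _
  | succ n => rw [dFun_cons, ι_ι, dFun_of_zero, sub_zero]

lemma sum_update_eq {n : ℕ} (ω : 𝔤 [⋀^Fin (n + 1)]→ₗ[A] N) (a : A) (y : 𝔤)
    (x : Fin (n + 1) → 𝔤) :
    ∑ j, ⁅x j, a⁆ • ω (update x j y) =
      ∑ l : Fin (n + 1), (-1 : ℤ) ^ (l : ℕ) • ⁅x l, a⁆ • ι y ω (l.removeNth x) := by
  refine Finset.sum_congr rfl fun j _ => ?_
  rw [map_update_cons, smul_comm, ι_apply]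

/-- The differential of a form is a form. -/
lemma exists_d {n : ℕ} (ω : 𝔤 [⋀^Fin n]→ₗ[A] N) :
    ∃ η : 𝔤 [⋀^Fin (n + 1)]→ₗ[A] N, ∀ x, η x = dFun ω x := by
  induction n with
  | zero =>
    obtain ⟨η, hη⟩ := exists_alternating (A := A) (N := N)
      { toFun := fun y => lieDer y ω
        map_add' := fun y z => by ext x; exact lieDer_add_left y z ω x
        map_smul' := fun a y => by
          ext x
          exact (lieDer_smul_left a y ω x).trans (by simp) } (fun x j => j.elim0)
    refine ⟨η, fun x => ?_⟩
    rw [← cons_self_tail x, hη, dFun_cons_zero]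
    rfl
  | succ n ih =>
    choose d hd using fun ω : 𝔤 [⋀^Fin n]→ₗ[A] N => ih ω
    obtain ⟨η, hη⟩ := exists_alternating (A := A) (N := N)
      { toFun := fun y => lieDer y ω - d (ι y ω)
        map_add' := fun y z => by
          ext x
          simp only [AlternatingMap.sub_apply, AlternatingMap.add_apply, hd, lieDer_add_left,
            ι_add_left, dFun_add]
          abel
        map_smul' := fun a y => by
          ext x
          simp only [AlternatingMap.sub_apply, AlternatingMap.smul_apply, hd, lieDer_smul_left,
            ι_smul_left, dFun_smul, sum_update_eq, RingHom.id_apply, smul_sub]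
          abel }
      (fun x j => by
        change (lieDer (x j) ω - d (ι (x j) ω)) x = 0
        have h := map_update_cons (lieDer (x j) ω - d (ι (x j) ω)) x j (x j)
        rw [update_eq_self] at h
        rw [h, AlternatingMap.sub_apply, hd, ι_dFun_ι, lieDer_cons, lie_self]
        have : ω (cons 0 (j.removeNth x)) = 0 := ω.map_coord_zero 0 (by simp)
        rw [this, sub_zero, sub_self, smul_zero])
    refine ⟨η, fun x => ?_⟩
    rw [← cons_self_tail x, hη, dFun_cons, ← hd]
    rfl

/-- The Chevalley--Eilenberg differential `d` of the Lie--Rinehart algebra `(A, 𝔤)` with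
coefficients in `N`, on `A`-multilinear alternating forms. -/
def d {n : ℕ} : (𝔤 [⋀^Fin n]→ₗ[A] N) →+ (𝔤 [⋀^Fin (n + 1)]→ₗ[A] N) :=
  AddMonoidHom.mk' (fun ω =>
    { toFun := dFun ω
      map_update_add' := by
        obtain ⟨η, hη⟩ := exists_d ω
        intro _ x i u v
        rw [← hη, ← hη, ← hη, η.map_update_add]
      map_update_smul' := by
        obtain ⟨η, hη⟩ := exists_d ω
        intro _ x i a u
        rw [← hη, ← hη, η.map_update_smul]
      map_eq_zero_of_eq' := by
        obtain ⟨η, hη⟩ := exists_d ω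
        intro x i j hij hne
        rw [← hη, η.map_eq_zero_of_eq x hij hne] })
    (fun ω η => by ext x; exact dFun_add ω η x)

lemma d_apply {n : ℕ} (ω : 𝔤 [⋀^Fin n]→ₗ[A] N) (x : Fin (n + 1) → 𝔤) : d ω x = dFun ω x := rfl

lemma ι_d_zero (ω : 𝔤 [⋀^Fin 0]→ₗ[A] N) (y : 𝔤) : ι y (d ω) = lieDer y ω := by
  ext x
  exact dFun_cons_zero ω y x

lemma ι_d {n : ℕ} (ω : 𝔤 [⋀^Fin (n + 1)]→ₗ[A] N) (y : 𝔤) :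
    ι y (d ω) = lieDer y ω - d (ι y ω) := by
  ext x
  exact dFun_cons ω y x

lemma lieDer_d {n : ℕ} (y : 𝔤) (ω : 𝔤 [⋀^Fin n]→ₗ[A] N) : lieDer y (d ω) = d (lieDer y ω) := by
  induction n with
  | zero =>
    refine ext_ι fun z => ?_
    rw [ι_lieDer, ι_d_zero, ι_d_zero, ι_d_zero, lieDer_lie]
    abel
  | succ n ih =>
    refine ext_ι fun z => ?_
    rw [ι_lieDer, ι_d, ι_d, ι_d, ι_lieDer, lieDer_lie, lieDer_sub, ih, map_sub]
    abel

/-- The Chevalley--Eilenberg differential squares to zero. -/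
lemma d_d {n : ℕ} (ω : 𝔤 [⋀^Fin n]→ₗ[A] N) : d (d ω) = 0 := by
  induction n with
  | zero =>
    refine ext_ι fun y => ?_
    rw [ι_d, ι_d_zero, lieDer_d, sub_self, ι_zero]
  | succ n ih =>
    refine ext_ι fun y => ?_
    rw [ι_d, ι_d, map_sub, ih, lieDer_d, sub_zero, sub_self, ι_zero]

end CE

end ChevalleyEilenberg

section Wedge

variable {A 𝔤 N : Type*} [CommRing A] [LieRing 𝔤] [Module A 𝔤] [AddCommGroup N] [Module A N]

namespace CE

/-- The wedge product of a form with values in functions and a form with values in `N`, given by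
the sum over shuffles
`(α ∧ ω)(x₁, …, xₖ₊ₘ) = ∑ sgn(σ) α(x_σ(1), …, x_σ(k)) ω(x_σ(k+1), …, x_σ(k+m))`. -/
def wedge {k m : ℕ} (α : 𝔤 [⋀^Fin k]→ₗ[A] A) (ω : 𝔤 [⋀^Fin m]→ₗ[A] N) :
    𝔤 [⋀^Fin (k + m)]→ₗ[A] N :=
  ((TensorProduct.lid A N).toLinearMap.compAlternatingMap
    (AlternatingMap.domCoprod α ω)).domDomCongr finSumFinEquiv

/-- Naturality of the wedge product. -/
lemma wedge_map {A' 𝔤' N' : Type*} [CommRing A'] [LieRing 𝔤'] [Module A' 𝔤'] [AddCommGroup N']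
    [Module A' N'] (r : A →+* A') (g : 𝔤 → 𝔤') (h : N →+ N')
    (hs : ∀ a n, h (a • n) = r a • h n) {k m : ℕ} (α : 𝔤 [⋀^Fin k]→ₗ[A] A)
    (ω : 𝔤 [⋀^Fin m]→ₗ[A] N) (α' : 𝔤' [⋀^Fin k]→ₗ[A'] A') (ω' : 𝔤' [⋀^Fin m]→ₗ[A'] N')
    (hα : ∀ x, r (α x) = α' (fun i => g (x i))) (hω : ∀ x, h (ω x) = ω' (fun i => g (x i)))
    (x : Fin (k + m) → 𝔤) : h (wedge α ω x) = wedge α' ω' (fun i => g (x i)) := by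
  change h (TensorProduct.lid A N ((∑ σ : Equiv.Perm.ModSumCongr (Fin k) (Fin m),
      AlternatingMap.domCoprod.summand α ω σ) (fun i => x (finSumFinEquiv i)))) =
    TensorProduct.lid A' N' ((∑ σ : Equiv.Perm.ModSumCongr (Fin k) (Fin m),
      AlternatingMap.domCoprod.summand α' ω' σ) (fun i => g (x (finSumFinEquiv i))))
  rw [sum_apply, sum_apply, map_sum, map_sum, map_sum]
  refine Finset.sum_congr rfl fun σ _ => ?_
  induction σ using Quotient.inductionOn' with | _ σ
  rw [AlternatingMap.domCoprod.summand_mk'', AlternatingMap.domCoprod.summand_mk'']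
  rcases Int.units_eq_one_or (Equiv.Perm.sign σ) with hσ | hσ <;>
    simp [hσ, MultilinearMap.domCoprod_apply, hs, hα, hω]

end CE

end Wedge

section Sheaves

open CategoryTheory TopologicalSpace Opposite
open scoped Manifold ContDiff

variable {EM : Type*} [NormedAddCommGroup EM] [NormedSpace ℝ EM] {HM : Type*} [TopologicalSpace HM]
  (I : ModelWithCorners ℝ EM HM) (M : Type) [TopologicalSpace M] [ChartedSpace HM M]

/-- The sheaf of rings `C^∞_M` of smooth real functions on `M`. -/
noncomputable abbrev CInf : TopCat.Sheaf RingCat.{0} (TopCat.of M) :=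
  (sheafCompose _ (forget₂ CommRingCat RingCat)).obj (smoothSheafCommRing I 𝓘(ℝ, ℝ) M ℝ)

/-- Sheaves of `C^∞_M`-modules. -/
abbrev SmoothModule := SheafOfModules.{0} (CInf I M)

/-- `C^∞_M` as a module over itself. -/
noncomputable abbrev structureSheaf : SmoothModule I M := SheafOfModules.unit (CInf I M)

variable {M}

/-- The ring `C^∞(U)` of sections of `C^∞_M` over `U`. -/
abbrev Fn (U : Opens M) : Type := C^∞⟮I, U; 𝓘(ℝ, ℝ), ℝ⟯

variable {I}

/-- The `C^∞(U)`-module of sections over `U` of a sheaf of `C^∞_M`-modules. -/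
def Sec (E : SmoothModule I M) (U : Opens M) : Type := E.val.obj (op U)

noncomputable instance (E : SmoothModule I M) (U : Opens M) : AddCommGroup (Sec E U) :=
  inferInstanceAs (AddCommGroup (E.val.obj (op U)))

noncomputable instance (E : SmoothModule I M) (U : Opens M) : Module (Fn I U) (Sec E U) :=
  inferInstanceAs (Module ((CInf I M).obj.obj (op U)) (E.val.obj (op U)))

/-- Restriction of functions. -/
noncomputable def resFn {U V : Opens M} (h : V ≤ U) : Fn I U →+* Fn I V :=
  ContMDiffMap.restrictRingHom I 𝓘(ℝ, ℝ) ℝ h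

/-- Restriction of sections. -/
noncomputable def res (E : SmoothModule I M) {U V : Opens M} (h : V ≤ U) : Sec E U →+ Sec E V :=
  AddMonoidHom.mk' (fun s => E.val.map (homOfLE h).op s)
    (fun s t => map_add (E.val.map (homOfLE h).op).hom s t)

lemma res_smul (E : SmoothModule I M) {U V : Opens M} (h : V ≤ U) (f : Fn I U) (s : Sec E U) :
    res E h (f • s) = resFn h f • res E h s :=
  E.val.map_smul (homOfLE h).op f s

lemma res_self (E : SmoothModule I M) {U : Opens M} (h : U ≤ U) (s : Sec E U) : res E h s = s :=
  CategoryTheory.congr_fun (E.val.presheaf.map_id (op U)) s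

lemma res_res (E : SmoothModule I M) {U V W : Opens M} (h : V ≤ U) (h' : W ≤ V) (s : Sec E U) :
    res E h' (res E h s) = res E (h'.trans h) s :=
  (E.val.map_comp_apply (homOfLE h).op (homOfLE h').op s).symm

lemma resFn_self {U : Opens M} (h : U ≤ U) (f : Fn I U) : resFn h f = f := rfl

lemma resFn_resFn {U V W : Opens M} (h : V ≤ U) (h' : W ≤ V) (f : Fn I U) :
    resFn h' (resFn h f) = resFn (h'.trans h) f := rfl

/-- Compatible sections of a sheaf glue uniquely. -/
lemma existsUnique_glue (E : SmoothModule I M) {ι : Type} (U : ι → Opens M) (V : Opens M)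
    (hU : ∀ i, U i ≤ V) (hcover : V ≤ iSup U) (s : ∀ i, Sec E (U i))
    (hs : ∀ i j, res E (inf_le_left : U i ⊓ U j ≤ U i) (s i) = res E inf_le_right (s j)) :
    ∃! t : Sec E V, ∀ i, res E (hU i) t = s i := by
  have := TopCat.Sheaf.existsUnique_gluing'
    (⟨E.val.presheaf, E.isSheaf⟩ : TopCat.Sheaf AddCommGrpCat (TopCat.of M)) U V
    (fun i => homOfLE (hU i)) hcover s (fun i j => hs i j)
  exact this

/-- Sections of a sheaf that agree on a cover agree. -/
lemma eq_of_res_eq (E : SmoothModule I M) {ι : Type} (U : ι → Opens M) (V : Opens M)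
    (hU : ∀ i, U i ≤ V) (hcover : V ≤ iSup U) (s t : Sec E V)
    (h : ∀ i, res E (hU i) s = res E (hU i) t) : s = t :=
  (existsUnique_glue E U V hU hcover (fun i => res E (hU i) t)
    (fun i j => by rw [res_res, res_res])).unique h (fun _ => rfl)

/-- A sheaf of `C^∞_M`-modules is locally free (of finite rank) if every point has an open
neighbourhood `U` over which it has a finite frame: finitely many sections over `U` whose
restrictions to any open `V ⊆ U` form a basis of the `C^∞(V)`-module of sections over `V`.
Such sheaves are the sheaves of smooth sections of smooth vector bundles. -/
def IsLocallyFree (E : SmoothModule I M) : Prop :=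
  ∀ x : M, ∃ U : Opens M, x ∈ U ∧ ∃ (n : ℕ) (b : Fin n → Sec E U), ∀ (V : Opens M) (h : V ≤ U),
    LinearIndependent (Fn I V) (fun i => res E h (b i)) ∧
      ⊤ ≤ Submodule.span (Fn I V) (Set.range fun i => res E h (b i))

variable (I M) in
/-- A Lie algebroid on `M`: a smooth vector bundle `L`, given by its locally free sheaf of smooth
sections, a Lie bracket on this sheaf, and a `C^∞_M`-linear anchor from it to the sheaf of vector
fields, given as derivations of smooth functions; the anchor is compatible with the Lie brackets,
and the bracket satisfies the Leibniz rule. -/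
structure LieAlgebroid where
  /-- the sheaf of sections of the vector bundle `L` -/
  bundle : SmoothModule I M
  isLocallyFree : IsLocallyFree bundle
  /-- the Lie bracket of sections -/
  bracket (U : Opens M) : Sec bundle U → Sec bundle U → Sec bundle U
  bracket_add (U : Opens M) (x y z : Sec bundle U) :
    bracket U x (y + z) = bracket U x y + bracket U x z
  add_bracket (U : Opens M) (x y z : Sec bundle U) :
    bracket U (x + y) z = bracket U x z + bracket U y z
  bracket_self (U : Opens M) (x : Sec bundle U) : bracket U x x = 0
  jacobi (U : Opens M) (x y z : Sec bundle U) :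
    bracket U x (bracket U y z) = bracket U (bracket U x y) z + bracket U y (bracket U x z)
  res_bracket {U V : Opens M} (h : V ≤ U) (x y : Sec bundle U) :
    res bundle h (bracket U x y) = bracket V (res bundle h x) (res bundle h y)
  /-- the anchor map -/
  anchor (U : Opens M) : Sec bundle U →ₗ[Fn I U] Derivation ℝ (Fn I U) (Fn I U)
  res_anchor {U V : Opens M} (h : V ≤ U) (x : Sec bundle U) (f : Fn I U) :
    resFn h (anchor U x f) = anchor V (res bundle h x) (resFn h f)
  anchor_bracket (U : Opens M) (x y : Sec bundle U) :
    anchor U (bracket U x y) = ⁅anchor U x, anchor U y⁆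
  leibniz (U : Opens M) (x y : Sec bundle U) (f : Fn I U) :
    bracket U x (f • y) = f • bracket U x y + anchor U x f • y

namespace LieAlgebroid

variable (L : LieAlgebroid I M)

noncomputable instance (U : Opens M) : LieRing (Sec L.bundle U) where
  bracket := L.bracket U
  add_lie := L.add_bracket U
  lie_add := L.bracket_add U
  lie_self := L.bracket_self U
  leibniz_lie := L.jacobi U

noncomputable instance (U : Opens M) : LieRingModule (Sec L.bundle U) (Fn I U) where
  bracket x f := L.anchor U x f
  add_lie x y f := by
    change L.anchor U (x + y) f = _
    rw [map_add]; rfl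
  lie_add x f g := map_add (L.anchor U x) f g
  leibniz_lie x y f := by
    change L.anchor U x (L.anchor U y f) =
      L.anchor U (L.bracket U x y) f + L.anchor U y (L.anchor U x f)
    rw [L.anchor_bracket, Derivation.commutator_apply]
    abel

lemma lie_def (U : Opens M) (x y : Sec L.bundle U) : ⁅x, y⁆ = L.bracket U x y := rfl

lemma lie_fn_def (U : Opens M) (x : Sec L.bundle U) (f : Fn I U) : ⁅x, f⁆ = L.anchor U x f := rfl

instance (U : Opens M) : LieRinehartRing (Fn I U) (Sec L.bundle U) where
  lie_smul_eq_mul' f g x := by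
    change L.anchor U (f • x) g = f * L.anchor U x g
    rw [map_smul]; rfl
  leibniz_mul_right' x f g := by
    change L.anchor U x (f * g) = f • L.anchor U x g + L.anchor U x f * g
    rw [Derivation.leibniz, mul_comm (L.anchor U x f)]
    rfl
  leibniz_smul_right' x y f := L.leibniz U x y f

/-- The enveloping algebra over `U`. The sheaf of algebras `𝒰_L` is the sheafification of
`U ↦ L.env U`. -/
abbrev env (U : Opens M) : Type := Env (Fn I U) (Sec L.bundle U)

/-- Restriction of elements of the enveloping algebra. -/
noncomputable def resEnv {U V : Opens M} (h : V ≤ U) : L.env U →+* L.env V :=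
  Env.map (resFn h) (res L.bundle h) (res_smul L.bundle h) (L.res_bracket h) (L.res_anchor h)

variable {U V W : Opens M}

@[simp] lemma resEnv_fn (h : V ≤ U) (f : Fn I U) :
    L.resEnv h (Env.fn f) = Env.fn (resFn h f) :=
  Env.map_fn _ _ _ _ _ f

@[simp] lemma resEnv_vec (h : V ≤ U) (x : Sec L.bundle U) :
    L.resEnv h (Env.vec (A := Fn I U) x) = Env.vec (A := Fn I V) (res L.bundle h x) :=
  Env.map_vec _ _ _ _ _ x

lemma resEnv_smul (h : V ≤ U) (f : Fn I U) (D : L.env U) :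
    L.resEnv h (f • D) = resFn h f • L.resEnv h D := by
  rw [Env.smul_eq, map_mul, resEnv_fn, Env.smul_eq]

lemma resEnv_self (h : U ≤ U) (D : L.env U) : L.resEnv h D = D := by
  suffices L.resEnv h = RingHom.id _ from DFunLike.congr_fun this D
  refine Env.ringHom_ext (fun a => ?_) (fun x => ?_)
  · rw [resEnv_fn]; rfl
  · rw [resEnv_vec, res_self]; rfl

lemma resEnv_resEnv (h : V ≤ U) (h' : W ≤ V) (D : L.env U) :
    L.resEnv h' (L.resEnv h D) = L.resEnv (h'.trans h) D := by
  suffices (L.resEnv h').comp (L.resEnv h) = L.resEnv (h'.trans h) from DFunLike.congr_fun this D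
  refine Env.ringHom_ext (fun a => ?_) (fun x => ?_)
  · simp [resFn_resFn]
  · simp [res_res]

end LieAlgebroid

/-- A left `𝒰_L`-module: a sheaf of `C^∞_M`-modules with a flat `L`-connection
`act U x s = ∇_x s`. -/
structure LModule (L : LieAlgebroid I M) where
  /-- the underlying sheaf of `C^∞_M`-modules -/
  sheaf : SmoothModule I M
  /-- the connection -/
  act (U : Opens M) : Sec L.bundle U → Sec sheaf U → Sec sheaf U
  add_act (U : Opens M) (x y : Sec L.bundle U) (s : Sec sheaf U) :
    act U (x + y) s = act U x s + act U y s
  act_add (U : Opens M) (x : Sec L.bundle U) (s t : Sec sheaf U) :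
    act U x (s + t) = act U x s + act U x t
  smul_act (U : Opens M) (f : Fn I U) (x : Sec L.bundle U) (s : Sec sheaf U) :
    act U (f • x) s = f • act U x s
  act_smul (U : Opens M) (x : Sec L.bundle U) (f : Fn I U) (s : Sec sheaf U) :
    act U x (f • s) = f • act U x s + L.anchor U x f • s
  act_act (U : Opens M) (x y : Sec L.bundle U) (s : Sec sheaf U) :
    act U x (act U y s) = act U (L.bracket U x y) s + act U y (act U x s)
  res_act {U V : Opens M} (h : V ≤ U) (x : Sec L.bundle U) (s : Sec sheaf U) :
    res sheaf h (act U x s) = act V (res L.bundle h x) (res sheaf h s)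

namespace LModule

variable {L : LieAlgebroid I M} (N : LModule L)

noncomputable instance (U : Opens M) : LieRingModule (Sec L.bundle U) (Sec N.sheaf U) where
  bracket := N.act U
  add_lie := N.add_act U
  lie_add := N.act_add U
  leibniz_lie := N.act_act U

instance (U : Opens M) : LieRinehartModule (Fn I U) (Sec L.bundle U) (Sec N.sheaf U) where
  smul_lie := N.smul_act U
  lie_smul := N.act_smul U

end LModule

/-! ### Forms and the de Rham complex -/

/-- The group of sections over `U` of the sheaf `Λᵐ L^∨ ⊗ E` of `L`-forms of degree `m` with values
in `E`: families, compatible with restrictions, of `C^∞(V)`-multilinear alternating maps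
`L(V)ᵐ → E(V)` for the open sets `V ⊆ U`. -/
def Form (L : LieAlgebroid I M) (E : SmoothModule I M) (m : ℕ) (U : Opens M) :
    AddSubgroup (∀ V : {V : Opens M // V ≤ U}, Sec L.bundle V.1 [⋀^Fin m]→ₗ[Fn I V.1] Sec E V.1) where
  carrier := {θ | ∀ (V W : {V : Opens M // V ≤ U}) (h : W.1 ≤ V.1) (x : Fin m → Sec L.bundle V.1),
    res E h (θ V x) = θ W (fun i => res L.bundle h (x i))}
  zero_mem' V W h x := map_zero _
  add_mem' {θ η} hθ hη V W h x := by
    change res E h (θ V x + η V x) = _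
    rw [map_add, hθ V W h, hη V W h]; rfl
  neg_mem' {θ} hθ V W h x := by
    change res E h (- θ V x) = _
    rw [map_neg, hθ V W h]; rfl

namespace Form

variable {L : LieAlgebroid I M} {E : SmoothModule I M} {m k : ℕ} {U U' : Opens M}

/-- Restriction of forms. -/
def restrict (h : U' ≤ U) : Form L E m U →+ Form L E m U' where
  toFun θ := ⟨fun V => θ.1 ⟨V.1, le_trans V.2 h⟩, fun V W hVW x =>
    θ.2 ⟨V.1, le_trans V.2 h⟩ ⟨W.1, le_trans W.2 h⟩ hVW x⟩
  map_zero' := rfl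
  map_add' _ _ := rfl

/-- The differential of forms with values in a left `𝒰_L`-module. -/
noncomputable def d {N : LModule L} : Form L N.sheaf m U →+ Form L N.sheaf (m + 1) U where
  toFun θ := ⟨fun V => CE.d (θ.1 V), fun V W h x => by
    rw [CE.d_apply, CE.d_apply, CE.dFun, CE.dFun, map_sum]
    refine Finset.sum_congr rfl fun l _ => ?_
    rw [map_zsmul, map_add, map_sum]
    have h1 : ∀ (y : Sec L.bundle V.1) (s : Sec N.sheaf V.1),
      res N.sheaf h ⁅y, s⁆ = ⁅res L.bundle h y, res N.sheaf h s⁆ := N.res_act h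
    have h2 : ∀ (y z : Sec L.bundle V.1),
      res L.bundle h ⁅y, z⁆ = ⁅res L.bundle h y, res L.bundle h z⁆ := L.res_bracket h
    rw [h1, θ.2 V W h]
    congr 2
    refine Finset.sum_congr rfl fun k _ => ?_
    rw [θ.2 V W h, ← h2]
    congr 1
    ext i
    rcases eq_or_ne i k with rfl | hi
    · simp
    · simp [hi, Fin.removeNth]⟩
  map_zero' := Subtype.ext (funext fun V => map_zero CE.d)
  map_add' θ η := Subtype.ext (funext fun V => map_add CE.d (θ.1 V) (η.1 V))

lemma d_d {N : LModule L} (θ : Form L N.sheaf m U) : d (d θ) = 0 :=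
  Subtype.ext (funext fun V => CE.d_d (θ.1 V))

/-- The wedge product of an `L`-form (with values in functions) and an `L`-form with values in
`E`. -/
noncomputable def wedge (α : Form L (structureSheaf I M) k U) (θ : Form L E m U) :
    Form L E (k + m) U :=
  ⟨fun V => CE.wedge (A := Fn I V.1) (N := Sec E V.1) (α.1 V) (θ.1 V), fun V W h x => by
    exact CE.wedge_map (A := Fn I V.1) (A' := Fn I W.1) (resFn h) (res L.bundle h) (res E h)
      (res_smul E h) (α.1 V) (θ.1 V) (α.1 W) (θ.1 W) (α.2 V W h) (θ.2 V W h) x⟩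

end Form

end Sheaves

section Jets

open CategoryTheory TopologicalSpace Opposite
open scoped Manifold ContDiff TensorProduct

variable {EM : Type*} [NormedAddCommGroup EM] [NormedSpace ℝ EM] {HM : Type*} [TopologicalSpace HM]
  {I : ModelWithCorners ℝ EM HM} {M : Type} [TopologicalSpace M] [ChartedSpace HM M]

/-- The complex `N(U) → (L^∨ ⊗ N)(U) → (Λ² L^∨ ⊗ N)(U) → ⋯` of `N`-valued `L`-forms over `U`. -/
noncomputable def dRObj (L : LieAlgebroid I M) (N : LModule L) (U : Opens M) :
    CochainComplex AddCommGrpCat.{0} ℕ :=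
  CochainComplex.of (fun m => AddCommGrpCat.of (Form L N.sheaf m U))
    (fun _ => AddCommGrpCat.ofHom Form.d)
    (fun _ => AddCommGrpCat.hom_ext (AddMonoidHom.ext fun θ => Form.d_d θ))

lemma dRObj_d (L : LieAlgebroid I M) (N : LModule L) (U : Opens M) (m : ℕ) :
    (dRObj L N U).d m (m + 1) = AddCommGrpCat.ofHom Form.d :=
  CochainComplex.of_d (fun m => AddCommGrpCat.of (Form L N.sheaf m U))
    (fun _ => AddCommGrpCat.ofHom Form.d) m

/-- The de Rham functor: the complex of presheaves `N → L^∨ ⊗ N → Λ² L^∨ ⊗ N → ⋯` of `N`-valued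
`L`-forms (each of its terms is a sheaf), for a left `𝒰_L`-module `N`. -/
noncomputable def dR (L : LieAlgebroid I M) (N : LModule L) :
    (Opens M)ᵒᵖ ⥤ CochainComplex AddCommGrpCat.{0} ℕ where
  obj U := dRObj L N U.unop
  map {U V} i := CochainComplex.ofHom
    (fun m => AddCommGrpCat.ofHom (Form.restrict (leOfHom i.unop))) (fun m => by
      rw [dRObj_d, dRObj_d]
      refine AddCommGrpCat.hom_ext (AddMonoidHom.ext fun θ => ?_)
      rfl)
  map_id U := by
    ext m θ
    rfl
  map_comp f g := by
    ext m θ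
    rfl

/-- The group of sections over `U` of `J_L(E) = Hom_{C^∞}(𝒰_L, E)`: families, compatible with
restrictions, of left `C^∞(V)`-linear maps from the enveloping algebra over `V` to `E(V)`, for the
open sets `V ⊆ U`. (As `E` is a sheaf, these are the morphisms to `E|_U` from the sheafification
`𝒰_L|_U` of the presheaf of enveloping algebras.) -/
def Jet (L : LieAlgebroid I M) (E : SmoothModule I M) (U : Opens M) :
    AddSubgroup (∀ V : {V : Opens M // V ≤ U}, L.env V.1 →ₗ[Fn I V.1] Sec E V.1) where
  carrier := {φ | ∀ (V W : {V : Opens M // V ≤ U}) (h : W.1 ≤ V.1) (D : L.env V.1),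
    res E h (φ V D) = φ W (L.resEnv h D)}
  zero_mem' V W h x := map_zero _
  add_mem' {φ ψ} hφ hψ V W h x := by
    change res E h (φ V x + ψ V x) = _
    rw [map_add, hφ V W h, hψ V W h]; rfl
  neg_mem' {φ} hφ V W h x := by
    change res E h (- φ V x) = _
    rw [map_neg, hφ V W h]; rfl

namespace Jet

variable {L : LieAlgebroid I M} {E : SmoothModule I M} {U U' U'' : Opens M}

@[ext] lemma ext' {φ ψ : Jet L E U} (h : ∀ V D, φ.1 V D = ψ.1 V D) : φ = ψ :=
  Subtype.ext (funext fun V => LinearMap.ext (h V))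

/-- Restriction of jets. -/
def restrict (h : U' ≤ U) : Jet L E U →+ Jet L E U' where
  toFun φ := ⟨fun V => φ.1 ⟨V.1, le_trans V.2 h⟩, fun V W hVW x =>
    φ.2 ⟨V.1, le_trans V.2 h⟩ ⟨W.1, le_trans W.2 h⟩ hVW x⟩
  map_zero' := rfl
  map_add' _ _ := rfl

/-- The `C^∞`-module structure of jets used for the de Rham complex: `(f φ)(D) = φ(D f)`. -/
noncomputable instance : SMul (Fn I U) (Jet L E U) where
  smul f φ := ⟨fun V => (φ.1 V).comp (Env.mulFn (resFn V.2 f)), fun V W h D => by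
    change res E h (φ.1 V (D * Env.fn _)) = φ.1 W (L.resEnv h D * Env.fn _)
    rw [φ.2 V W h, map_mul, L.resEnv_fn, resFn_resFn]⟩

lemma smul_apply (f : Fn I U) (φ : Jet L E U) (V : {V : Opens M // V ≤ U}) (D : L.env V.1) :
    (f • φ).1 V D = φ.1 V (D * Env.fn (resFn V.2 f)) := rfl

lemma add_apply (φ ψ : Jet L E U) (V : {V : Opens M // V ≤ U}) (D : L.env V.1) :
    (φ + ψ).1 V D = φ.1 V D + ψ.1 V D := rfl

noncomputable instance : Module (Fn I U) (Jet L E U) where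
  one_smul φ := by
    ext V D
    rw [smul_apply, map_one, map_one, mul_one]
  mul_smul f g φ := by
    ext V D
    rw [smul_apply, smul_apply, smul_apply, (resFn V.2).map_mul, Env.fn.map_mul, mul_assoc]
  smul_zero f := rfl
  smul_add f φ ψ := rfl
  add_smul f g φ := by
    ext V D
    rw [smul_apply, add_apply, smul_apply, smul_apply, map_add, map_add, mul_add, map_add]
  zero_smul φ := by
    ext V D
    rw [smul_apply, map_zero, map_zero, mul_zero, map_zero]
    rfl

lemma eval_smul (f : Fn I U) (φ : Jet L E U) :
    (f • φ).1 ⟨U, le_rfl⟩ 1 = f • φ.1 ⟨U, le_rfl⟩ 1 := by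
  rw [smul_apply, one_mul, resFn_self, ← mul_one (Env.fn f), ← Env.smul_eq, map_smul]

end Jet

variable (L : LieAlgebroid I M) (E : SmoothModule I M)

/-- The presheaf of abelian groups underlying the sheaf of jets. -/
noncomputable def jetPresheaf : (Opens M)ᵒᵖ ⥤ AddCommGrpCat.{0} where
  obj U := AddCommGrpCat.of (Jet L E U.unop)
  map i := AddCommGrpCat.ofHom (Jet.restrict (leOfHom i.unop))

lemma jetPresheaf_isSheaf : TopCat.Presheaf.IsSheaf (X := TopCat.of M) (jetPresheaf L E) := by
  rw [TopCat.Presheaf.isSheaf_iff_isSheafUniqueGluing]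
  intro ι U φ hφ
  replace hφ : ∀ (i j : ι) (W : Opens M) (hi : W ≤ U i) (hj : W ≤ U j) (D : L.env W),
      ((φ i : Jet L E (U i)).1 ⟨W, hi⟩ D : Sec E W) = (φ j : Jet L E (U j)).1 ⟨W, hj⟩ D := by
    intro i j W hi hj D
    have h : Jet.restrict inf_le_left (φ i : Jet L E (U i)) =
      Jet.restrict inf_le_right (φ j : Jet L E (U j)) := hφ i j
    exact congrArg (fun ψ : Jet L E (U i ⊓ U j) => ψ.1 ⟨W, le_inf hi hj⟩ D) h
  have hcov : ∀ V : Opens M, V ≤ iSup U → V ≤ ⨆ i, V ⊓ U i := fun V hV => by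
    rw [← inf_iSup_eq]
    exact le_inf le_rfl hV
  have glue : ∀ (V : {V : Opens M // V ≤ iSup U}) (D : L.env V.1), ∃! t : Sec E V.1,
      ∀ i, res E (inf_le_left : V.1 ⊓ U i ≤ V.1) t =
        (φ i : Jet L E (U i)).1 ⟨V.1 ⊓ U i, inf_le_right⟩ (L.resEnv inf_le_left D) := by
    intro V D
    refine existsUnique_glue E (fun i => V.1 ⊓ U i) V.1 (fun i => inf_le_left) (hcov V.1 V.2) _ ?_
    intro i j
    rw [(φ i : Jet L E (U i)).2 ⟨V.1 ⊓ U i, inf_le_right⟩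
        ⟨(V.1 ⊓ U i) ⊓ (V.1 ⊓ U j), inf_le_left.trans inf_le_right⟩ inf_le_left,
      (φ j : Jet L E (U j)).2 ⟨V.1 ⊓ U j, inf_le_right⟩
        ⟨(V.1 ⊓ U i) ⊓ (V.1 ⊓ U j), inf_le_right.trans inf_le_right⟩ inf_le_right,
      L.resEnv_resEnv, L.resEnv_resEnv]
    exact hφ i j _ _ _ _
  choose g hg _ using glue
  have hg' : ∀ (V : {V : Opens M // V ≤ iSup U}) (D : L.env V.1) (W : Opens M) (h : W ≤ V.1)
      (i : ι) (hi : W ≤ U i),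
      res E h (g V D) = (φ i : Jet L E (U i)).1 ⟨W, hi⟩ (L.resEnv h D) := by
    intro V D W h i hi
    rw [← res_res E (inf_le_left : V.1 ⊓ U i ≤ V.1) (le_inf h hi), hg V D i,
      (φ i : Jet L E (U i)).2 ⟨V.1 ⊓ U i, inf_le_right⟩ ⟨W, hi⟩ (le_inf h hi), L.resEnv_resEnv]
  let ψ : Jet L E (iSup U) := ⟨fun V =>
    { toFun := g V
      map_add' := fun D D' => by
        refine eq_of_res_eq E (fun i => V.1 ⊓ U i) V.1 (fun i => inf_le_left) (hcov V.1 V.2) _ _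
          fun i => ?_
        rw [map_add, hg, hg, hg, map_add, map_add]
      map_smul' := fun f D => by
        refine eq_of_res_eq E (fun i => V.1 ⊓ U i) V.1 (fun i => inf_le_left) (hcov V.1 V.2) _ _
          fun i => ?_
        rw [RingHom.id_apply, res_smul, hg, hg, L.resEnv_smul, map_smul] }, fun V W h D => by
    refine eq_of_res_eq E (fun i => W.1 ⊓ U i) W.1 (fun i => inf_le_left) (hcov W.1 W.2) _ _
      fun i => ?_
    change res E _ (res E h (g V D)) = res E _ (g W (L.resEnv h D))
    rw [res_res, hg' V D _ _ i inf_le_right, hg' W _ _ _ i inf_le_right, L.resEnv_resEnv]⟩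
  refine ⟨ψ, fun i => ?_, fun χ hχ => ?_⟩
  · refine Jet.ext' fun V D => ?_
    change g ⟨V.1, _⟩ D = (φ i : Jet L E (U i)).1 V D
    have := hg' ⟨V.1, le_trans V.2 (le_iSup U i)⟩ D V.1 le_rfl i V.2
    rwa [res_self, L.resEnv_self] at this
  · refine Jet.ext' fun V D => ?_
    refine eq_of_res_eq E (fun i => V.1 ⊓ U i) V.1 (fun i => inf_le_left) (hcov V.1 V.2) _ _
      fun i => ?_
    change res E _ ((χ : Jet L E (iSup U)).1 V D) = res E _ (g V D)
    rw [hg V D i, (χ : Jet L E (iSup U)).2 V ⟨V.1 ⊓ U i, inf_le_left.trans V.2⟩]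
    have h : Jet.restrict (le_iSup U i) (χ : Jet L E (iSup U)) = (φ i : Jet L E (U i)) := hχ i
    rw [← h]
    rfl

noncomputable instance (U : (Opens M)ᵒᵖ) :
    Module ((CInf I M).obj.obj U) ((jetPresheaf L E).obj U) :=
  inferInstanceAs (Module (Fn I U.unop) (Jet L E U.unop))

/-- The sheaf of `C^∞_M`-modules `J_L(E) = Hom_{C^∞}(𝒰_L, E)` of `L`-jets of `E`. -/
noncomputable def jetSheaf : SmoothModule I M where
  val := PresheafOfModules.ofPresheaf (jetPresheaf L E) (fun U V i f φ => by
    refine Jet.ext' fun W D => ?_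
    rfl)
  isSheaf := jetPresheaf_isSheaf L E

/-- The left `𝒰_L`-module `J_L(E)`: an element `D'` of `𝒰_L` acts by `(D' φ)(D) = φ(D D')`. It makes
sense without an action of `L` on `E`. For `E = C^∞`, the involution `Env.antipode`, which preserves
the values at `1`, identifies it with `J_L` with the module structure `(f φ)(D) = f φ(D)` and the
flat connection `∇_x φ (D) = x (φ(D)) - φ(x D)`; see `Env.antipode_smul`, `Env.antipode_nabla`. -/
noncomputable def jets : LModule L where
  sheaf := jetSheaf L E
  act U x φ := (⟨fun V => ((φ : Jet L E U).1 V).comp (Env.mulVec (res L.bundle V.2 x)),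
    fun V W h D => by
      change res E h ((φ : Jet L E U).1 V (D * Env.vec _)) =
        (φ : Jet L E U).1 W (L.resEnv h D * Env.vec _)
      rw [(φ : Jet L E U).2 V W h, map_mul, L.resEnv_vec, res_res]⟩ : Jet L E U)
  add_act U x y φ := by
    refine Jet.ext' fun V D => ?_
    change (φ : Jet L E U).1 V (D * Env.vec (res L.bundle V.2 (x + y))) =
      (φ : Jet L E U).1 V (D * Env.vec (res L.bundle V.2 x)) +
      (φ : Jet L E U).1 V (D * Env.vec (res L.bundle V.2 y))
    rw [map_add, map_add, mul_add, map_add]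
  act_add U x φ ψ := rfl
  smul_act U f x φ := by
    refine Jet.ext' fun V D => ?_
    change (φ : Jet L E U).1 V (D * Env.vec (res L.bundle V.2 (f • x))) =
      (φ : Jet L E U).1 V (D * Env.fn (resFn V.2 f) * Env.vec (res L.bundle V.2 x))
    rw [res_smul, map_smul, mul_assoc, Env.smul_eq]
  act_smul U x f φ := by
    refine Jet.ext' fun V D => ?_
    change (φ : Jet L E U).1 V (D * Env.vec (res L.bundle V.2 x) * Env.fn (resFn V.2 f)) =
      (φ : Jet L E U).1 V (D * Env.fn (resFn V.2 f) * Env.vec (res L.bundle V.2 x)) +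
      (φ : Jet L E U).1 V (D * Env.fn (resFn V.2 (L.anchor U x f)))
    rw [mul_assoc, Env.vec_mul_fn, mul_add, map_add, mul_assoc, L.lie_fn_def, L.res_anchor]
  act_act U x y φ := by
    refine Jet.ext' fun V D => ?_
    change (φ : Jet L E U).1 V (D * Env.vec (res L.bundle V.2 x) * Env.vec (res L.bundle V.2 y)) =
      (φ : Jet L E U).1 V (D * Env.vec (res L.bundle V.2 (L.bracket U x y))) +
      (φ : Jet L E U).1 V (D * Env.vec (res L.bundle V.2 y) * Env.vec (res L.bundle V.2 x))
    rw [L.res_bracket, ← L.lie_def, Env.vec_lie, mul_sub, map_sub, mul_assoc, mul_assoc,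
      sub_add_cancel]
  res_act h x φ := by
    refine Jet.ext' fun V D => ?_
    change (φ : Jet L E _).1 ⟨V.1, _⟩ (D * Env.vec (res L.bundle _ x)) =
      (φ : Jet L E _).1 ⟨V.1, _⟩ (D * Env.vec (res L.bundle V.2 (res L.bundle h x)))
    rw [res_res]

/-- The quotient map `p : J_L(E) → E`, `φ ↦ φ(1)`. -/
noncomputable def jetProj : jetSheaf L E ⟶ E where
  val := PresheafOfModules.homMk
    { app := fun U => AddCommGrpCat.ofHom (AddMonoidHom.mk'
        (fun φ => ((φ : Jet L E U.unop).1 ⟨U.unop, le_rfl⟩ 1 : Sec E U.unop)) (fun φ ψ => rfl))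
      naturality := fun U V i => by
        refine AddCommGrpCat.hom_ext (AddMonoidHom.ext fun φ => ?_)
        change (φ : Jet L E U.unop).1 ⟨V.unop, _⟩ 1 =
          res E (leOfHom i.unop) ((φ : Jet L E U.unop).1 ⟨U.unop, le_rfl⟩ 1)
        rw [(φ : Jet L E U.unop).2 ⟨U.unop, le_rfl⟩ ⟨V.unop, leOfHom i.unop⟩ (leOfHom i.unop),
          (L.resEnv _).map_one] }
    (fun U f φ => by
      exact Jet.eval_smul (U := U.unop) f φ)

end Jets

section Maps

open CategoryTheory TopologicalSpace Opposite
open scoped Manifold ContDiff TensorProduct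

/-- Compatibility of maps of complexes `C → A[0]` and `D → B[0]`, given in degree zero. -/
lemma toSingle_naturality {C D : CochainComplex AddCommGrpCat.{0} ℕ} {A B : AddCommGrpCat.{0}}
    (k : C ⟶ D) (r : A ⟶ B) (g : C.X 0 ⟶ A) (g' : D.X 0 ⟶ B)
    (h : CategoryStruct.comp (k.f 0) g' = CategoryStruct.comp g r) :
    CategoryStruct.comp k ((CochainComplex.toSingle₀Equiv D B).symm g') =
      CategoryStruct.comp ((CochainComplex.toSingle₀Equiv C A).symm g)
        ((CochainComplex.single₀ AddCommGrpCat.{0}).map r) := by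
  apply (CochainComplex.toSingle₀Equiv C B).injective
  simp [h]

variable {EM : Type*} [NormedAddCommGroup EM] [NormedSpace ℝ EM] {HM : Type*} [TopologicalSpace HM]
  {I : ModelWithCorners ℝ EM HM} {M : Type} [TopologicalSpace M] [ChartedSpace HM M]
  {L : LieAlgebroid I M} {E : SmoothModule I M}

namespace Jet

variable {U V : Opens M}

/-- The product `(a φ)(D) = ∑ a(D₁) φ(D₂)`, where `Δ(D) = ∑ D₁ ⊗ D₂`, of a section `a` of `J_L` and
a section `φ` of `J_L(E)`. -/
noncomputable def mul (a : Jet L (structureSheaf I M) U) (φ : Jet L E U) : Jet L E U :=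
  ⟨fun V => Env.conv (A := Fn I V.1) (𝔤 := Sec L.bundle V.1) (a.1 V) (φ.1 V), fun V W h D =>
    Env.conv_map (A := Fn I V.1) (A' := Fn I W.1) (resFn h) (res L.bundle h) (res_smul L.bundle h)
      (L.res_bracket h) (L.res_anchor h) (res E h) (res_smul E h) (a.2 V W h) (φ.2 V W h) D⟩

/-- The product of jets as a bilinear map. -/
noncomputable def mulHom (U : Opens M) :
    Jet L (structureSheaf I M) U →ₗ[Fn I U] Jet L E U →ₗ[Fn I U] Jet L E U :=
  LinearMap.mk₂ (Fn I U) mul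
    (fun a b φ => Subtype.ext (funext fun V =>
      Env.add_conv (A := Fn I V.1) (a.1 V) (b.1 V) (φ.1 V)))
    (fun f a φ => Subtype.ext (funext fun V =>
      Env.comp_mulFn_conv (A := Fn I V.1) (resFn V.2 f) (a.1 V) (φ.1 V)))
    (fun a φ ψ => Subtype.ext (funext fun V =>
      Env.conv_add (A := Fn I V.1) (a.1 V) (φ.1 V) (ψ.1 V)))
    (fun f a φ => Subtype.ext (funext fun V =>
      Env.conv_comp_mulFn (A := Fn I V.1) (resFn V.2 f) (a.1 V) (φ.1 V)))

end Jet

/-- The map on sections of a morphism of sheaves of modules. -/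
noncomputable def secHom {E F : SmoothModule I M} (g : E ⟶ F) (U : Opens M) :
    Sec E U →ₗ[Fn I U] Sec F U :=
  (g.val.app (op U)).hom

lemma res_secHom {E F : SmoothModule I M} (g : E ⟶ F) {U V : Opens M} (h : V ≤ U) (s : Sec E U) :
    res F h (secHom g U s) = secHom g V (res E h s) :=
  (PresheafOfModules.naturality_apply g.val (homOfLE h).op s).symm

/-- The tensor product of sheaves of `C^∞_M`-modules: the sheafification of the tensor product of
the presheaves of sections. -/
noncomputable def tensor (E F : SmoothModule I M) : SmoothModule I M :=
  (PresheafOfModules.sheafification (𝟙 (CInf I M).obj)).obj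
    (PresheafOfModules.Monoidal.tensorObj (R := (smoothSheafCommRing I 𝓘(ℝ, ℝ) M ℝ).obj)
      E.val F.val)

/-- The map `a ⊗ e ↦ a ν(e)` on sections over `U`. -/
noncomputable def iNuSec (ν : E ⟶ jetSheaf L E) (U : Opens M) :
    Jet L (structureSheaf I M) U ⊗[Fn I U] Sec E U →ₗ[Fn I U] Jet L E U :=
  TensorProduct.lift ((Jet.mulHom U).compl₂ (secHom ν U))

lemma restrict_mul_secHom (ν : E ⟶ jetSheaf L E) {U V : Opens M} (h : V ≤ U)
    (a : Jet L (structureSheaf I M) U) (e : Sec E U) :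
    iNuSec ν V (Jet.restrict h a ⊗ₜ res E h e) = Jet.restrict h (iNuSec ν U (a ⊗ₜ e)) := by
  change Jet.mul (Jet.restrict h a) (secHom ν V (res E h e)) =
    Jet.restrict h (Jet.mul a (secHom ν U e))
  have := res_secHom ν h e
  change Jet.restrict h (secHom ν U e) = secHom ν V (res E h e) at this
  rw [← this]
  rfl

/-- The map `a ⊗ e ↦ a ν(e)` from the presheaf tensor product of `J_L` and `E` to `J_L(E)`. -/
noncomputable def iNuPre (ν : E ⟶ jetSheaf L E) :
    PresheafOfModules.Monoidal.tensorObj (R := (smoothSheafCommRing I 𝓘(ℝ, ℝ) M ℝ).obj)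
      (jetSheaf L (structureSheaf I M)).val E.val ⟶
    (PresheafOfModules.restrictScalars (𝟙 (CInf I M).obj)).obj (jetSheaf L E).val :=
  PresheafOfModules.homMk
    { app := fun U => AddCommGrpCat.ofHom (iNuSec ν U.unop).toAddMonoidHom
      naturality := fun U V i => by
        refine AddCommGrpCat.hom_ext (Env.tensor_addHom_ext fun a e => ?_)
        exact restrict_mul_secHom ν (leOfHom i.unop) a e }
    (fun U f t => by
      exact (iNuSec ν U.unop).map_smul f t)

/-- The morphism `i_ν : J_L ⊗ E → J_L(E)`, `a ⊗ e ↦ a ν(e)`, induced by `ν : E → J_L(E)`. -/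
noncomputable def iNu (ν : E ⟶ jetSheaf L E) :
    tensor (jetSheaf L (structureSheaf I M)) E ⟶ jetSheaf L E :=
  (PresheafOfModules.sheafificationHomEquiv (𝟙 (CInf I M).obj)).symm (iNuPre ν)

variable (L E)

/-- The projection `dR_L(J_L(E)) → E` in degree `m`: it is `p` in degree `0` and zero in positive
degrees. -/
noncomputable def dRProjDeg (U : Opens M) : ∀ m : ℕ, Form L (jetSheaf L E) m U →+ Sec E U
  | 0 => AddMonoidHom.mk' (fun θ => secHom (jetProj L E) U (θ.1 ⟨U, le_rfl⟩ ![]))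
      (fun _ _ => map_add (secHom (jetProj L E) U) _ _)
  | _ + 1 => 0

/-- The augmentation `C^*L → C^∞_M`: the identity in degree `0` and zero in positive degrees. It
makes every sheaf of `C^∞_M`-modules a module over `C^*L`. -/
noncomputable def aug (U : Opens M) : ∀ k : ℕ, Form L (structureSheaf I M) k U →+ Fn I U
  | 0 => AddMonoidHom.mk' (fun α => (α.1 ⟨U, le_rfl⟩ ![] : Fn I U)) (fun _ _ => rfl)
  | _ + 1 => 0

/-- The presheaf of abelian groups of sections of a sheaf of modules. -/
noncomputable def secPresheaf : (Opens M)ᵒᵖ ⥤ AddCommGrpCat.{0} where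
  obj U := AddCommGrpCat.of (Sec E U.unop)
  map i := AddCommGrpCat.ofHom (res E (leOfHom i.unop))
  map_id _ := AddCommGrpCat.hom_ext (AddMonoidHom.ext fun s => res_self E _ s)
  map_comp i j := AddCommGrpCat.hom_ext (AddMonoidHom.ext fun s =>
    (res_res E (leOfHom i.unop) (leOfHom j.unop) s).symm)

lemma res_dRProjDeg {U V : Opens M} (h : V ≤ U) (θ : Form L (jetSheaf L E) 0 U) :
    dRProjDeg L E V 0 (Form.restrict h θ) = res E h (dRProjDeg L E U 0 θ) := by
  change secHom (jetProj L E) V (θ.1 ⟨V, _⟩ ![]) =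
    res E h (secHom (jetProj L E) U (θ.1 ⟨U, le_rfl⟩ ![]))
  rw [res_secHom, θ.2 ⟨U, le_rfl⟩ ⟨V, h⟩ h]
  congr 2
  exact Subsingleton.elim _ _

/-- The projection `dR_L(J_L(E)) → E`, with `E` regarded as a complex in degree `0`. -/
noncomputable def dRProj :
    dR L (jets L E) ⟶ secPresheaf E ⋙ CochainComplex.single₀ AddCommGrpCat.{0} where
  app U := (CochainComplex.toSingle₀Equiv (dRObj L (jets L E) U.unop)
    (AddCommGrpCat.of (Sec E U.unop))).symm (AddCommGrpCat.ofHom (dRProjDeg L E U.unop 0))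
  naturality U V i := by
    refine toSingle_naturality _ _ _ _ ?_
    exact AddCommGrpCat.hom_ext (AddMonoidHom.ext fun θ => res_dRProjDeg L E (leOfHom i.unop) θ)

/-- In degree zero, `dRProj` is the map `dRProjDeg`; in positive degrees its target is zero. -/
lemma dRProj_f_zero (U : Opens M) : ((dRProj L E).app (op U)).f 0 =
    AddCommGrpCat.ofHom (dRProjDeg L E U 0) :=
  CochainComplex.toSingle₀Equiv_symm_apply_f_zero _

end Maps

end LieAlgebroidJets

open LieAlgebroidJets CategoryTheory TopologicalSpace Opposite
open scoped Manifold ContDiff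

/-! Filter the enveloping algebra by order, and the jets by the order to which they vanish. Both
claims are proved on leading terms and then carried over to all jets, because jets are separated and
complete for this filtration. Every operator has finite order, so a jet vanishing to all orders is
zero (`Jet.eq_zero_of_mem_vanish`), and a series of jets vanishing to increasing order is a finite
sum on each operator (`Jet.exists_series`).

The quasi-isomorphism is a formal Poincaré lemma. Over a frame `b_j` of `L` there are jets of
functions `t_j` with `t_j(1) = 0` whose value on a vector `x` is the `j`-th coordinate of `x`. They
play the role of formal coordinates. They are read off from a representation of the enveloping
algebra on polynomials, and this is the only part of the Poincaré-Birkhoff-Witt theorem that is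
needed. Contraction with the Euler field `∑ t_j b_j` is a homotopy up to higher order: its
anticommutator with `d` multiplies the leading term of an `(m+1)`-form that vanishes below order `q`
by `q + m + 1` (`Form.Vanishes.homotopy`). That number is invertible, so a closed form has a
primitive modulo higher order (`Form.exists_step`), and the iteration converges.

Jets carry a second multiplication by functions, `φ ↦ f φ(D)`. The connection is right
multiplication by vectors, so this multiplication commutes with `d` (`Form.d_star`). Hence local
primitives can be averaged with a partition of unity without any term in `df`, which gives exactness
over every open set (`Form.exists_primitive`). In degree zero, a closed jet vanishes on the left
ideal generated by `L`, so it is the counit times its value at `1` (`Env.eq_counit_smul`).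

For `i_ν`, let `e_j` be a local frame of `E`; then `ν(e_j)` has value `e_j` at `1`. If the `a_j`
vanish below order `q`, the leading term of `∑ a_j ν(e_j)` is `∑ a_j e_j`. Leading terms therefore
determine the coefficients one order at a time, and completeness gives bijectivity. Bijectivity over
open sets with a frame suffices, as `i_ν` is defined on a sheafification. -/

namespace LieAlgebroidJets

namespace Env

open scoped TensorProduct

/-! ### Order filtration of the enveloping algebra and leading terms of the coproduct -/

section Filtration

variable (A 𝔤 : Type*) [CommRing A] [LieRing 𝔤] [Module A 𝔤] [LieRingModule 𝔤 A]

/-- The order filtration of the enveloping algebra: `filt q` consists of the elements of order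
less than `q`. -/
noncomputable def filt : ℕ → Submodule A (Env A 𝔤)
  | 0 => ⊥
  | q + 1 => Submodule.span A ({1} ∪ {D | ∃ x : 𝔤, ∃ D' ∈ filt q, vec x * D' = D})

variable {A 𝔤}

lemma filt_zero_eq {D : Env A 𝔤} (h : D ∈ filt A 𝔤 0) : D = 0 := (Submodule.mem_bot A).1 h

lemma one_mem_filt (q : ℕ) : (1 : Env A 𝔤) ∈ filt A 𝔤 (q + 1) :=
  Submodule.subset_span (Or.inl rfl)

lemma vec_mul_mem_filt {q : ℕ} (x : 𝔤) {D : Env A 𝔤} (h : D ∈ filt A 𝔤 q) :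
    vec x * D ∈ filt A 𝔤 (q + 1) :=
  Submodule.subset_span (Or.inr ⟨x, D, h, rfl⟩)

/-- Induction along the order filtration. -/
lemma filt_induction {P : ℕ → Env A 𝔤 → Prop} (zero : ∀ q, P q 0)
    (add : ∀ q D D', P q D → P q D' → P q (D + D')) (smul : ∀ q (a : A), ∀ D ∈ filt A 𝔤 q, P q D → P q (a • D))
    (one : ∀ q, P (q + 1) 1)
    (vec_mul : ∀ q x D, D ∈ filt A 𝔤 q → P q D → P (q + 1) (vec x * D)) :
    ∀ q, ∀ D ∈ filt A 𝔤 q, P q D := by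
  intro q
  induction q with
  | zero =>
    intro D h
    rw [filt_zero_eq h]
    exact zero 0
  | succ q ih =>
    intro D h
    induction h using Submodule.span_induction with
    | mem D h =>
      rcases h with h | ⟨x, D', h, rfl⟩
      · rw [Set.mem_singleton_iff] at h
        rw [h]
        exact one q
      · exact vec_mul q x D' h (ih D' h)
    | zero => exact zero _
    | add D D' _ _ h h' => exact add _ _ _ h h'
    | smul a D hD h => exact smul _ a D hD h

lemma filt_le_succ (q : ℕ) : filt A 𝔤 q ≤ filt A 𝔤 (q + 1) := fun D h =>
  filt_induction (P := fun q D => D ∈ filt A 𝔤 (q + 1)) (fun _ => zero_mem _)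
    (fun _ _ _ h h' => add_mem h h') (fun _ a _ _ h => Submodule.smul_mem _ a h)
    (fun _ => one_mem_filt _) (fun _ x _ _ h => vec_mul_mem_filt x h) q D h

lemma filt_mono : Monotone (filt A 𝔤) := monotone_nat_of_le_succ filt_le_succ

lemma exists_mem_filt (D : Env A 𝔤) : ∃ q, D ∈ filt A 𝔤 q := by
  induction D using Env.induction with
  | one => exact ⟨1, one_mem_filt 0⟩
  | add D D' h h' =>
    obtain ⟨q, h⟩ := h
    obtain ⟨q', h'⟩ := h'
    exact ⟨max q q', add_mem (filt_mono (le_max_left _ _) h) (filt_mono (le_max_right _ _) h')⟩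
  | fn_mul a D h =>
    obtain ⟨q, h⟩ := h
    exact ⟨q, Submodule.smul_mem _ a h⟩
  | vec_mul x D h =>
    obtain ⟨q, h⟩ := h
    exact ⟨q + 1, vec_mul_mem_filt x h⟩

/-- Induction from `[x D, a] = x [D, a] + x(a) D`: the commutator with a function lowers the order.
Consequently the two module structures on jets, `φ(D f)` and `f φ(D)`, agree on leading terms. -/
lemma mul_fn_sub_mem_filt (a : A) {q : ℕ} {D : Env A 𝔤} (h : D ∈ filt A 𝔤 (q + 1)) :
    D * fn a - a • D ∈ filt A 𝔤 q := by
  -- The truncated `q - 1` lets the induction include `q = 0`, where `D = 0`.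
  refine filt_induction (P := fun q D => D * fn a - a • D ∈ filt A 𝔤 (q - 1)) ?_ ?_ ?_ ?_ ?_
    (q + 1) D h
  · intro q; simp
  · intro q D D' h h'
    rw [add_mul, smul_add, add_sub_add_comm]
    exact add_mem h h'
  · intro q b D _ h
    rw [smul_mul, smul_comm, ← smul_sub]
    exact Submodule.smul_mem _ b h
  · intro q
    rw [smul_eq, one_mul, mul_one, sub_self]
    exact zero_mem _
  · intro q x D hD h
    rw [Nat.add_sub_cancel]
    have : vec x * D * fn a - a • (vec x * D) = vec x * (D * fn a - a • D) + ⁅x, a⁆ • D := by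
      rw [mul_sub, vec_mul_smul, mul_assoc]; abel
    rw [this]
    refine add_mem ?_ (Submodule.smul_mem _ _ hD)
    cases q with
    | zero => rw [filt_zero_eq hD]; simp
    | succ q => exact vec_mul_mem_filt x h

/-- A commutator with a vector does not raise the order, because `[x D, y] = x [D, y] + [x, y] D`
and `[a D, y] = a [D, y] - y(a) D`. -/
lemma mul_vec_sub_mem_filt (y : 𝔤) {q : ℕ} {D : Env A 𝔤} (h : D ∈ filt A 𝔤 q) :
    D * vec y - vec y * D ∈ filt A 𝔤 q := by
  refine filt_induction (P := fun q D => D * vec y - vec y * D ∈ filt A 𝔤 q) ?_ ?_ ?_ ?_ ?_ q D h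
  · intro q; simp
  · intro q D D' h h'
    rw [add_mul, mul_add, add_sub_add_comm]
    exact add_mem h h'
  · intro q a D hD h
    have : (a • D) * vec y - vec y * (a • D) = a • (D * vec y - vec y * D) - ⁅y, a⁆ • D := by
      rw [vec_mul_smul, smul_mul, smul_sub]; abel
    rw [this]
    exact sub_mem (Submodule.smul_mem _ a h) (Submodule.smul_mem _ _ hD)
  · intro q
    rw [one_mul, mul_one, sub_self]
    exact zero_mem _
  · intro q x D hD h
    have : vec x * D * vec y - vec y * (vec x * D) =
        vec x * (D * vec y - vec y * D) + vec ⁅x, y⁆ * D := by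
      rw [vec_lie, sub_mul, mul_sub]; simp only [mul_assoc]; abel
    rw [this]
    exact add_mem (vec_mul_mem_filt x h) (vec_mul_mem_filt _ hD)

/-- The filtration is generated by left multiplications, whereas the connection on jets uses right
multiplication; the two differ by a commutator of no higher order. -/
lemma mul_vec_mem_filt (y : 𝔤) {q : ℕ} {D : Env A 𝔤} (h : D ∈ filt A 𝔤 q) :
    D * vec y ∈ filt A 𝔤 (q + 1) := by
  have := add_mem (filt_le_succ q (mul_vec_sub_mem_filt y h)) (vec_mul_mem_filt y h)
  rwa [sub_add_cancel] at this

/-- The span of the tensors `D ⊗ D'` with `D` of order less than `q`. -/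
noncomputable def filtLeft (q : ℕ) : Submodule A (Env A 𝔤 ⊗[A] Env A 𝔤) :=
  Submodule.span A {t | ∃ D ∈ filt A 𝔤 q, ∃ D', D ⊗ₜ[A] D' = t}

/-- The span of the tensors `D ⊗ D'` with `D'` of order less than `q`. -/
noncomputable def filtRight (q : ℕ) : Submodule A (Env A 𝔤 ⊗[A] Env A 𝔤) :=
  Submodule.span A {t | ∃ D, ∃ D' ∈ filt A 𝔤 q, D ⊗ₜ[A] D' = t}

lemma tmul_mem_filtLeft {q : ℕ} {D : Env A 𝔤} (h : D ∈ filt A 𝔤 q) (D' : Env A 𝔤) :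
    D ⊗ₜ[A] D' ∈ filtLeft q := Submodule.subset_span ⟨D, h, D', rfl⟩

lemma tmul_mem_filtRight {q : ℕ} {D' : Env A 𝔤} (h : D' ∈ filt A 𝔤 q) (D : Env A 𝔤) :
    D ⊗ₜ[A] D' ∈ filtRight q := Submodule.subset_span ⟨D, D', h, rfl⟩

/-- This is the relation `x a = a x + x(a)` of the enveloping algebra, read in its action on the
tensor square. -/
lemma vecTensor_smul (x : 𝔤) (a : A) (t : Env A 𝔤 ⊗[A] Env A 𝔤) :
    vecTensor x (a • t) = a • vecTensor x t + ⁅x, a⁆ • t := by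
  rw [← actTensor_fn, ← actTensor_vec, ← actTensor_mul, vec_mul_fn, map_add]
  change actTensor (fn a * vec x) t + actTensor (fn ⁅x, a⁆) t = _
  rw [actTensor_mul, actTensor_fn, actTensor_vec, actTensor_fn]

lemma vecTensor_mem_filtLeft (x : 𝔤) {q : ℕ} {t : Env A 𝔤 ⊗[A] Env A 𝔤} (h : t ∈ filtLeft q) :
    vecTensor x t ∈ filtLeft (q + 1) := by
  have hle : (filtLeft q : Submodule A (Env A 𝔤 ⊗[A] Env A 𝔤)) ≤ filtLeft (q + 1) :=
    Submodule.span_mono fun t ⟨D, h, D', e⟩ => ⟨D, filt_le_succ q h, D', e⟩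
  induction h using Submodule.span_induction with
  | mem t h =>
    obtain ⟨D, h, D', rfl⟩ := h
    rw [vecTensor_tmul]
    exact add_mem (tmul_mem_filtLeft (vec_mul_mem_filt x h) _)
      (tmul_mem_filtLeft (filt_le_succ q h) _)
  | zero => rw [map_zero]; exact zero_mem _
  | add s t _ _ hs ht => rw [map_add]; exact add_mem hs ht
  | smul a t ht h =>
    rw [vecTensor_smul]
    exact add_mem (Submodule.smul_mem _ a h) (Submodule.smul_mem _ _ (hle ht))

lemma vecTensor_mem_filtRight (x : 𝔤) {q : ℕ} {t : Env A 𝔤 ⊗[A] Env A 𝔤}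
    (h : t ∈ filtRight q) : vecTensor x t ∈ filtRight (q + 1) := by
  have hle : (filtRight q : Submodule A (Env A 𝔤 ⊗[A] Env A 𝔤)) ≤ filtRight (q + 1) :=
    Submodule.span_mono fun t ⟨D, D', h, e⟩ => ⟨D, D', filt_le_succ q h, e⟩
  induction h using Submodule.span_induction with
  | mem t h =>
    obtain ⟨D, D', h, rfl⟩ := h
    rw [vecTensor_tmul]
    exact add_mem (tmul_mem_filtRight (filt_le_succ q h) _)
      (tmul_mem_filtRight (vec_mul_mem_filt x h) _)
  | zero => rw [map_zero]; exact zero_mem _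
  | add s t _ _ hs ht => rw [map_add]; exact add_mem hs ht
  | smul a t ht h =>
    rw [vecTensor_smul]
    exact add_mem (Submodule.smul_mem _ a h) (Submodule.smul_mem _ _ (hle ht))

/-- Since `x` acts on `D ⊗ 1` as `x D ⊗ 1 + D ⊗ x`, each new vector adds to `D ⊗ 1` only terms whose
left factor has smaller order than the product. -/
lemma coprod_sub_mem_filtLeft {q : ℕ} {D : Env A 𝔤} (h : D ∈ filt A 𝔤 (q + 1)) :
    coprod D - D ⊗ₜ[A] 1 ∈ filtLeft q := by
  refine filt_induction (P := fun q D => coprod D - D ⊗ₜ[A] 1 ∈ filtLeft (q - 1)) ?_ ?_ ?_ ?_ ?_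
    (q + 1) D h
  · intro q; simp
  · intro q D D' h h'
    rw [map_add, TensorProduct.add_tmul, add_sub_add_comm]
    exact add_mem h h'
  · intro q b D _ h
    have : coprod (b • D) - (b • D) ⊗ₜ[A] 1 = b • (coprod D - D ⊗ₜ[A] 1) := by
      rw [smul_sub, TensorProduct.smul_tmul', map_smul]
    rw [this]
    exact Submodule.smul_mem _ b h
  · intro q
    rw [coprod_one, sub_self]
    exact zero_mem _
  · intro q x D hD h
    rw [Nat.add_sub_cancel]
    have : coprod (vec x * D) - (vec x * D) ⊗ₜ[A] 1 =
        vecTensor x (coprod D - D ⊗ₜ[A] 1) + D ⊗ₜ[A] (vec x * 1) := by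
      rw [coprod_vec_mul, map_sub, vecTensor_tmul]; abel
    rw [this]
    refine add_mem ?_ (tmul_mem_filtLeft hD _)
    cases q with
    | zero => rw [filt_zero_eq hD]; simp
    | succ q => exact vecTensor_mem_filtLeft x h

lemma coprod_sub_mem_filtRight {q : ℕ} {D : Env A 𝔤} (h : D ∈ filt A 𝔤 (q + 1)) :
    coprod D - 1 ⊗ₜ[A] D ∈ filtRight q := by
  refine filt_induction (P := fun q D => coprod D - 1 ⊗ₜ[A] D ∈ filtRight (q - 1)) ?_ ?_ ?_ ?_ ?_
    (q + 1) D h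
  · intro q; simp
  · intro q D D' h h'
    rw [map_add, TensorProduct.tmul_add, add_sub_add_comm]
    exact add_mem h h'
  · intro q b D _ h
    have : coprod (b • D) - 1 ⊗ₜ[A] (b • D) = b • (coprod D - 1 ⊗ₜ[A] D) := by
      rw [smul_sub, TensorProduct.tmul_smul, map_smul]
    rw [this]
    exact Submodule.smul_mem _ b h
  · intro q
    rw [coprod_one, sub_self]
    exact zero_mem _
  · intro q x D hD h
    rw [Nat.add_sub_cancel]
    have : coprod (vec x * D) - 1 ⊗ₜ[A] (vec x * D) =
        vecTensor x (coprod D - 1 ⊗ₜ[A] D) + (vec x * 1) ⊗ₜ[A] D := by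
      rw [coprod_vec_mul, map_sub, vecTensor_tmul]; abel
    rw [this]
    refine add_mem ?_ (tmul_mem_filtRight hD _)
    cases q with
    | zero => rw [filt_zero_eq hD]; simp
    | succ q => exact vecTensor_mem_filtRight x h

/-! ### Leading terms and the Leibniz rule for products of jets -/

section Conv

variable {N : Type*} [AddCommGroup N] [Module A N]

/-- The leading term of a product whose left factor vanishes in lower order. -/
lemma conv_apply_of_left (a : Env A 𝔤 →ₗ[A] A) (φ : Env A 𝔤 →ₗ[A] N) {q : ℕ}
    (ha : ∀ D ∈ filt A 𝔤 q, a D = 0) {D : Env A 𝔤} (h : D ∈ filt A 𝔤 (q + 1)) :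
    conv a φ D = a D • φ 1 := by
  have key : ∀ t ∈ (filtLeft q : Submodule A (Env A 𝔤 ⊗[A] Env A 𝔤)), pair a φ t = 0 := by
    intro t ht
    refine Submodule.span_le (p := LinearMap.ker (pair a φ)).2 ?_ ht
    rintro _ ⟨D, hD, D', rfl⟩
    rw [SetLike.mem_coe, LinearMap.mem_ker, pair_tmul, ha D hD, zero_smul]
  have := key _ (coprod_sub_mem_filtLeft h)
  rwa [map_sub, sub_eq_zero, pair_tmul] at this

/-- The leading term of a product, up to values of the right factor in lower order. -/
lemma conv_sub_mem_map (a : Env A 𝔤 →ₗ[A] A) (φ : Env A 𝔤 →ₗ[A] N) {q : ℕ} {D : Env A 𝔤}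
    (h : D ∈ filt A 𝔤 (q + 1)) : conv a φ D - a 1 • φ D ∈ (filt A 𝔤 q).map φ := by
  have key : ∀ t ∈ (filtRight q : Submodule A (Env A 𝔤 ⊗[A] Env A 𝔤)),
      pair a φ t ∈ (filt A 𝔤 q).map φ := by
    intro t ht
    refine Submodule.span_le (p := ((filt A 𝔤 q).map φ).comap (pair a φ)).2 ?_ ht
    rintro _ ⟨D, D', hD, rfl⟩
    rw [SetLike.mem_coe, Submodule.mem_comap, pair_tmul]
    exact Submodule.smul_mem _ _ (Submodule.mem_map_of_mem hD)
  have := key _ (coprod_sub_mem_filtRight h)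
  rwa [map_sub, pair_tmul] at this

/-- The leading term of a product whose right factor vanishes in lower order. -/
lemma conv_apply_of_right (a : Env A 𝔤 →ₗ[A] A) (φ : Env A 𝔤 →ₗ[A] N) {q : ℕ}
    (hφ : ∀ D ∈ filt A 𝔤 q, φ D = 0) {D : Env A 𝔤} (h : D ∈ filt A 𝔤 (q + 1)) :
    conv a φ D = a 1 • φ D := by
  obtain ⟨D', hD', e⟩ := conv_sub_mem_map a φ h
  rw [hφ D' hD'] at e
  exact sub_eq_zero.1 e.symm

/-- Used with `g` a jet and `φ` a right multiplication: it turns an operator on jets into an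
operator on the enveloping algebra itself, where the Euler operator is computed. -/
lemma conv_comp_left {N' : Type*} [AddCommGroup N'] [Module A N'] (g : N →ₗ[A] N')
    (a : Env A 𝔤 →ₗ[A] A) (φ : Env A 𝔤 →ₗ[A] N) (D : Env A 𝔤) :
    conv a (g ∘ₗ φ) D = g (conv a φ D) := by
  rw [conv_apply, conv_apply]
  generalize coprod D = t
  induction t with
  | zero => simp
  | add s t hs ht => simp only [map_add, hs, ht]
  | tmul D D' => rw [pair_tmul, pair_tmul, map_smul]; rfl

/-- A vector is primitive, and right multiplication in one factor commutes with all left actions.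
This makes it well defined over `A` and reduces the claim to `D = 1`. -/
lemma coprod_mul_vec (D : Env A 𝔤) (y : 𝔤) :
    coprod (D * vec y) =
      TensorProduct.map (mulVec y) .id (coprod D) + TensorProduct.map .id (mulVec y) (coprod D) := by
  induction D using Env.induction with
  | one =>
    rw [one_mul, ← mul_one (vec y), coprod_vec_mul, coprod_one, vecTensor_tmul,
      TensorProduct.map_tmul, TensorProduct.map_tmul]
    simp [mulVec]
  | add D D' h h' => rw [add_mul, map_add, map_add, h, h', map_add, map_add]; abel
  | fn_mul b D h => rw [mul_assoc, coprod_fn_mul, h, coprod_fn_mul, map_smul, map_smul, smul_add]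
  | vec_mul x D h =>
    rw [mul_assoc, coprod_vec_mul, h, coprod_vec_mul, map_add, vecTensor_map_id, vecTensor_map_id']
    · intro D; exact mul_assoc _ _ _
    · intro D; exact mul_assoc _ _ _

/-- The Leibniz rule for products of jets. -/
lemma conv_comp_mulVec (a : Env A 𝔤 →ₗ[A] A) (φ : Env A 𝔤 →ₗ[A] N) (y : 𝔤) :
    conv a φ ∘ₗ mulVec y = conv (a ∘ₗ mulVec y) φ + conv a (φ ∘ₗ mulVec y) := by
  ext D
  change pair a φ (coprod (D * vec y)) =
    pair (a ∘ₗ mulVec y) φ (coprod D) + pair a (φ ∘ₗ mulVec y) (coprod D)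
  rw [coprod_mul_vec]
  generalize coprod D = t
  induction t with
  | zero => simp
  | add s t hs ht =>
    simp only [map_add] at hs ht ⊢
    rw [add_add_add_comm, hs, ht]; abel
  | tmul D D' => simp

end Conv

end Filtration

/-! ### The Euler operator on the enveloping algebra -/

section Euler

variable {A 𝔤 ι : Type*} [CommRing A] [LieRing 𝔤] [Module A 𝔤] [LieRingModule 𝔤 A]
  [LieRinehartRing A 𝔤] [Fintype ι]

/-- Moving `x` out of the product differentiates the coefficient `t(D₁)`, while the coproduct
replaces `D₁` by `x D₁`; the difference of these two terms is the flat connection `nabla` applied to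
`t`. -/
lemma conv_vec_mul {x y : 𝔤} (t : Env A 𝔤 →ₗ[A] A) (D : Env A 𝔤) :
    conv t (mulVec y) (vec x * D) = vec x * conv t (mulVec y) D - conv (nabla x t) (mulVec y) D := by
  rw [conv_apply, conv_apply, conv_apply, coprod_vec_mul]
  generalize coprod D = s
  induction s with
  | zero => simp
  | add s t hs ht => simp only [map_add, hs, ht, mul_add]; abel
  | tmul D D' =>
    rw [vecTensor_tmul, map_add, pair_tmul, pair_tmul, pair_tmul, pair_tmul, nabla_apply,
      vec_mul_smul, sub_smul]
    change _ + t D • (vec x * D' * vec y) = t D • (vec x * (D' * vec y)) + _ - _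
    rw [mul_assoc]
    abel

/-- The Euler operator `∑ⱼ tⱼ bⱼ` of a system of coordinates multiplies the part of degree `q` of
the associated graded module by `q`. -/
lemma euler_sub_mem_filt (b : ι → 𝔤) (t : ι → Env A 𝔤 →ₗ[A] A) (h1 : ∀ j, t j 1 = 0)
    (hb : ∀ x : 𝔤, ∑ j, t j (vec x) • b j = x) {q : ℕ} {D : Env A 𝔤}
    (h : D ∈ filt A 𝔤 (q + 1)) :
    ∑ j, conv (t j) (mulVec (b j)) D - q • D ∈ filt A 𝔤 q := by
  -- An element of `filt q` has order at most `q - 1`, and this is the eigenvalue on the leading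
  -- term.
  refine filt_induction
    (P := fun q D => ∑ j, conv (t j) (mulVec (b j)) D - (q - 1 : ℕ) • D ∈ filt A 𝔤 (q - 1))
    ?_ ?_ ?_ ?_ ?_ (q + 1) D h
  · intro q; simp
  · intro q D D' h h'
    simp only [map_add, Finset.sum_add_distrib, smul_add]
    rw [add_sub_add_comm]
    exact add_mem h h'
  · intro q c D _ h
    simp only [map_smul, ← Finset.smul_sum]
    rw [smul_comm, ← smul_sub]
    exact Submodule.smul_mem _ c h
  · intro q
    have : ∀ j, conv (t j) (mulVec (b j)) 1 = 0 := fun j => by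
      rw [conv_apply, coprod_one, pair_tmul, h1, zero_smul]
    simp only [this, Finset.sum_const_zero, zero_sub]
    cases q with
    | zero => simp
    | succ q =>
      exact neg_mem (nsmul_mem (one_mem_filt q) _)
  · intro q x D hD h
    rw [Nat.add_sub_cancel]
    cases q with
    | zero => rw [filt_zero_eq hD]; simp
    | succ q =>
      rw [Nat.add_sub_cancel] at h
      -- Modulo lower order only the values at `1` of the jets `∇_x t_j` matter. They are `-t_j(x)`,
      -- and `∑ t_j(x) b_j = x` supplies the extra copy of `x D` that raises the eigenvalue from `q`
      -- to `q + 1`.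
      have h2 : ∑ j, (conv (nabla x (t j)) (mulVec (b j)) D - (nabla x (t j)) 1 • (D * vec (b j)))
          ∈ filt A 𝔤 (q + 1) := sum_mem fun j _ => by
        obtain ⟨D', hD', e⟩ := conv_sub_mem_map (nabla x (t j)) (mulVec (b j)) hD
        change _ = _ - (nabla x (t j)) 1 • (D * vec (b j)) at e
        rw [← e]
        exact mul_vec_mem_filt _ hD'
      have h3 : ∀ j, nabla x (t j) 1 = - t j (vec x) := fun j => by
        rw [nabla_apply, h1, lie_zero, mul_one, zero_sub]
      have h4 : ∑ j, t j (vec x) • (D * vec (b j) - vec (b j) * D) ∈ filt A 𝔤 (q + 1) :=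
        sum_mem fun j _ => Submodule.smul_mem _ _ (mul_vec_sub_mem_filt _ hD)
      have h5 : ∑ j, t j (vec x) • (vec (b j) * D) = vec x * D := by
        conv_rhs => rw [← hb x]
        rw [map_sum, Finset.sum_mul]
        exact Finset.sum_congr rfl fun j _ => by rw [map_smul, smul_mul]
      have : ∑ j, conv (t j) (mulVec (b j)) (vec x * D) - (q + 1) • (vec x * D) =
          vec x * (∑ j, conv (t j) (mulVec (b j)) D - q • D) -
          ∑ j, (conv (nabla x (t j)) (mulVec (b j)) D - (nabla x (t j)) 1 • (D * vec (b j))) +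
          ∑ j, t j (vec x) • (D * vec (b j) - vec (b j) * D) := by
        simp only [conv_vec_mul, h3, smul_sub, Finset.sum_sub_distrib, h5, neg_smul,
          Finset.sum_neg_distrib, mul_sub, Finset.mul_sum, mul_smul_comm, add_smul, one_smul]
        abel
      rw [this]
      exact add_mem (sub_mem (vec_mul_mem_filt x h) h2) h4

end Euler

/-! ### The counit and horizontal jets -/

section Counit

variable {A 𝔤 : Type*} [CommRing A] [LieRing 𝔤] [Module A 𝔤] [LieRingModule 𝔤 A]
  [LieRinehartRing A 𝔤]

variable (A 𝔤) in
/-- The action of the Lie algebra on functions. -/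
def lieFn : 𝔤 →+ AddMonoid.End A where
  toFun x := (AddMonoidHom.mk' (fun a => ⁅x, a⁆) (lie_add x) : A →+ A)
  map_zero' := DFunLike.ext _ _ fun a => zero_lie a
  map_add' x y := DFunLike.ext _ _ fun a => add_lie x y a

/-- The action of the enveloping algebra on functions. -/
noncomputable def actFn : Env A 𝔤 →+* AddMonoid.End A :=
  lift (B := AddMonoid.End A) (Module.toAddMonoidEnd A A) (lieFn A 𝔤)
    (fun a x => DFunLike.ext _ _ fun c => LieRinehartRing.lie_smul_eq_mul a c x)
    (fun x y => DFunLike.ext _ _ fun a => lie_lie x y a)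
    (fun x a => DFunLike.ext _ _ fun c => by
      change ⁅x, a⁆ * c = ⁅x, a * c⁆ - a * ⁅x, c⁆
      rw [LieRinehartRing.leibniz_mul_right]
      simp only [smul_eq_mul]
      ring)

lemma actFn_fn (a c : A) : actFn (fn a : Env A 𝔤) c = a * c := by
  rw [actFn, lift_fn]; rfl

lemma actFn_vec (x : 𝔤) (c : A) : actFn (vec x : Env A 𝔤) c = ⁅x, c⁆ := by
  rw [actFn, lift_vec]; rfl

lemma actFn_mul (D D' : Env A 𝔤) (c : A) : actFn (D * D') c = actFn D (actFn D' c) := by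
  rw [map_mul]; rfl

/-- The counit of the enveloping algebra, `ε(D) = D · 1`. -/
noncomputable def counit : Env A 𝔤 →ₗ[A] A where
  toFun D := actFn D 1
  map_add' D D' := by rw [map_add]; rfl
  map_smul' a D := by rw [smul_eq, actFn_mul, actFn_fn]; rfl

lemma counit_apply (D : Env A 𝔤) : counit D = actFn D 1 := rfl

lemma counit_one : counit (1 : Env A 𝔤) = 1 := by
  rw [counit_apply, actFn.map_one]; rfl

lemma counit_vec_mul (x : 𝔤) (D : Env A 𝔤) : counit (vec x * D) = ⁅x, counit D⁆ := by
  rw [counit_apply, actFn_mul, actFn_vec, counit_apply]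

lemma counit_mul_vec (D : Env A 𝔤) (x : 𝔤) : counit (D * vec x) = 0 := by
  have h : ⁅x, (1 : A)⁆ = 0 := by
    simpa using LieRinehartRing.leibniz_mul_right x (1 : A) (1 : A)
  rw [counit_apply, actFn_mul, actFn_vec, h, map_zero]

/-- A linear map that vanishes on the left ideal generated by the vectors is a multiple of the
counit. -/
lemma eq_counit_smul {N : Type*} [AddCommGroup N] [Module A N] (φ : Env A 𝔤 →ₗ[A] N)
    (h : ∀ x D, φ (D * vec x) = 0) (D : Env A 𝔤) : φ D = counit D • φ 1 := by
  suffices ∀ q, ∀ D ∈ filt A 𝔤 q, φ D = counit D • φ 1 by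
    obtain ⟨q, hD⟩ := exists_mem_filt D
    exact this q D hD
  intro q
  induction q with
  | zero => intro D hD; rw [filt_zero_eq hD]; simp
  | succ q ih =>
    intro D hD
    induction hD using Submodule.span_induction with
    | mem D hD =>
      rcases hD with hD | ⟨x, D', hD, rfl⟩
      · rw [Set.mem_singleton_iff.1 hD, counit_one, one_smul]
      -- As `φ` and the counit both kill `D' x`, their values on `x D'` are minus those on the
      -- commutator `D' x - x D'`, whose order is covered by the induction.
      · have h1 := ih _ (mul_vec_sub_mem_filt x hD)
        rw [map_sub, map_sub, h, counit_mul_vec, zero_sub, zero_sub, neg_smul] at h1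
        exact neg_injective h1
    | zero => simp
    | add D D' _ _ h h' => rw [map_add, map_add, h, h', add_smul]
    | smul a D _ h => rw [map_smul, map_smul, h, smul_assoc]

end Counit

end Env
end LieAlgebroidJets

namespace LieAlgebroidJets

/-! ### Poincaré-Birkhoff-Witt representation on polynomials, and coordinate functions -/

namespace PBW

open Finsupp

section Rep

variable {A 𝔤 ι : Type*} [CommRing A] [LieRing 𝔤] [Module A 𝔤] [LieRingModule 𝔤 A]

/-- The additive operator on polynomials with given values on monomials that satisfies the Leibniz
rule with respect to the derivation `a ↦ ⁅x, a⁆` of the coefficients. -/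
noncomputable def op (x : 𝔤) (T : Multiset ι → Multiset ι →₀ A) :
    (Multiset ι →₀ A) →+ (Multiset ι →₀ A) :=
  Finsupp.liftAddHom fun J => AddMonoidHom.mk' (fun a => a • T J + single J ⁅x, a⁆)
    (fun a a' => by rw [add_smul, lie_add, single_add]; abel)

lemma op_single (x : 𝔤) (T : Multiset ι → Multiset ι →₀ A) (J : Multiset ι) (a : A) :
    op x T (single J a) = a • T J + single J ⁅x, a⁆ := by
  simp [op]

lemma op_apply (x : 𝔤) (T : Multiset ι → Multiset ι →₀ A) (p : Multiset ι →₀ A) :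
    op x T p = p.sum fun J a => a • T J + single J ⁅x, a⁆ := rfl

lemma op_congr (x : 𝔤) {T T' : Multiset ι → Multiset ι →₀ A} {p : Multiset ι →₀ A}
    (h : ∀ J ∈ p.support, T J = T' J) : op x T p = op x T' p := by
  rw [op_apply, op_apply]
  exact Finsupp.sum_congr fun J hJ => by rw [h J hJ]

variable (A) in
/-- Polynomials of degree at most `q`. -/
noncomputable def deg (ι : Type*) (q : ℕ) : Submodule A (Multiset ι →₀ A) :=
  Finsupp.supported A A {J | J.card ≤ q}

lemma card_le_of_mem_deg {q : ℕ} {p : Multiset ι →₀ A} (h : p ∈ deg A ι q) {J : Multiset ι}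
    (hJ : J ∈ p.support) : J.card ≤ q := (Finsupp.mem_supported A p).1 h hJ

lemma single_mem_deg {q : ℕ} {J : Multiset ι} (h : J.card ≤ q) (a : A) : single J a ∈ deg A ι q :=
  Finsupp.single_mem_supported A a h

lemma deg_mono {q r : ℕ} (h : q ≤ r) : deg A ι q ≤ deg A ι r :=
  Finsupp.supported_mono fun _ hJ => le_trans hJ h

lemma op_mem_deg (x : 𝔤) {T : Multiset ι → Multiset ι →₀ A} {q r : ℕ} (hqr : q ≤ r)
    (hT : ∀ J, J.card ≤ q → T J ∈ deg A ι r) {p : Multiset ι →₀ A} (h : p ∈ deg A ι q) :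
    op x T p ∈ deg A ι r := by
  rw [op_apply]
  refine Submodule.sum_mem _ fun J hJ => ?_
  have hJ := card_le_of_mem_deg h hJ
  exact add_mem (Submodule.smul_mem _ _ (hT J hJ)) (single_mem_deg (hJ.trans hqr) _)

/-- Whatever the values `T` on monomials, the operator satisfies the Leibniz rule; only the bracket
relation remains to be arranged by the choice of `T`. -/
lemma op_smul [LieRinehartRing A 𝔤] (x : 𝔤) (T : Multiset ι → Multiset ι →₀ A) (a : A)
    (p : Multiset ι →₀ A) : op x T (a • p) = a • op x T p + ⁅x, a⁆ • p := by
  induction p using Finsupp.induction_linear with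
  | zero => simp
  | add p p' h h' => simp only [smul_add, map_add, h, h']; abel
  | single J c =>
    rw [smul_single, op_single, op_single, smul_eq_mul, LieRinehartRing.leibniz_mul_right, single_add,
      smul_add, mul_smul, smul_single, smul_single, smul_eq_mul, smul_eq_mul, add_assoc]

variable [LinearOrder ι] [Fintype ι]

/-- The least element of a nonempty multiset. -/
def least (J : Multiset ι) (h : J ≠ 0) : ι := J.toFinset.min' (by simpa using h)

lemma least_mem (J : Multiset ι) (h : J ≠ 0) : least J h ∈ J :=
  Multiset.mem_toFinset.1 (Finset.min'_mem _ _)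

lemma least_le (J : Multiset ι) (h : J ≠ 0) {l : ι} (hl : l ∈ J) : least J h ≤ l :=
  Finset.min'_le _ _ (Multiset.mem_toFinset.2 hl)

lemma least_cons {k : ι} {K : Multiset ι} (h : ∀ l ∈ K, k ≤ l) :
    least (k ::ₘ K) (Multiset.cons_ne_zero) = k := by
  refine le_antisymm (least_le _ _ (Multiset.mem_cons_self k K)) ?_
  rcases Multiset.mem_cons.1 (least_mem (k ::ₘ K) Multiset.cons_ne_zero) with e | e
  · exact e.ge
  · exact h _ e

variable (b : Module.Basis ι A 𝔤)

open Classical in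
/-- Approximations to the action of the basis vectors on monomials in the representation of the
enveloping algebra on polynomials; `act b p i J` is correct for monomials `J` of degree at
most `p`. -/
noncomputable def act : ℕ → ι → Multiset ι → Multiset ι →₀ A
  | 0, i, J => single (i ::ₘ J) 1
  | p + 1, i, J =>
    -- With `k` the least element and `J = k K`, the relation to be enforced is `b_i b_k K = b_k
    -- (b_i K) + [b_i, b_k] K`. The top part `i K` of `b_i K` is sent by `b_k` to `k i K` outright;
    -- the remainder has lower degree and is handled recursively. The first argument bounds the
    -- depth of the recursion.
    if h : J ≠ 0 then
      if least J h < i then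
        single (i ::ₘ J) 1 +
          op (b (least J h)) (act p (least J h))
            (act p i (J.erase (least J h)) - single (i ::ₘ J.erase (least J h)) 1) +
          ∑ l, b.repr ⁅b i, b (least J h)⁆ l • act p l (J.erase (least J h))
      else single (i ::ₘ J) 1
    else single (i ::ₘ J) 1

lemma act_of_le (p : ℕ) {i : ι} {J : Multiset ι} (h : ∀ l ∈ J, i ≤ l) :
    act b p i J = single (i ::ₘ J) 1 := by
  cases p with
  | zero => rfl
  | succ p =>
    rw [act]
    split_ifs with h1 h2
    · exact absurd h2 (not_lt.2 (h _ (least_mem J h1)))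
    · rfl
    · rfl

lemma act_of_lt (p : ℕ) {i k : ι} {K : Multiset ι} (h : ∀ l ∈ K, k ≤ l) (hi : k < i) :
    act b (p + 1) i (k ::ₘ K) = single (i ::ₘ k ::ₘ K) 1 +
      op (b k) (act b p k) (act b p i K - single (i ::ₘ K) 1) +
      ∑ l, b.repr ⁅b i, b k⁆ l • act b p l K := by
  rw [act, dif_pos Multiset.cons_ne_zero, least_cons h, if_pos hi, Multiset.erase_cons_head]

/-- Case distinction used to compute with `act`. -/
lemma le_or_exists_cons (i : ι) (J : Multiset ι) :
    (∀ l ∈ J, i ≤ l) ∨ ∃ k K, J = k ::ₘ K ∧ (∀ l ∈ K, k ≤ l) ∧ k < i := by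
  by_cases h : J = 0
  · left; rw [h]; simp
  · rcases lt_or_ge (least J h) i with hi | hi
    · right
      refine ⟨least J h, J.erase (least J h), (Multiset.cons_erase (least_mem J h)).symm,
        fun l hl => least_le J h (Multiset.mem_of_mem_erase hl), hi⟩
    · left
      exact fun l hl => hi.trans (least_le J h hl)

/-- The leading term of `b_i J` is the monomial `i J`. The degree bound on the rest is what makes
the recursive calls in `act` terminate at correct values. -/
lemma act_sub_mem_deg (p : ℕ) (i : ι) (J : Multiset ι) :
    act b p i J - single (i ::ₘ J) 1 ∈ deg A ι J.card := by
  induction p generalizing i J with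
  | zero => rw [act, sub_self]; exact zero_mem _
  | succ p ih =>
    have act_mem : ∀ i J, act b p i J ∈ deg A ι (J.card + 1) := fun i J => by
      have := add_mem (deg_mono (Nat.le_succ _) (ih i J))
        (single_mem_deg (Multiset.card_cons i J).le (1 : A))
      rwa [sub_add_cancel] at this
    rcases le_or_exists_cons i J with h | ⟨k, K, rfl, hK, hi⟩
    · rw [act_of_le b _ h, sub_self]; exact zero_mem _
    · rw [act_of_lt b p hK hi, add_assoc, add_sub_cancel_left, Multiset.card_cons]
      refine add_mem ?_ (sum_mem fun l _ => Submodule.smul_mem _ _ (act_mem l K))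
      exact op_mem_deg (b k) (Nat.le_succ _)
        (fun J hJ => deg_mono (Nat.succ_le_succ hJ) (act_mem k J)) (ih i K)

/-- The recursion for a monomial of degree `n + 1` evaluates `act` only on monomials of degree at
most `n`, so the approximations are stationary from the degree of the monomial on. -/
lemma act_succ (p : ℕ) (i : ι) (J : Multiset ι) (h : J.card ≤ p) :
    act b (p + 1) i J = act b p i J := by
  induction p generalizing i J with
  | zero =>
    have : J = 0 := by simpa using h
    rw [this, act_of_le, act_of_le] <;> simp
  | succ p ih =>
    rcases le_or_exists_cons i J with h' | ⟨k, K, rfl, hK, hi⟩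
    · rw [act_of_le b _ h', act_of_le b _ h']
    · rw [Multiset.card_cons] at h
      have h : K.card ≤ p := by omega
      rw [act_of_lt b _ hK hi, act_of_lt b _ hK hi, ih i K h]
      congr 2
      · refine op_congr _ fun J hJ => ih k J ?_
        exact (card_le_of_mem_deg (act_sub_mem_deg b p i K) hJ).trans h
      · funext l; rw [ih l K h]

lemma act_eq (p : ℕ) (i : ι) (J : Multiset ι) (h : J.card ≤ p) :
    act b p i J = act b J.card i J := by
  induction p, h using Nat.le_induction with
  | base => rfl
  | succ p h ih => rw [act_succ b p i J h, ih]

/-- The action of a basis vector on polynomials. -/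
noncomputable def basisAct (i : ι) : (Multiset ι →₀ A) →+ (Multiset ι →₀ A) :=
  op (b i) fun J => act b J.card i J

/-- The action of a vector on polynomials. -/
noncomputable def vecAct (x : 𝔤) : (Multiset ι →₀ A) →+ (Multiset ι →₀ A) where
  toFun p := ∑ l, b.repr x l • basisAct b l p
  map_zero' := by simp
  map_add' p p' := by simp [smul_add, Finset.sum_add_distrib]

lemma vecAct_apply (x : 𝔤) (p : Multiset ι →₀ A) :
    vecAct b x p = ∑ l, b.repr x l • basisAct b l p := rfl

lemma vecAct_basis (i : ι) (p : Multiset ι →₀ A) : vecAct b (b i) p = basisAct b i p := by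
  rw [vecAct_apply, Finset.sum_eq_single i]
  · simp
  · intro j _ hj
    rw [b.repr_self, Finsupp.single_eq_of_ne hj, zero_smul]
  · simp

lemma vecAct_add (x y : 𝔤) (p : Multiset ι →₀ A) :
    vecAct b (x + y) p = vecAct b x p + vecAct b y p := by
  simp [vecAct_apply, add_smul, Finset.sum_add_distrib]

lemma vecAct_smul_left (a : A) (x : 𝔤) (p : Multiset ι →₀ A) :
    vecAct b (a • x) p = a • vecAct b x p := by
  simp only [vecAct_apply, map_smul, Finsupp.smul_apply, smul_eq_mul, mul_smul, Finset.smul_sum]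

/-- `vecAct`, as a linear map in the vector. -/
noncomputable def vecActHom (p : Multiset ι →₀ A) : 𝔤 →ₗ[A] (Multiset ι →₀ A) where
  toFun x := vecAct b x p
  map_add' x y := vecAct_add b x y p
  map_smul' a x := vecAct_smul_left b a x p

lemma vecAct_zero (p : Multiset ι →₀ A) : vecAct b 0 p = 0 := map_zero (vecActHom b p)

lemma vecAct_neg (x : 𝔤) (p : Multiset ι →₀ A) : vecAct b (-x) p = - vecAct b x p :=
  map_neg (vecActHom b p) x

lemma vecAct_sub (x y : 𝔤) (p : Multiset ι →₀ A) :
    vecAct b (x - y) p = vecAct b x p - vecAct b y p :=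
  map_sub (vecActHom b p) x y

variable [LieRinehartRing A 𝔤]

lemma lie_one (x : 𝔤) : ⁅x, (1 : A)⁆ = 0 := by
  simpa using LieRinehartRing.leibniz_mul_right x (1 : A) (1 : A)

lemma basisAct_single (i : ι) (J : Multiset ι) :
    basisAct b i (single J 1) = act b J.card i J := by
  rw [basisAct, op_single, lie_one, single_zero, add_zero, one_smul]

lemma basisAct_single_of_le' {i : ι} {J : Multiset ι} (h : ∀ l ∈ J, i ≤ l) :
    basisAct b i (single J 1) = single (i ::ₘ J) 1 := by
  rw [basisAct_single, act_of_le b _ h]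

lemma basisAct_sub_mem_deg (i : ι) (J : Multiset ι) :
    basisAct b i (single J 1) - single (i ::ₘ J) 1 ∈ deg A ι J.card := by
  rw [basisAct_single]
  exact act_sub_mem_deg b _ i J

/-- The bracket relation that holds by construction: it is the recursive clause of `act`, with its
leading monomial recognised as `b_k` applied to `i K`. -/
lemma basisAct_single_of_lt {i k : ι} {K : Multiset ι} (h : ∀ l ∈ K, k ≤ l) (hi : k < i) :
    basisAct b i (single (k ::ₘ K) 1) = basisAct b k (basisAct b i (single K 1)) +
      vecAct b ⁅b i, b k⁆ (single K 1) := by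
  have hk : ∀ l ∈ i ::ₘ K, k ≤ l := fun l hl => by
    rcases Multiset.mem_cons.1 hl with rfl | hl
    · exact hi.le
    · exact h l hl
  have e : basisAct b i (single K 1) =
    single (i ::ₘ K) 1 + (basisAct b i (single K 1) - single (i ::ₘ K) 1) := by abel
  rw [basisAct_single, Multiset.card_cons, act_of_lt b _ h hi, vecAct_apply, e, map_add,
    basisAct_single_of_le' b hk, Multiset.cons_swap k i K]
  simp only [basisAct_single]
  congr 2
  refine op_congr _ fun J hJ => act_eq b _ k J ?_
  exact card_le_of_mem_deg (act_sub_mem_deg b _ i K) hJ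

lemma basisAct_smul (i : ι) (a : A) (p : Multiset ι →₀ A) :
    basisAct b i (a • p) = a • basisAct b i p + ⁅b i, a⁆ • p := op_smul _ _ _ _

lemma vecAct_smul (x : 𝔤) (a : A) (p : Multiset ι →₀ A) :
    vecAct b x (a • p) = a • vecAct b x p + ⁅x, a⁆ • p := by
  have h : ⁅x, a⁆ = ∑ l, b.repr x l * ⁅b l, a⁆ := by
    conv_lhs => rw [← b.sum_repr x]
    let f : 𝔤 →+ A := AddMonoidHom.mk' (fun x => ⁅x, a⁆) fun x y => add_lie x y a
    change f _ = _
    rw [map_sum]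
    exact Finset.sum_congr rfl fun l _ => LieRinehartRing.lie_smul_eq_mul _ _ _
  simp only [vecAct_apply, basisAct_smul, smul_add, Finset.sum_add_distrib, Finset.smul_sum]
  rw [h, Finset.sum_smul]
  simp only [mul_smul, smul_comm a]

/-- The polynomials on which the action of vectors is compatible with brackets. -/
noncomputable def good : Submodule A (Multiset ι →₀ A) where
  carrier := {p | ∀ x y, vecAct b x (vecAct b y p) - vecAct b y (vecAct b x p) = vecAct b ⁅x, y⁆ p}
  zero_mem' x y := by simp
  add_mem' {p q} hp hq x y := by
    simp only [map_add]
    rw [← hp, ← hq]; abel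
  smul_mem' a p hp x y := by
    simp only [vecAct_smul, map_add]
    rw [← hp, lie_lie, sub_smul, smul_sub]
    abel

/-- By the Leibniz rules the defect of the bracket relation is `A`-bilinear and alternating in the
two vectors, so pairs of basis vectors in one order suffice. -/
lemma mem_good_of_basis {p : Multiset ι →₀ A}
    (h : ∀ i j, j < i → basisAct b i (basisAct b j p) - basisAct b j (basisAct b i p) =
      vecAct b ⁅b i, b j⁆ p) : p ∈ good b := by
  have h2 : ∀ i y, vecAct b (b i) (vecAct b y p) - vecAct b y (vecAct b (b i) p) =
      vecAct b ⁅b i, y⁆ p := by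
    intro i y
    induction b.mem_span y using Submodule.span_induction with
    | mem y hy =>
      obtain ⟨j, rfl⟩ := hy
      simp only [vecAct_basis]
      rcases lt_trichotomy j i with hj | rfl | hj
      · exact h i j hj
      · rw [lie_self, vecAct_zero, sub_self]
      · rw [← lie_skew, vecAct_neg, ← h j i hj]; abel
    | zero => simp [vecAct_zero]
    | add y z _ _ hy hz =>
      simp only [vecAct_add, map_add, lie_add]
      rw [← hy, ← hz]; abel
    | smul a y _ hy =>
      rw [LieRinehartRing.leibniz_smul_right, vecAct_add, vecAct_smul_left, vecAct_smul_left,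
        vecAct_smul_left, vecAct_smul_left, vecAct_smul, ← hy, smul_sub]
      abel
  intro x y
  induction b.mem_span x using Submodule.span_induction with
  | mem x hx =>
    obtain ⟨i, rfl⟩ := hx
    exact h2 i y
  | zero => simp [vecAct_zero]
  | add x z _ _ hx hz =>
    simp only [vecAct_add, map_add, add_lie]
    rw [← hx, ← hz]; abel
  | smul a x _ hx =>
    rw [← lie_skew, LieRinehartRing.leibniz_smul_right, ← lie_skew, smul_neg, vecAct_neg,
      vecAct_add, vecAct_neg, vecAct_smul_left, vecAct_smul_left, vecAct_smul_left,
      vecAct_smul_left, vecAct_smul, ← hx, smul_sub]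
    abel

/-- The usual confluence argument by induction on the degree. If `j` is at most every letter of `J`,
the relation for `b_i` and `b_j` was imposed. Otherwise the least letter `k` of `J = k K` is smaller
than `i` and `j`, and the relation follows from those involving `b_k` by the Jacobi identity. -/
lemma single_mem_good (J : Multiset ι) : single J (1 : A) ∈ good b := by
  induction hn : J.card using Nat.strong_induction_on generalizing J with
  | _ n ih =>
    have ih' : ∀ m < n, ∀ p ∈ deg A ι m, p ∈ good b := fun m hm p hp => by
      rw [← Finsupp.sum_single p]
      refine Submodule.sum_mem _ fun J hJ => ?_
      have := ih J.card ((card_le_of_mem_deg hp hJ).trans_lt hm) J rfl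
      change single J (p J) ∈ good b
      rw [← mul_one (p J), ← smul_eq_mul, ← smul_single]
      exact Submodule.smul_mem _ _ this
    refine mem_good_of_basis b fun i j hij => ?_
    rcases le_or_exists_cons j J with h | ⟨k, K, rfl, hK, hj⟩
    · rw [basisAct_single_of_le' b h, basisAct_single_of_lt b h hij]
      abel
    · rw [Multiset.card_cons] at hn
      have hz : single K (1 : A) ∈ good b := ih K.card (by omega) K rfl
      -- The relation for `b_i, b_k` on `b_j K`: on the leading monomial `j K` it holds by
      -- construction since `k` is least, and the remainder has degree below `n`.
      have rel : ∀ i j, k < i → k < j →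
          vecAct b (b i) (vecAct b (b k) (vecAct b (b j) (single K 1))) =
          vecAct b (b k) (vecAct b (b i) (vecAct b (b j) (single K 1))) +
            vecAct b ⁅b i, b k⁆ (vecAct b (b j) (single K 1)) := by
        intro i j hi hj
        have hkj : ∀ l ∈ j ::ₘ K, k ≤ l := fun l hl => by
          rcases Multiset.mem_cons.1 hl with rfl | hl
          · exact hj.le
          · exact hK l hl
        have hw := ih' K.card (by omega) _ (basisAct_sub_mem_deg b j K) (b i) (b k)
        have e := basisAct_single_of_lt b hkj hi
        rw [← basisAct_single_of_le' b hkj] at e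
        simp only [map_sub] at hw
        simp only [vecAct_basis] at hw ⊢
        rw [e] at hw
        rw [← sub_eq_zero] at hw ⊢
        rw [← hw]
        abel
      have hzk : single (k ::ₘ K) (1 : A) = vecAct b (b k) (single K 1) := by
        rw [vecAct_basis, basisAct_single_of_le' b hK]
      -- All relations needed to move `b_k` to the front of `b_i b_j b_k K` and `b_j b_i b_k K`. The
      -- brackets of brackets that arise combine by the Jacobi identity.
      have r1 := rel i j (hj.trans hij) hj
      have r2 := rel j i hj (hj.trans hij)
      have g1 := hz (b j) (b k)
      have g2 := hz (b i) (b k)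
      have g3 := hz (b i) ⁅b j, b k⁆
      have g4 := hz (b j) ⁅b i, b k⁆
      have g5 := hz ⁅b i, b j⁆ (b k)
      have g6 := congrArg (vecAct b (b k)) (hz (b i) (b j))
      rw [lie_lie, vecAct_sub] at g5
      rw [sub_eq_iff_eq_add] at g1 g2 g3 g4 g5
      rw [map_sub, sub_eq_iff_eq_add] at g6
      rw [← vecAct_basis, ← vecAct_basis, ← vecAct_basis, ← vecAct_basis, hzk, g1, g2, map_add,
        map_add, r1, r2, g3, g4, g5, g6]
      abel

lemma mem_good (p : Multiset ι →₀ A) : p ∈ good b := by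
  rw [← Finsupp.sum_single p]
  refine Submodule.sum_mem _ fun J _ => ?_
  rw [← mul_one (p J), ← smul_eq_mul, ← smul_single]
  exact Submodule.smul_mem _ _ (single_mem_good b J)

/-- `vecAct`, as an additive map to endomorphisms. -/
noncomputable def vecActEnd : 𝔤 →+ AddMonoid.End (Multiset ι →₀ A) where
  toFun := vecAct b
  map_zero' := DFunLike.ext _ _ fun p => vecAct_zero b p
  map_add' x y := DFunLike.ext _ _ fun p => vecAct_add b x y p

/-- The representation of the enveloping algebra on polynomials. -/
noncomputable def rep : Env A 𝔤 →+* AddMonoid.End (Multiset ι →₀ A) :=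
  Env.lift (B := AddMonoid.End (Multiset ι →₀ A)) (Module.toAddMonoidEnd A (Multiset ι →₀ A))
    (vecActEnd b)
    (fun a x => DFunLike.ext _ _ fun p => vecAct_smul_left b a x p)
    (fun x y => DFunLike.ext _ _ fun p => (mem_good b p x y).symm)
    (fun x a => DFunLike.ext _ _ fun p => by
      change ⁅x, a⁆ • p = vecAct b x (a • p) - a • vecAct b x p
      rw [vecAct_smul, add_sub_cancel_left])

lemma rep_fn (a : A) (p : Multiset ι →₀ A) : rep b (Env.fn a) p = a • p := by
  rw [rep, Env.lift_fn]; rfl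

lemma rep_vec (x : 𝔤) (p : Multiset ι →₀ A) : rep b (Env.vec x) p = vecAct b x p := by
  rw [rep, Env.lift_vec]; rfl

lemma rep_mul (D D' : Env A 𝔤) (p : Multiset ι →₀ A) :
    rep b (D * D') p = rep b D (rep b D' p) := by
  rw [map_mul]; rfl

/-- The coordinate functions: left linear functions on the enveloping algebra that vanish at `1`
and extend the coordinates of vectors with respect to a basis. -/
noncomputable def coord (j : ι) : Env A 𝔤 →ₗ[A] A where
  toFun D := rep b D (single 0 1) {j}
  map_add' D D' := by rw [map_add]; rfl
  map_smul' a D := by rw [Env.smul_eq, rep_mul, rep_fn]; rfl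

lemma coord_apply (j : ι) (D : Env A 𝔤) : coord b j D = rep b D (single 0 1) {j} := rfl

lemma coord_one (j : ι) : coord b j 1 = 0 := by
  rw [coord_apply, (rep b).map_one]
  change single (0 : Multiset ι) (1 : A) {j} = 0
  exact Finsupp.single_eq_of_ne (by simp)

lemma coord_vec (j : ι) (x : 𝔤) : coord b j (Env.vec x) = b.repr x j := by
  rw [coord_apply, rep_vec, vecAct_apply]
  have : ∀ l, basisAct b l (single 0 1) = single {l} 1 := fun l => by
    rw [basisAct_single_of_le' b (by simp)]; rfl
  simp only [this, smul_single, smul_eq_mul, mul_one]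
  rw [Finsupp.finsetSum_apply, Finset.sum_eq_single j]
  · simp
  · intro l _ hl
    exact Finsupp.single_eq_of_ne (by simpa using hl.symm)
  · simp

end Rep

section Repr

variable {A N A' N' ι : Type*} [CommRing A] [AddCommGroup N] [Module A N] [CommRing A']
  [AddCommGroup N'] [Module A' N'] [Fintype ι]

/-- Naturality of the coordinates with respect to a basis. -/
lemma map_repr (f : A →+* A') (g : N →+ N') (hs : ∀ a x, g (a • x) = f a • g x)
    (b : Module.Basis ι A N) (b' : Module.Basis ι A' N') (hb : ∀ i, g (b i) = b' i) (x : N)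
    (l : ι) : f (b.repr x l) = b'.repr (g x) l := by
  classical
  conv_rhs => rw [← b.sum_repr x, map_sum]
  simp only [hs, hb, map_sum, map_smul, Module.Basis.repr_self, smul_single, smul_eq_mul, mul_one]
  rw [Finsupp.finsetSum_apply, Finset.sum_eq_single l]
  · simp
  · intro j _ hj
    exact Finsupp.single_eq_of_ne hj.symm
  · simp

end Repr

/-! ### Naturality of the coordinate functions -/

section Naturality

variable {A 𝔤 ι : Type*} [CommRing A] [LieRing 𝔤] [Module A 𝔤] [LieRingModule 𝔤 A]
  {A' 𝔤' : Type*} [CommRing A'] [LieRing 𝔤'] [Module A' 𝔤'] [LieRingModule 𝔤' A']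
  (f : A →+* A') (g : 𝔤 →+ 𝔤') (hs : ∀ a x, g (a • x) = f a • g x)
  (hv : ∀ x y, g ⁅x, y⁆ = ⁅g x, g y⁆) (hf : ∀ x a, f ⁅x, a⁆ = ⁅g x, f a⁆)

/-- The map of polynomials induced by a map of coefficients. -/
noncomputable def mapPoly (f : A →+* A') : (Multiset ι →₀ A) →+ (Multiset ι →₀ A') :=
  Finsupp.mapRange.addMonoidHom f.toAddMonoidHom

lemma mapPoly_single (J : Multiset ι) (a : A) : mapPoly f (single J a) = single J (f a) := by
  simp [mapPoly]

lemma mapPoly_smul (a : A) (p : Multiset ι →₀ A) : mapPoly f (a • p) = f a • mapPoly f p := by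
  ext J
  exact map_mul f a (p J)

include hf in
lemma mapPoly_op (x : 𝔤) (T : Multiset ι → Multiset ι →₀ A) (T' : Multiset ι → Multiset ι →₀ A')
    (hT : ∀ J, mapPoly f (T J) = T' J) (p : Multiset ι →₀ A) :
    mapPoly f (op x T p) = op (g x) T' (mapPoly f p) := by
  induction p using Finsupp.induction_linear with
  | zero => simp
  | add p p' h h' => simp only [map_add, h, h']
  | single J c =>
    rw [op_single, map_add, mapPoly_smul, mapPoly_single, mapPoly_single, op_single, hT, hf]

variable [LinearOrder ι] [Fintype ι] (b : Module.Basis ι A 𝔤) (b' : Module.Basis ι A' 𝔤')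
  (hb : ∀ i, g (b i) = b' i)

-- The recursion uses only the basis, the bracket and its structure coefficients, and the action on
-- functions, all preserved by the given maps. Applied to restrictions, this makes the coordinate
-- functions of a frame into jets.
include hs hv hf hb in
lemma mapPoly_act (p : ℕ) (i : ι) (J : Multiset ι) : mapPoly f (act b p i J) = act b' p i J := by
  induction p generalizing i J with
  | zero => rw [act, act, mapPoly_single, map_one]
  | succ p ih =>
    rcases le_or_exists_cons i J with h | ⟨k, K, rfl, hK, hi⟩
    · rw [act_of_le b _ h, act_of_le b' _ h, mapPoly_single, map_one]
    · rw [act_of_lt b _ hK hi, act_of_lt b' _ hK hi, map_add, map_add, mapPoly_single, map_one,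
        mapPoly_op f g hf (b k) _ (act b' p k) (ih k), map_sub, ih, mapPoly_single, map_one,
        map_sum, hb]
      simp only [mapPoly_smul, map_repr f g hs b b' hb, hv, hb, ih]

include hs hv hf hb in
lemma mapPoly_vecAct (x : 𝔤) (p : Multiset ι →₀ A) :
    mapPoly f (vecAct b x p) = vecAct b' (g x) (mapPoly f p) := by
  rw [vecAct_apply, vecAct_apply, map_sum]
  refine Finset.sum_congr rfl fun l _ => ?_
  rw [mapPoly_smul, map_repr f g hs b b' hb]
  congr 1
  rw [basisAct, mapPoly_op f g hf (b l) _ (fun J => act b' J.card l J)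
    (fun J => mapPoly_act f g hs hv hf b b' hb _ l J), hb]
  rfl

variable [LieRinehartRing A 𝔤] [LieRinehartRing A' 𝔤']

include hb in
/-- Naturality of the coordinate functions. -/
lemma map_coord (j : ι) (D : Env A 𝔤) :
    f (coord b j D) = coord b' j (Env.map f g hs hv hf D) := by
  have : mapPoly f (rep b D (single 0 1)) = rep b' (Env.map f g hs hv hf D) (single 0 1) := by
    induction D using Env.induction with
    | one =>
      rw [map_one, map_one, map_one]
      change mapPoly f (single 0 1) = single 0 1
      rw [mapPoly_single, map_one]
    | add D D' h h' =>
      rw [map_add, map_add, map_add]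
      change mapPoly f (rep b D (single 0 1) + rep b D' (single 0 1)) = _
      rw [map_add, h, h']
      rfl
    | fn_mul a D h => rw [rep_mul, rep_fn, mapPoly_smul, h, map_mul, Env.map_fn, rep_mul, rep_fn]
    | vec_mul x D h =>
      rw [rep_mul, rep_vec, mapPoly_vecAct f g hs hv hf b b' hb, h, map_mul, Env.map_vec, rep_mul,
        rep_vec]
  exact DFunLike.congr_fun this {j}

end Naturality

end PBW
end LieAlgebroidJets

namespace LieAlgebroidJets

/-! ### Frames, and jets filtered by order of vanishing -/

section JetCalculus

open CategoryTheory TopologicalSpace Opposite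
open scoped Manifold ContDiff TensorProduct

variable {EM : Type*} [NormedAddCommGroup EM] [NormedSpace ℝ EM] {HM : Type*} [TopologicalSpace HM]
  {I : ModelWithCorners ℝ EM HM} {M : Type} [TopologicalSpace M] [ChartedSpace HM M]
  {L : LieAlgebroid I M} {E : SmoothModule I M}

/-- Finitely many sections over `U` form a frame if their restrictions to every smaller open set
form a basis of the module of sections. -/
def IsFrame (E : SmoothModule I M) {U : Opens M} {n : ℕ} (b : Fin n → Sec E U) : Prop :=
  ∀ (V : Opens M) (h : V ≤ U), LinearIndependent (Fn I V) (fun i => res E h (b i)) ∧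
    ⊤ ≤ Submodule.span (Fn I V) (Set.range fun i => res E h (b i))

namespace IsFrame

variable {U : Opens M} {n : ℕ} {b : Fin n → Sec E U} (hb : IsFrame E b)

include hb in
lemma restrict {V : Opens M} (h : V ≤ U) : IsFrame E (fun i => res E h (b i)) := fun W hW => by
  simp only [res_res]
  exact hb W (hW.trans h)

/-- The basis of the module of sections over a smaller open set given by a frame. -/
noncomputable def basis {V : Opens M} (h : V ≤ U) : Module.Basis (Fin n) (Fn I V) (Sec E V) :=
  Module.Basis.mk (hb V h).1 (hb V h).2

lemma basis_apply {V : Opens M} (h : V ≤ U) (i : Fin n) : hb.basis h i = res E h (b i) := by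
  simp [basis]

lemma res_basis {V W : Opens M} (h : V ≤ U) (h' : W ≤ V) (i : Fin n) :
    res E h' (hb.basis h i) = hb.basis (h'.trans h) i := by
  rw [basis_apply, basis_apply, res_res]

lemma res_repr {V W : Opens M} (h : V ≤ U) (h' : W ≤ V) (s : Sec E V) (i : Fin n) :
    resFn h' ((hb.basis h).repr s i) = (hb.basis (h'.trans h)).repr (res E h' s) i :=
  PBW.map_repr (resFn h') (res E h') (res_smul E h') (hb.basis h) (hb.basis (h'.trans h))
    (hb.res_basis h h') s i

end IsFrame

namespace Jet

variable {U V W : Opens M}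

/-- The coordinate functions on the enveloping algebra given by a frame, as jets. -/
noncomputable def coord {n : ℕ} {b : Fin n → Sec L.bundle U} (hb : IsFrame L.bundle b)
    (j : Fin n) : Jet L (structureSheaf I M) U :=
  ⟨fun V => PBW.coord (hb.basis V.2) j, fun V W h D =>
    PBW.map_coord (resFn h) (res L.bundle h) (res_smul L.bundle h) (L.res_bracket h)
      (L.res_anchor h) (hb.basis V.2) (hb.basis W.2) (hb.res_basis V.2 h) j D⟩

/-- Multiplication of the values of a jet with a function. -/
noncomputable def star (f : Fn I U) : Jet L E U →ₗ[Fn I U] Jet L E U where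
  toFun φ := ⟨fun V => resFn V.2 f • φ.1 V, fun V W h D => by
    change res E h (resFn V.2 f • φ.1 V D) = resFn W.2 f • φ.1 W (L.resEnv h D)
    rw [res_smul, φ.2 V W h, resFn_resFn]⟩
  map_add' φ ψ := by
    refine Jet.ext' fun V D => ?_
    exact smul_add _ _ _
  map_smul' g φ := rfl

lemma star_apply (f : Fn I U) (φ : Jet L E U) (V : {V : Opens M // V ≤ U}) (D : L.env V.1) :
    (star f φ).1 V D = resFn V.2 f • φ.1 V D := rfl

/-- The connection on jets. -/
noncomputable def act (x : Sec L.bundle U) (φ : Jet L E U) : Jet L E U := (jets L E).act U x φ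

lemma act_apply (x : Sec L.bundle U) (φ : Jet L E U) (V : {V : Opens M // V ≤ U})
    (D : L.env V.1) : (act x φ).1 V D =
      φ.1 V (D * Env.vec (res L.bundle V.2 x)) := rfl

/-- The connection on jets satisfies the Leibniz rule for the product. -/
lemma act_mulHom (a : Jet L (structureSheaf I M) U) (x : Sec L.bundle U) (φ : Jet L E U) :
    act x (mulHom U a φ) = mulHom U (act x a) φ + mulHom U a (act x φ) :=
  Subtype.ext (funext fun V => Env.conv_comp_mulVec (A := Fn I V.1) (𝔤 := Sec L.bundle V.1)
    (N := Sec E V.1) (a.1 V) (φ.1 V) (res L.bundle V.2 x))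

variable (L E U) in
/-- The jets that vanish on elements of order less than `q`. -/
noncomputable def vanish (q : ℕ) : Submodule (Fn I U) (Jet L E U) where
  carrier := {φ | ∀ (V : {V : Opens M // V ≤ U}) (D : L.env V.1), D ∈ Env.filt (Fn I V.1) (Sec L.bundle V.1) q → φ.1 V D = 0}
  zero_mem' V D _ := rfl
  add_mem' {φ ψ} hφ hψ V D hD := by rw [add_apply, hφ V D hD, hψ V D hD, add_zero]
  smul_mem' f φ hφ V D hD := by
    rw [smul_apply]
    refine hφ V _ ?_
    cases q with
    | zero => rw [Env.filt_zero_eq hD, zero_mul]; exact zero_mem _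
    | succ q =>
      have := add_mem (Env.filt_le_succ q (Env.mul_fn_sub_mem_filt (resFn V.2 f) hD))
        (Submodule.smul_mem _ (resFn V.2 f) hD)
      rwa [sub_add_cancel] at this

lemma mem_vanish_zero (φ : Jet L E U) : φ ∈ vanish L E U 0 := fun V D hD => by
  rw [Env.filt_zero_eq hD, map_zero]

lemma vanish_anti {q r : ℕ} (h : q ≤ r) : vanish L E U r ≤ vanish L E U q :=
  fun _ hφ V D hD => hφ V D (Env.filt_mono h hD)

lemma eq_zero_of_mem_vanish {φ : Jet L E U} (h : ∀ q, φ ∈ vanish L E U q) : φ = 0 :=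
  Jet.ext' fun V D => by
    obtain ⟨q, hq⟩ := Env.exists_mem_filt D
    exact h q V D hq

lemma star_mem_vanish (f : Fn I U) {q : ℕ} {φ : Jet L E U} (h : φ ∈ vanish L E U q) :
    star f φ ∈ vanish L E U q := fun V D hD => by
  rw [star_apply, h V D hD, smul_zero]

/-- The connection is right multiplication by a vector, which raises the order of operators by at
most one; it therefore costs at most one order of vanishing. -/
lemma act_mem_vanish (x : Sec L.bundle U) {q : ℕ} {φ : Jet L E U}
    (h : φ ∈ vanish L E U (q + 1)) : act x φ ∈ vanish L E U q :=
  fun V D hD => by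
    rw [act_apply]
    exact h V _ (Env.mul_vec_mem_filt _ hD)

/-- The values of a jet of functions, as functions. -/
noncomputable def fnVal (a : Jet L (structureSheaf I M) U) (V : {V : Opens M // V ≤ U}) (D : L.env V.1) :
    Fn I V.1 := a.1 V D

lemma mulHom_apply_of_right (a : Jet L (structureSheaf I M) U) {q : ℕ} {φ : Jet L E U}
    (h : φ ∈ vanish L E U q) (V : {V : Opens M // V ≤ U}) {D : L.env V.1}
    (hD : D ∈ Env.filt (Fn I V.1) (Sec L.bundle V.1) (q + 1)) :
    (mulHom U a φ).1 V D = fnVal a V 1 • φ.1 V D :=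
  Env.conv_apply_of_right (A := Fn I V.1) (a.1 V) (φ.1 V) (h V) hD

lemma mulHom_apply_of_left {q : ℕ} {a : Jet L (structureSheaf I M) U}
    (h : a ∈ vanish L (structureSheaf I M) U q) (φ : Jet L E U) (V : {V : Opens M // V ≤ U})
    {D : L.env V.1} (hD : D ∈ Env.filt (Fn I V.1) (Sec L.bundle V.1) (q + 1)) :
    (mulHom U a φ).1 V D = fnVal a V D • φ.1 V 1 :=
  Env.conv_apply_of_left (A := Fn I V.1) (a.1 V) (φ.1 V) (h V) hD

/-- The leading term of a product is the value `a(1)` times that of the right factor. Coordinate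
functions vanish at `1`, so multiplying by them gains one order. -/
lemma mulHom_mem_vanish_succ {a : Jet L (structureSheaf I M) U} (ha : ∀ V, fnVal a V 1 = 0) {q : ℕ}
    {φ : Jet L E U} (h : φ ∈ vanish L E U q) : mulHom U a φ ∈ vanish L E U (q + 1) :=
  fun V D hD => by
    rw [mulHom_apply_of_right a h V hD, ha, zero_smul]

section Frame

variable {n : ℕ} {b : Fin n → Sec L.bundle U} (hb : IsFrame L.bundle b)

lemma coord_one (j : Fin n) (V : {V : Opens M // V ≤ U}) : fnVal (coord hb j) V 1 = 0 :=
  PBW.coord_one (hb.basis V.2) j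

lemma coord_vec (j : Fin n) (V : {V : Opens M // V ≤ U}) (x : Sec L.bundle V.1) :
    fnVal (coord hb j) V (Env.vec x) = (hb.basis V.2).repr x j :=
  PBW.coord_vec (hb.basis V.2) j x

/-- The Euler operator acts on the leading term of a jet that vanishes in order less than `q`
by multiplication with `q`. -/
lemma euler_sub_mem_vanish (h : V ≤ U) {q : ℕ} {φ : Jet L E V} (hφ : φ ∈ vanish L E V q) :
    ∑ j, mulHom V (restrict h (coord hb j)) (act (res L.bundle h (b j)) φ)
      - q • φ ∈ vanish L E V (q + 1) := fun W D hD => by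
  have key := Env.euler_sub_mem_filt (fun j => hb.basis (W.2.trans h) j)
    (fun j => (PBW.coord (hb.basis (W.2.trans h)) j)) (PBW.coord_one _)
    (fun x => by
      simp only [PBW.coord_vec]
      exact (hb.basis (W.2.trans h)).sum_repr x) hD
  have e : (∑ j, mulHom V (restrict h (coord hb j))
      (act (res L.bundle h (b j)) φ) - q • φ).1 W D =
      φ.1 W (∑ j, Env.conv (PBW.coord (hb.basis (W.2.trans h)) j)
        (Env.mulVec (hb.basis (W.2.trans h) j)) D - q • D) := by
    rw [map_sub, map_sum, map_nsmul]
    have e1 : ∀ (φ ψ : Jet L E V), (φ - ψ).1 W D = φ.1 W D - ψ.1 W D := fun _ _ => rfl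
    have e2 : ∀ (φ : Jet L E V), (q • φ).1 W D = q • φ.1 W D := fun φ => by
      let F : Jet L E V →+ Sec E W.1 := AddMonoidHom.mk' (fun φ => φ.1 W D) (fun _ _ => rfl)
      exact map_nsmul F q φ
    have e3 : ∀ (φ : Fin n → Jet L E V), (∑ j, φ j).1 W D = ∑ j, (φ j).1 W D := fun φ => by
      let F : Jet L E V →+ Sec E W.1 := AddMonoidHom.mk' (fun φ => φ.1 W D) (fun _ _ => rfl)
      exact map_sum F φ _
    rw [e1, e2, e3]
    congr 1
    refine Finset.sum_congr rfl fun j _ => ?_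
    -- The jet is pulled out of the product, so that the Euler operator acts on `D` before the jet
    -- is evaluated.
    rw [← Env.conv_comp_left, hb.basis_apply, ← res_res L.bundle h W.2]
    rfl
  rw [e]
  exact hφ W _ key

/-- The derivative of `t_j` along `z` has value at `1` the `j`-th coordinate `z_j`, and `ψ(z) = ∑
z_j ψ(b_j)`. Here `z_j` multiplies on the right inside the argument of the jet, which alters only
higher-order terms. In the homotopy formula this is applied to each slot of a form. -/
lemma linear_sub_mem_vanish (h : V ≤ U) {q : ℕ} (ψ : Sec L.bundle V →ₗ[Fn I V] Jet L E V)
    (hψ : ∀ z, ψ z ∈ vanish L E V q) (z : Sec L.bundle V) :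
    ∑ j, mulHom V (act z (restrict h (coord hb j))) (ψ (res L.bundle h (b j))) - ψ z ∈ vanish L E V (q + 1) := by
  have e : ψ z = ∑ j, (hb.basis h).repr z j • ψ (res L.bundle h (b j)) := by
    conv_lhs => rw [← (hb.basis h).sum_repr z, map_sum]
    exact Finset.sum_congr rfl fun j _ => by rw [map_smul, hb.basis_apply]
  rw [e, ← Finset.sum_sub_distrib]
  refine sum_mem fun j _ W D hD => ?_
  have hj := hψ (res L.bundle h (b j))
  generalize ψ (res L.bundle h (b j)) = φ at hj
  change (mulHom V (act z (restrict h (coord hb j))) φ).1 W D - ((hb.basis h).repr z j • φ).1 W D = 0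
  have e1 : fnVal (act z (restrict h (coord hb j))) W 1 = resFn W.2 ((hb.basis h).repr z j) := by
    rw [hb.res_repr]
    change (coord hb j).1 ⟨W.1, W.2.trans h⟩ (1 * Env.vec _) = _
    rw [one_mul]
    exact coord_vec hb j ⟨W.1, W.2.trans h⟩ _
  rw [mulHom_apply_of_right _ hj W hD, smul_apply, e1, sub_eq_zero, ← map_smul, eq_comm,
    ← sub_eq_zero, ← map_sub]
  exact hj W _ (Env.mul_fn_sub_mem_filt _ hD)

end Frame

end Jet

end JetCalculus
end LieAlgebroidJets

namespace LieAlgebroidJets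

/-! ### Cartan calculus for contractions with coefficients -/

namespace CE

section

variable {A 𝔤 N : Type*} [CommRing A] [AddCommGroup 𝔤] [Module A 𝔤] [AddCommGroup N] [Module A N]

lemma altSum_apply {m : ℕ} {J : Type*} (s : Finset J) (f : J → 𝔤 [⋀^Fin m]→ₗ[A] N)
    (x : Fin m → 𝔤) : (∑ j ∈ s, f j) x = ∑ j ∈ s, f j x :=
  map_sum (AddMonoidHom.mk' (fun θ : 𝔤 [⋀^Fin m]→ₗ[A] N => θ x) (fun _ _ => rfl)) f s

end

open Fin Function

variable {A 𝔤 N : Type*} [CommRing A] [LieRing 𝔤] [Module A 𝔤] [LieRingModule 𝔤 A]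
  [LieRinehartRing A 𝔤] [AddCommGroup N] [Module A N] [LieRingModule 𝔤 N]
  [LieRinehartModule A 𝔤 N]

/-- Only the terms of `d` that differentiate values see `τ`; the bracket terms commute with it. Here
`τ'` is the covariant derivative of `τ`. -/
lemma d_compAlternatingMap {m : ℕ} (τ : N →ₗ[A] N) (τ' : 𝔤 → N →+ N)
    (h : ∀ x n, ⁅x, τ n⁆ = τ' x n + τ ⁅x, n⁆) (θ : 𝔤 [⋀^Fin m]→ₗ[A] N) (x : Fin (m + 1) → 𝔤) :
    d (τ.compAlternatingMap θ) x = τ (d θ x) +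
      ∑ l : Fin (m + 1), (-1 : ℤ) ^ (l : ℕ) • τ' (x l) (θ (l.removeNth x)) := by
  simp only [d_apply, dFun, map_sum, map_zsmul, map_add, LinearMap.compAlternatingMap_apply, h,
    smul_add, Finset.sum_add_distrib]
  abel

/-- The anticommutator of the differential with the contraction along `∑ⱼ τⱼ yⱼ`. -/
lemma d_ι_add_ι_d {m : ℕ} {J : Type*} [Fintype J] (y : J → 𝔤) (τ : J → N →ₗ[A] N)
    (τ' : J → 𝔤 → N →+ N) (h : ∀ j x n, ⁅x, τ j n⁆ = τ' j x n + τ j ⁅x, n⁆)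
    (θ : 𝔤 [⋀^Fin (m + 1)]→ₗ[A] N) (x : Fin (m + 1) → 𝔤) :
    d (∑ j, (τ j).compAlternatingMap (ι (y j) θ)) x +
      ∑ j, (τ j).compAlternatingMap (ι (y j) (d θ)) x =
    ∑ j, τ j (lieDer (y j) θ x) + ∑ j, ∑ l, τ' j (x l) (θ (update x l (y j))) := by
  rw [map_sum, altSum_apply, ← Finset.sum_add_distrib, ← Finset.sum_add_distrib]
  refine Finset.sum_congr rfl fun j _ => ?_
  rw [d_compAlternatingMap (τ j) (τ' j) (h j), LinearMap.compAlternatingMap_apply, ι_d,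
    AlternatingMap.sub_apply, map_sub]
  simp only [map_update_cons, map_zsmul, ι_apply]
  abel

end CE

/-! ### The Euler homotopy on forms with values in jets -/

section FormCalculus

open CategoryTheory TopologicalSpace Opposite
open scoped Manifold ContDiff TensorProduct

variable {EM : Type*} [NormedAddCommGroup EM] [NormedSpace ℝ EM] {HM : Type*} [TopologicalSpace HM]
  {I : ModelWithCorners ℝ EM HM} {M : Type} [TopologicalSpace M] [ChartedSpace HM M]
  {L : LieAlgebroid I M} {E : SmoothModule I M} {U : Opens M} {m : ℕ}

namespace Form

/-- The differential of forms with values in jets. -/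
noncomputable abbrev dJet : Form L (jetSheaf L E) m U →+ Form L (jetSheaf L E) (m + 1) U :=
  Form.d (N := jets L E)

lemma ext_apply {F : SmoothModule I M} {θ η : Form L F m U}
    (h : ∀ V (x : Fin m → Sec L.bundle V.1), θ.1 V x = η.1 V x) : θ = η :=
  Subtype.ext (funext fun V => AlternatingMap.ext (h V))

/-- Postcomposition of the values of a form with linear maps compatible with restriction. -/
noncomputable def postcomp {F F' : SmoothModule I M}
    (τ : ∀ V : {V : Opens M // V ≤ U}, Sec F V.1 →ₗ[Fn I V.1] Sec F' V.1)
    (hτ : ∀ (V W : {V : Opens M // V ≤ U}) (h : W.1 ≤ V.1) (s : Sec F V.1),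
      res F' h (τ V s) = τ W (res F h s)) : Form L F m U →+ Form L F' m U where
  toFun θ := ⟨fun V => (τ V).compAlternatingMap (θ.1 V), fun V W h x => by
    rw [LinearMap.compAlternatingMap_apply, LinearMap.compAlternatingMap_apply, hτ V W h,
      θ.2 V W h]⟩
  map_zero' := ext_apply fun V x => map_zero (τ V)
  map_add' θ η := ext_apply fun V x => map_add (τ V) _ _

/-- Contraction of a form with a section of `L`. -/
noncomputable def contract {F : SmoothModule I M} (y : Sec L.bundle U) :
    Form L F (m + 1) U →+ Form L F m U where
  toFun θ := ⟨fun V => (θ.1 V).curryLeft (res L.bundle V.2 y), fun V W h x => by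
    rw [AlternatingMap.curryLeft_apply_apply, AlternatingMap.curryLeft_apply_apply, θ.2 V W h]
    congr 1
    ext i
    refine Fin.cases ?_ (fun i => ?_) i
    · exact res_res L.bundle V.2 h y
    · rfl⟩
  map_zero' := rfl
  map_add' θ η := rfl

/-- Multiplication of the values of a form with values in jets with a function. -/
noncomputable def star (f : Fn I U) : Form L (jetSheaf L E) m U →+ Form L (jetSheaf L E) m U :=
  postcomp (fun V => (Jet.star (resFn V.2 f) : Jet L E V.1 →ₗ[Fn I V.1] Jet L E V.1))
    (fun _ _ _ _ => rfl)

/-- Multiplying values by `f` acts on the left of an operator's value, while the connection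
multiplies operators on the right, so no derivative of `f` appears. -/
lemma d_star (f : Fn I U) (θ : Form L (jetSheaf L E) m U) : dJet (star f θ) = star f (dJet θ) := by
  refine ext_apply fun V x => ?_
  let τ : Sec (jets L E).sheaf V.1 →ₗ[Fn I V.1] Sec (jets L E).sheaf V.1 :=
    (Jet.star (resFn V.2 f) : Jet L E V.1 →ₗ[Fn I V.1] Jet L E V.1)
  have := CE.d_compAlternatingMap (A := Fn I V.1) (𝔤 := Sec L.bundle V.1)
    (N := Sec (jets L E).sheaf V.1) τ (fun _ => 0)
    (fun x φ => by rw [AddMonoidHom.zero_apply, zero_add]; rfl) (θ.1 V) x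
  simp only [AddMonoidHom.zero_apply, smul_zero, Finset.sum_const_zero, add_zero] at this
  exact this

variable {n : ℕ} {b : Fin n → Sec L.bundle U} (hb : IsFrame L.bundle b)

/-- Contraction of a form with values in jets with the Euler vector field of a frame. -/
noncomputable def euler : Form L (jetSheaf L E) (m + 1) U →+ Form L (jetSheaf L E) m U :=
  ∑ j, (postcomp (F := jetSheaf L E) (F' := jetSheaf L E)
    (fun V => (Jet.mulHom V.1 (Jet.restrict V.2 (Jet.coord hb j)) :
      Jet L E V.1 →ₗ[Fn I V.1] Jet L E V.1)) (fun _ _ _ _ => rfl)).comp (contract (b j))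

lemma euler_apply (θ : Form L (jetSheaf L E) (m + 1) U) (V : {V : Opens M // V ≤ U}) :
    (euler hb θ).1 V = ∑ j, (Jet.mulHom V.1 (Jet.restrict V.2 (Jet.coord hb j)) :
      Jet L E V.1 →ₗ[Fn I V.1] Jet L E V.1).compAlternatingMap
        ((θ.1 V).curryLeft (res L.bundle V.2 (b j))) := by
  let F : Form L (jetSheaf L E) m U →+
    (Sec L.bundle V.1 [⋀^Fin m]→ₗ[Fn I V.1] Sec (jetSheaf L E) V.1) :=
    AddMonoidHom.mk' (fun θ => θ.1 V) (fun _ _ => rfl)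
  change F (euler hb θ) = _
  rw [euler, AddMonoidHom.finsetSum_apply, map_sum]
  rfl

/-- Forms with values in jets that vanish in order less than `q`. -/
def Vanishes (q : ℕ) (θ : Form L (jetSheaf L E) m U) : Prop :=
  ∀ V (x : Fin m → Sec L.bundle V.1), (θ.1 V x : Jet L E V.1) ∈ Jet.vanish L E V.1 q

lemma vanishes_zero (θ : Form L (jetSheaf L E) m U) : Vanishes 0 θ :=
  fun _ _ => Jet.mem_vanish_zero _

lemma Vanishes.sub {q : ℕ} {θ η : Form L (jetSheaf L E) m U} (h : Vanishes q θ)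
    (h' : Vanishes q η) : Vanishes q (θ - η) := fun V x => sub_mem (h V x) (h' V x)

lemma Vanishes.anti {q r : ℕ} (hqr : q ≤ r) {θ : Form L (jetSheaf L E) m U} (h : Vanishes r θ) :
    Vanishes q θ := fun V x => Jet.vanish_anti hqr (h V x)

lemma Vanishes.star {q : ℕ} {θ : Form L (jetSheaf L E) m U} (h : Vanishes q θ) (f : Fn I U) :
    Vanishes q (star f θ) := fun V x => Jet.star_mem_vanish _ (h V x)

lemma eq_zero_of_vanishes {θ : Form L (jetSheaf L E) m U} (h : ∀ q, Vanishes q θ) : θ = 0 :=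
  ext_apply fun V x => Jet.eq_zero_of_mem_vanish fun q => h q V x

lemma Vanishes.d {q : ℕ} {θ : Form L (jetSheaf L E) m U} (h : Vanishes (q + 1) θ) :
    Vanishes q (dJet θ) := fun V x => by
  refine Submodule.sum_mem (Jet.vanish L E V.1 q) fun l _ => ?_
  refine zsmul_mem (add_mem (Jet.act_mem_vanish _ (h V _)) (sum_mem fun k _ => ?_)) _
  -- Only the connection costs an order of vanishing; the bracket terms keep `q + 1`.
  exact Jet.vanish_anti (Nat.le_succ q) (h V _)

lemma Vanishes.euler {q : ℕ} {θ : Form L (jetSheaf L E) (m + 1) U} (h : Vanishes q θ) :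
    Vanishes (q + 1) (euler hb θ) := fun V x => by
  have e := (DFunLike.congr_fun (euler_apply hb θ V) x).trans (CE.altSum_apply
    (N := Sec (jets L E).sheaf V.1) _ _ x)
  refine (congrArg (fun φ : Jet L E V.1 => φ ∈ Jet.vanish L E V.1 (q + 1)) e).mpr ?_
  refine Submodule.sum_mem (Jet.vanish L E V.1 (q + 1)) fun j _ => ?_
  exact Jet.mulHom_mem_vanish_succ (fun W => Jet.coord_one hb j ⟨W.1, W.2.trans V.2⟩) (h V _)

/-- The Lie derivative along the Euler vector field multiplies the leading term of a form of degree
`m + 1` that vanishes in order less than `q` by `q + m + 1`. -/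
lemma Vanishes.homotopy {q : ℕ} {θ : Form L (jetSheaf L E) (m + 1) U} (h : Vanishes q θ) :
    Vanishes (q + 1) (dJet (Form.euler hb θ) + Form.euler hb (dJet θ) - (q + m + 1) • θ) := by
  intro V x
  let y : Fin n → Sec L.bundle V.1 := fun j => res L.bundle V.2 (b j)
  let t : Fin n → Jet L (structureSheaf I M) V.1 := fun j => Jet.restrict V.2 (Jet.coord hb j)
  let τ : Fin n → Sec (jets L E).sheaf V.1 →ₗ[Fn I V.1] Sec (jets L E).sheaf V.1 := fun j =>
    (Jet.mulHom V.1 (t j) : Jet L E V.1 →ₗ[Fn I V.1] Jet L E V.1)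
  let τ' : Fin n → Sec L.bundle V.1 → Sec (jets L E).sheaf V.1 →+ Sec (jets L E).sheaf V.1 :=
    fun j z => (Jet.mulHom V.1 (Jet.act z (t j)) :
      Jet L E V.1 →ₗ[Fn I V.1] Jet L E V.1).toAddMonoidHom
  let S : Submodule (Fn I V.1) (Sec (jets L E).sheaf V.1) := Jet.vanish L E V.1 (q + 1)
  let w : Sec L.bundle V.1 [⋀^Fin (m + 1)]→ₗ[Fn I V.1] Sec (jets L E).sheaf V.1 := θ.1 V
  have key := CE.d_ι_add_ι_d (A := Fn I V.1) y τ τ' (fun j x φ => Jet.act_mulHom (t j) x φ) w x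
  have ht : ∀ j W, Jet.fnVal (t j) W 1 = 0 := fun j W => Jet.coord_one hb j ⟨W.1, W.2.trans V.2⟩
  -- The factor `q`: the Euler operator acting on the values of the form.
  have h1 : ∑ j, τ j ⁅y j, w x⁆ - q • w x ∈ S := Jet.euler_sub_mem_vanish hb V.2 (h V x)
  -- The bracket terms of the Lie derivative are multiplied by coordinates that vanish at `1`, so
  -- they are negligible.
  have h2 : ∑ j, ∑ l, τ j (w (Function.update x l ⁅y j, x l⁆)) ∈ S :=
    sum_mem fun j _ => sum_mem fun l _ => Jet.mulHom_mem_vanish_succ (ht j) (h V _)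
  -- The summand `m + 1`: the derivatives of the coordinates reproduce the form once for each of its
  -- arguments.
  have h3 : ∑ l, (∑ j, τ' j (x l) (w (Function.update x l (y j))) - w x) ∈ S :=
    sum_mem fun l _ => by
      have h4 : ∑ j, τ' j (x l) (w (Function.update x l (y j))) -
          w (Function.update x l (x l)) ∈ S :=
        Jet.linear_sub_mem_vanish hb V.2 (q := q) (w.toMultilinearMap.toLinearMap x l)
          (fun z => h V (Function.update x l z)) (x l)
      rwa [Function.update_eq_self] at h4
  have e : (dJet (Form.euler hb θ) + Form.euler hb (dJet θ) - (q + m + 1) • θ).1 V x =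
      CE.d (∑ j, (τ j).compAlternatingMap (CE.ι (y j) w)) x +
      ∑ j, (τ j).compAlternatingMap (CE.ι (y j) (CE.d w)) x - (q + m + 1) • w x := by
    let F : Form L (jetSheaf L E) (m + 1) U →+ Sec (jets L E).sheaf V.1 :=
      AddMonoidHom.mk' (fun θ => θ.1 V x) (fun _ _ => rfl)
    change F (dJet (Form.euler hb θ) + Form.euler hb (dJet θ) - (q + m + 1) • θ) = _
    rw [map_sub, map_add, map_nsmul]
    refine congrArg (· - (q + m + 1) • w x) (congrArg₂ (· + ·) ?_ ?_)
    · change CE.d (A := Fn I V.1) (N := Sec (jets L E).sheaf V.1) ((Form.euler hb θ).1 V) x = _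
      rw [euler_apply]
      rfl
    · change (Form.euler hb (dJet θ)).1 V x = _
      rw [euler_apply]
      exact CE.altSum_apply _ _ _
  change _ ∈ S
  rw [e, key]
  have e' : ∑ j, τ j (CE.lieDer (y j) w x) + ∑ j, ∑ l, τ' j (x l) (w (Function.update x l (y j))) -
      (q + m + 1) • w x = (∑ j, τ j ⁅y j, w x⁆ - q • w x) -
      ∑ j, ∑ l, τ j (w (Function.update x l ⁅y j, x l⁆)) +
      ∑ l, (∑ j, τ' j (x l) (w (Function.update x l (y j))) - w x) := by
    simp only [CE.lieDer_apply, map_sub, map_sum, Finset.sum_sub_distrib, Finset.sum_const,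
      Finset.card_univ, Fintype.card_fin, add_smul]
    rw [Finset.sum_comm (f := fun j l => τ' j (x l) (w (Function.update x l (y j))))]
    abel
  rw [e']
  exact add_mem (sub_mem h1 h2) h3

include hb in
/-- A single step in the construction of a primitive of a closed form. -/
lemma exists_step {q : ℕ} {θ : Form L (jetSheaf L E) (m + 1) U} (h : Vanishes q θ)
    (hθ : dJet θ = 0) : ∃ η : Form L (jetSheaf L E) m U, Vanishes (q + 1) η ∧
      Vanishes (q + 1) (θ - dJet η) := by
  have h1 := h.homotopy hb
  rw [hθ, map_zero, add_zero] at h1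
  -- The eigenvalue `q + m + 1` is nonzero even for `q = 0`, because the form has positive degree.
  -- Its inverse acts through `star`, hence commutes with `d`.
  let c : Fn I U := algebraMap ℝ (Fn I U) ((q + m + 1 : ℕ) : ℝ)⁻¹
  refine ⟨star c (Form.euler hb θ), (h.euler hb).star c, ?_⟩
  have h2 := h1.star (-c)
  have e : ∀ ζ : Form L (jetSheaf L E) (m + 1) U, star (-c) (ζ - (q + m + 1) • θ) =
      θ - star c ζ := fun ζ => by
    have hc : ((q + m + 1 : ℕ) : Fn I U) * c = 1 := by
      rw [← map_natCast (algebraMap ℝ (Fn I U)), ← map_mul, mul_inv_cancel₀, map_one]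
      exact Nat.cast_ne_zero.2 (Nat.succ_ne_zero _)
    refine ext_apply fun V x => Jet.ext' fun W D => ?_
    let F : Form L (jetSheaf L E) (m + 1) U →+ Sec E W.1 :=
      AddMonoidHom.mk' (fun θ => (θ.1 V x : Jet L E V.1).1 W D) (fun _ _ => rfl)
    change resFn (W.2.trans V.2) (-c) • F (ζ - (q + m + 1) • θ) = F (θ - star c ζ)
    rw [map_sub, map_sub, map_nsmul, map_neg]
    change _ = _ - resFn (W.2.trans V.2) c • F ζ
    rw [neg_smul, smul_sub, neg_sub, ← Nat.cast_smul_eq_nsmul (Fn I W.1), smul_smul, mul_comm,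
      ← map_natCast (resFn (I := I) (W.2.trans V.2)), ← map_mul, hc, map_one, one_smul]
  rw [e, ← d_star] at h2
  exact h2

end Form
end FormCalculus
end LieAlgebroidJets

namespace LieAlgebroidJets

/-! ### Completeness of jets and the local Poincaré lemma -/

section Completeness

open CategoryTheory TopologicalSpace Opposite
open scoped Manifold ContDiff TensorProduct

variable {EM : Type*} [NormedAddCommGroup EM] [NormedSpace ℝ EM] {HM : Type*} [TopologicalSpace HM]
  {I : ModelWithCorners ℝ EM HM} {M : Type} [TopologicalSpace M] [ChartedSpace HM M]
  {L : LieAlgebroid I M} {E : SmoothModule I M} {U : Opens M} {m : ℕ}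

namespace Jet

lemma sum_range_apply {φ : ℕ → Jet L E U} (V : {V : Opens M // V ≤ U}) (D : L.env V.1) (q : ℕ) :
    (∑ r ∈ Finset.range q, φ r).1 V D = ∑ r ∈ Finset.range q, (φ r).1 V D :=
  map_sum (AddMonoidHom.mk' (fun φ : Jet L E U => φ.1 V D) (fun _ _ => rfl)) φ _

open Classical in
/-- The module of jets is complete: series of jets that vanish to increasing order have a sum. -/
lemma exists_series (φ : ℕ → Jet L E U) (h : ∀ r, φ r ∈ vanish L E U r) :
    ∃ ψ : Jet L E U, ∀ q, ψ - ∑ r ∈ Finset.range q, φ r ∈ vanish L E U q := by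
  -- On `D` of order less than `q` all terms with `r ≥ q` vanish, so any bound on the order gives
  -- the same finite sum; `Nat.find` picks the least.
  let F : ∀ V : {V : Opens M // V ≤ U}, L.env V.1 → Sec E V.1 := fun V D =>
    ∑ r ∈ Finset.range (Nat.find (Env.exists_mem_filt D)), (φ r).1 V D
  have hF : ∀ (V : {V : Opens M // V ≤ U}) (D : L.env V.1) q, D ∈ Env.filt (Fn I V.1) (Sec L.bundle V.1) q →
      F V D = ∑ r ∈ Finset.range q, (φ r).1 V D := by
    intro V D q hD
    refine Finset.sum_subset (Finset.range_mono (Nat.find_min' _ hD)) fun r _ hr => ?_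
    rw [Finset.mem_range, not_lt] at hr
    exact h r V D (Env.filt_mono hr (Nat.find_spec (Env.exists_mem_filt D)))
  have hmap : ∀ (V W : {V : Opens M // V ≤ U}) (h : W.1 ≤ V.1) (D : L.env V.1) (q : ℕ),
      D ∈ Env.filt (Fn I V.1) (Sec L.bundle V.1) q →
      L.resEnv h D ∈ Env.filt (Fn I W.1) (Sec L.bundle W.1) q := fun V W h D q =>
    Env.filt_induction (P := fun q D => L.resEnv h D ∈ Env.filt (Fn I W.1) (Sec L.bundle W.1) q)
      (fun q => by rw [map_zero]; exact zero_mem _)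
      (fun q D D' h h' => by rw [map_add]; exact add_mem h h')
      (fun q a D _ h => by rw [L.resEnv_smul]; exact Submodule.smul_mem _ _ h)
      (fun q => by rw [map_one]; exact Env.one_mem_filt q)
      (fun q x D _ h => by rw [map_mul, L.resEnv_vec]; exact Env.vec_mul_mem_filt _ h) q D
  refine ⟨⟨fun V => { toFun := F V, map_add' := fun D D' => ?_, map_smul' := fun a D => ?_ },
    fun V W hVW D => ?_⟩, fun q V D hD => ?_⟩
  · obtain ⟨q, hD⟩ := Env.exists_mem_filt D
    obtain ⟨q', hD'⟩ := Env.exists_mem_filt D'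
    have hD := Env.filt_mono (le_max_left q q') hD
    have hD' := Env.filt_mono (le_max_right q q') hD'
    rw [hF V _ _ (add_mem hD hD'), hF V _ _ hD, hF V _ _ hD', ← Finset.sum_add_distrib]
    exact Finset.sum_congr rfl fun r _ => map_add _ _ _
  · obtain ⟨q, hD⟩ := Env.exists_mem_filt D
    rw [hF V _ _ (Submodule.smul_mem _ a hD), hF V _ _ hD, RingHom.id_apply, Finset.smul_sum]
    exact Finset.sum_congr rfl fun r _ => map_smul _ _ _
  · obtain ⟨q, hD⟩ := Env.exists_mem_filt D
    change res E hVW (F V D) = F W (L.resEnv hVW D)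
    rw [hF V _ _ hD, hF W _ _ (hmap V W hVW D q hD), map_sum]
    exact Finset.sum_congr rfl fun r _ => (φ r).2 V W hVW D
  · change F V D - (∑ r ∈ Finset.range q, φ r).1 V D = 0
    rw [hF V D q hD, sum_range_apply, sub_self]

end Jet

namespace Form

lemma sum_apply (s : Finset ℕ) (η : ℕ → Form L E m U) (V : {V : Opens M // V ≤ U})
    (x : Fin m → Sec L.bundle V.1) : (∑ r ∈ s, η r).1 V x = ∑ r ∈ s, (η r).1 V x :=
  map_sum (AddMonoidHom.mk' (fun η : Form L E m U => η.1 V x) (fun _ _ => rfl)) η s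

/-- Series of forms that vanish to increasing order have a sum. -/
lemma exists_series (η : ℕ → Form L (jetSheaf L E) m U) (h : ∀ r, Vanishes r (η r)) :
    ∃ ζ : Form L (jetSheaf L E) m U, ∀ q, Vanishes q (ζ - ∑ r ∈ Finset.range q, η r) := by
  -- The sums are chosen separately for each tuple of arguments. A sum is determined by its partial
  -- sums modulo every order of vanishing, and this uniqueness forces multilinearity and
  -- compatibility with restriction.
  choose F hF using fun (V : {V : Opens M // V ≤ U}) (x : Fin m → Sec L.bundle V.1) =>
    Jet.exists_series (fun r => (η r).1 V x) (fun r => h r V x)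
  let S : ∀ (V : {V : Opens M // V ≤ U}), ℕ → Submodule (Fn I V.1) (Sec (jetSheaf L E) V.1) :=
    fun V q => Jet.vanish L E V.1 q
  let G : ∀ (V : {V : Opens M // V ≤ U}), (Fin m → Sec L.bundle V.1) → Sec (jetSheaf L E) V.1 := F
  have hG : ∀ V x q, G V x - ∑ r ∈ Finset.range q, (η r).1 V x ∈ S V q := fun V x q => hF V x q
  have eq_of : ∀ V (s t : Sec (jetSheaf L E) V.1), (∀ q, s - t ∈ S V q) → s = t :=
    fun V s t h => sub_eq_zero.1 (Jet.eq_zero_of_mem_vanish h)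
  let ζ : ∀ V : {V : Opens M // V ≤ U},
      Sec L.bundle V.1 [⋀^Fin m]→ₗ[Fn I V.1] Sec (jetSheaf L E) V.1 := fun V =>
    { toFun := G V
      map_update_add' := fun {inst} x i u v => by
        refine eq_of V _ _ fun q => ?_
        have h1 := hG V (Function.update x i (u + v)) q
        have h2 := add_mem (hG V (Function.update x i u) q) (hG V (Function.update x i v) q)
        have h3 := sub_mem h1 h2
        simp only [AlternatingMap.map_update_add, Finset.sum_add_distrib] at h3
        convert h3 using 1
        abel
      map_update_smul' := fun {inst} x i a u => by
        refine eq_of V _ _ fun q => ?_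
        have h1 := hG V (Function.update x i (a • u)) q
        have h2 := Submodule.smul_mem _ a (hG V (Function.update x i u) q)
        have h3 := sub_mem h1 h2
        simp only [AlternatingMap.map_update_smul, smul_sub, Finset.smul_sum] at h3
        convert h3 using 1
        abel
      map_eq_zero_of_eq' := fun x i j hij hne => by
        refine eq_of V _ _ fun q => ?_
        have h1 := hG V x q
        have h2 : ∀ r, (η r).1 V x = 0 := fun r => ((η r).1 V).map_eq_zero_of_eq x hij hne
        simp only [h2, Finset.sum_const_zero] at h1
        exact h1 }
  refine ⟨⟨ζ, fun V W hVW x => ?_⟩, fun q V x => ?_⟩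
  · refine eq_of W _ _ fun q => ?_
    have h1 : res (jetSheaf L E) hVW (G V x - ∑ r ∈ Finset.range q, (η r).1 V x) ∈ S W q :=
      fun W' D hD => hG V x q ⟨W'.1, W'.2.trans hVW⟩ D hD
    have h2 := sub_mem h1 (hG W (fun i => res L.bundle hVW (x i)) q)
    simp only [map_sub, map_sum, (η _).2 V W hVW, sub_sub_sub_cancel_right] at h2
    exact h2
  · have := hG V x q
    rw [← sum_apply] at this
    exact this

/-- The Poincaré lemma for forms with values in jets, over an open set with a frame. -/
lemma exists_primitive_of_frame {n : ℕ} {b : Fin n → Sec L.bundle U} (hb : IsFrame L.bundle b)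
    (θ : Form L (jetSheaf L E) (m + 1) U) (hθ : dJet θ = 0) :
    ∃ η : Form L (jetSheaf L E) m U, dJet η = θ := by
  have dd : ∀ η : Form L (jetSheaf L E) m U, dJet (dJet η) = 0 := fun η =>
    Form.d_d (N := jets L E) η
  let Z : ℕ → Type _ := fun q => {θ : Form L (jetSheaf L E) (m + 1) U // Vanishes q θ ∧ dJet θ = 0}
  choose step h1 h2 using fun (q : ℕ) (θ : Z q) => exists_step hb θ.2.1 θ.2.2
  -- The remainders of successive approximation: each stays closed and vanishes to one order more
  -- than the previous one.
  let z : ∀ q, Z q := fun q => Nat.rec (motive := Z) ⟨θ, vanishes_zero θ, hθ⟩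
    (fun q θ => ⟨θ.1 - dJet (step q θ), h2 q θ, by rw [map_sub, θ.2.2, dd, sub_self]⟩) q
  let η : ℕ → Form L (jetSheaf L E) m U := fun q => step q (z q)
  have hz : ∀ q, dJet (∑ r ∈ Finset.range q, η r) = θ - (z q).1 := by
    intro q
    induction q with
    | zero => rw [Finset.range_zero, Finset.sum_empty, map_zero]; exact (sub_self θ).symm
    | succ q ih =>
      rw [Finset.sum_range_succ, map_add, ih]
      change _ = θ - ((z q).1 - dJet (η q))
      abel
  obtain ⟨ζ, hζ⟩ := exists_series η fun r => (h1 r (z r)).anti (Nat.le_succ r)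
  refine ⟨ζ, sub_eq_zero.1 (eq_zero_of_vanishes fun q => ?_)⟩
  -- Since `d` costs one order, the approximation at stage `q + 1` controls `dζ - θ` to order `q`.
  have h3 := (hζ (q + 1)).d.sub ((z (q + 1)).2.1.anti (Nat.le_succ q))
  rw [map_sub, hz] at h3
  convert h3 using 1
  abel

end Form
end Completeness
end LieAlgebroidJets

namespace LieAlgebroidJets

/-! ### Partitions of unity and the global Poincaré lemma -/

section Gluing

open CategoryTheory TopologicalSpace Opposite
open scoped Manifold ContDiff TensorProduct

variable {EM : Type*} [NormedAddCommGroup EM] [NormedSpace ℝ EM] {HM : Type*} [TopologicalSpace HM]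
  {I : ModelWithCorners ℝ EM HM} {M : Type} [TopologicalSpace M] [ChartedSpace HM M]
  {L : LieAlgebroid I M} {E : SmoothModule I M} {m : ℕ}

/-- Smooth partitions of unity on an open subset subordinate to an open cover, together with
neighbourhoods of the points on which the sums are finite. -/
lemma exists_partition [FiniteDimensional ℝ EM] [IsManifold I ∞ M] [T2Space M]
    [SigmaCompactSpace M] (U : Opens M) (W : U → Opens M) (hW : ∀ y : U, y.1 ∈ W y) :
    ∃ (χ : U → Fn I U) (N : U → Opens M) (hN : ∀ y, N y ≤ U) (F : U → Finset U),
      (∀ y, y.1 ∈ N y) ∧ (∀ y, ∀ i ∈ F y, N y ≤ W i) ∧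
      (∀ y, ∀ i ∉ F y, resFn (hN y) (χ i) = 0) ∧ ∀ y, ∑ i ∈ F y, resFn (hN y) (χ i) = 1 := by
  -- Partitions of unity are needed on the open submanifold `U`. It is σ-compact because second
  -- countability and local compactness pass to open subsets.
  have : SecondCountableTopology HM := I.secondCountableTopology
  have : SecondCountableTopology M := ChartedSpace.secondCountable_of_sigmaCompact HM M
  have : LocallyCompactSpace HM := I.locallyCompactSpace
  have : LocallyCompactSpace U := ChartedSpace.locallyCompactSpace HM U
  obtain ⟨f, hf⟩ := SmoothPartitionOfUnity.exists_isSubordinate I (M := U) isClosed_univ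
    (fun y : U => Subtype.val ⁻¹' (W y : Set M)) (fun y => (W y).2.preimage continuous_subtype_val)
    (fun y _ => Set.mem_iUnion.2 ⟨y, hW y⟩)
  -- Near `y` only the functions whose closed support contains `y` can be nonzero, and these
  -- supports lie in the sets of the cover; after shrinking, the neighbourhood lies in all of the
  -- corresponding sets.
  have hO : ∀ y : U, ∃ O : Set U, IsOpen O ∧ y ∈ O ∧ ∀ z ∈ O, f.fintsupport z ⊆ f.fintsupport y ∧
      ∀ i ∈ f.fintsupport y, z.1 ∈ W i := by
    intro y
    have h1 := f.eventually_fintsupport_subset y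
    have h2 : ∀ᶠ z in nhds y, ∀ i ∈ f.fintsupport y, z.1 ∈ W i := by
      rw [Filter.eventually_all_finset]
      intro i hi
      refine ((W i).2.preimage continuous_subtype_val).mem_nhds ?_
      exact hf i ((f.mem_fintsupport_iff y i).1 hi)
    obtain ⟨O, h, hO, hy⟩ := eventually_nhds_iff.1 (h1.and h2)
    exact ⟨O, hO, hy, h⟩
  choose O hO hyO hz using hO
  refine ⟨fun i => f i, fun y => ⟨Subtype.val '' O y, U.2.isOpenMap_subtype_val _ (hO y)⟩, ?_,
    fun y => f.fintsupport y, fun y => ⟨y, hyO y, rfl⟩, ?_, ?_, ?_⟩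
  · rintro y _ ⟨z, _, rfl⟩
    exact z.2
  · rintro y i hi _ ⟨z, h, rfl⟩
    exact (hz y z h).2 i hi
  · intro y i hi
    ext ⟨_, z, h, rfl⟩
    change f i z = 0
    by_contra hne
    exact hi ((hz y z h).1 ((f.mem_fintsupport_iff z i).2 (subset_tsupport _ hne)))
  · intro y
    ext ⟨_, z, h, rfl⟩
    have hsub : f.finsupport z ⊆ f.fintsupport y := fun i hi =>
      (hz y z h).1 ((f.mem_fintsupport_iff z i).2 (subset_tsupport _ ((f.mem_finsupport z).1 hi)))
    have h1 := f.sum_finsupport' z (Set.mem_univ z) hsub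
    refine Eq.trans ?_ h1
    let ev : Fn I U →+* ℝ := ContMDiffMap.evalRingHom z
    change (ContMDiffMap.evalRingHom _ : Fn I _ →+* ℝ) (∑ i ∈ _, resFn _ (f i)) = _
    rw [map_sum]
    rfl

namespace Form

variable {U : Opens M} {F : SmoothModule I M}

/-- Forms that agree on an open cover agree. -/
lemma eq_of_restrict_eq {ι : Type} (W : ι → Opens M) (hW : ∀ i, W i ≤ U) (hcov : U ≤ iSup W)
    {θ η : Form L F m U} (h : ∀ i, restrict (hW i) θ = restrict (hW i) η) : θ = η := by
  refine ext_apply fun V x => ?_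
  refine eq_of_res_eq F (fun i => V.1 ⊓ W i) V.1 (fun i => inf_le_left)
    (by rw [← inf_iSup_eq]; exact le_inf le_rfl (V.2.trans hcov)) _ _ fun i => ?_
  rw [θ.2 V ⟨V.1 ⊓ W i, inf_le_left.trans V.2⟩ inf_le_left,
    η.2 V ⟨V.1 ⊓ W i, inf_le_left.trans V.2⟩ inf_le_left]
  exact congrArg (fun ζ : Form L F m (W i) => ζ.1 ⟨V.1 ⊓ W i, inf_le_right⟩ _) (h i)

/-- Compatible forms on an open cover can be glued. -/
lemma exists_glue {ι : Type} (W : ι → Opens M) (hW : ∀ i, W i ≤ U) (hcov : U ≤ iSup W)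
    (θ : ∀ i, Form L F m (W i))
    (hθ : ∀ i j, restrict (inf_le_left : W i ⊓ W j ≤ W i) (θ i) = restrict inf_le_right (θ j)) :
    ∃ η : Form L F m U, ∀ i, restrict (hW i) η = θ i := by
  have hθ' : ∀ (i j : ι) (V : Opens M) (hi : V ≤ W i) (hj : V ≤ W j) (x : Fin m → Sec L.bundle V),
      (θ i).1 ⟨V, hi⟩ x = (θ j).1 ⟨V, hj⟩ x := fun i j V hi hj x =>
    congrArg (fun ζ : Form L F m (W i ⊓ W j) => ζ.1 ⟨V, le_inf hi hj⟩ x) (hθ i j)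
  have hcov' : ∀ V : Opens M, V ≤ U → V ≤ ⨆ i, V ⊓ W i := fun V hV => by
    rw [← inf_iSup_eq]; exact le_inf le_rfl (hV.trans hcov)
  have glue : ∀ (V : {V : Opens M // V ≤ U}) (x : Fin m → Sec L.bundle V.1), ∃! t : Sec F V.1,
      ∀ i, res F (inf_le_left : V.1 ⊓ W i ≤ V.1) t =
        (θ i).1 ⟨V.1 ⊓ W i, inf_le_right⟩ (fun k => res L.bundle inf_le_left (x k)) := by
    intro V x
    refine existsUnique_glue F (fun i => V.1 ⊓ W i) V.1 (fun i => inf_le_left) (hcov' V.1 V.2) _ ?_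
    intro i j
    rw [(θ i).2 ⟨V.1 ⊓ W i, inf_le_right⟩
        ⟨(V.1 ⊓ W i) ⊓ (V.1 ⊓ W j), inf_le_left.trans inf_le_right⟩ inf_le_left,
      (θ j).2 ⟨V.1 ⊓ W j, inf_le_right⟩
        ⟨(V.1 ⊓ W i) ⊓ (V.1 ⊓ W j), inf_le_right.trans inf_le_right⟩ inf_le_right]
    simp only [res_res]
    exact hθ' i j _ _ _ _
  choose g hg _ using glue
  have hg' : ∀ (V : {V : Opens M // V ≤ U}) (x : Fin m → Sec L.bundle V.1) (V' : Opens M)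
      (h : V' ≤ V.1) (i : ι) (hi : V' ≤ W i),
      res F h (g V x) = (θ i).1 ⟨V', hi⟩ (fun k => res L.bundle h (x k)) := by
    intro V x V' h i hi
    rw [← res_res F (inf_le_left : V.1 ⊓ W i ≤ V.1) (le_inf h hi), hg V x i,
      (θ i).2 ⟨V.1 ⊓ W i, inf_le_right⟩ ⟨V', hi⟩ (le_inf h hi)]
    simp only [res_res]
  have ext : ∀ (V : {V : Opens M // V ≤ U}) (s t : Sec F V.1),
      (∀ i, res F (inf_le_left : V.1 ⊓ W i ≤ V.1) s = res F inf_le_left t) → s = t := fun V s t =>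
    eq_of_res_eq F (fun i => V.1 ⊓ W i) V.1 (fun i => inf_le_left) (hcov' V.1 V.2) s t
  have upd : ∀ (inst : DecidableEq (Fin m)) (V V' : Opens M) (h : V' ≤ V)
      (x : Fin m → Sec L.bundle V) (k : Fin m) (u : Sec L.bundle V),
      (fun l => res L.bundle h (Function.update x k u l)) =
        Function.update (fun l => res L.bundle h (x l)) k (res L.bundle h u) := by
    intro inst V V' h x k u
    ext l
    rcases eq_or_ne l k with rfl | hl
    · simp
    · simp [hl]
  let η : Form L F m U := ⟨fun V =>
    { toFun := g V
      map_update_add' := fun {inst} x k u v => by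
        refine ext V _ _ fun i => ?_
        rw [map_add, hg, hg, hg]
        simp only [upd, map_add, AlternatingMap.map_update_add]
      map_update_smul' := fun {inst} x k a u => by
        refine ext V _ _ fun i => ?_
        rw [res_smul, hg, hg]
        simp only [upd, res_smul, AlternatingMap.map_update_smul]
      map_eq_zero_of_eq' := fun x k l hkl hne => by
        refine ext V _ _ fun i => ?_
        rw [hg, map_zero]
        exact AlternatingMap.map_eq_zero_of_eq _ _ (by rw [hkl]) hne }, fun V V' h x => by
    refine ext V' _ _ fun i => ?_
    change res F _ (res F h (g V x)) = res F _ (g V' _)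
    rw [res_res, hg' V x _ _ i inf_le_right, hg]
    simp only [res_res]⟩
  refine ⟨η, fun i => ext_apply fun V x => ?_⟩
  have := hg' ⟨V.1, V.2.trans (hW i)⟩ x V.1 le_rfl i V.2
  simp only [res_self] at this
  exact this

lemma restrict_d {V : Opens M} (h : V ≤ U) (θ : Form L (jetSheaf L E) m U) :
    restrict h (dJet θ) = dJet (restrict h θ) := rfl

/-- `star`, as an additive map in the function. -/
noncomputable def starHom (θ : Form L (jetSheaf L E) m U) : Fn I U →+ Form L (jetSheaf L E) m U :=
  AddMonoidHom.mk' (fun f => star f θ) fun f g => ext_apply fun V x => Jet.ext' fun W D => by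
    change resFn (W.2.trans V.2) (f + g) • (θ.1 V x : Jet L E V.1).1 W D =
      resFn (W.2.trans V.2) f • (θ.1 V x : Jet L E V.1).1 W D +
        resFn (W.2.trans V.2) g • (θ.1 V x : Jet L E V.1).1 W D
    rw [map_add, add_smul]

lemma star_zero (θ : Form L (jetSheaf L E) m U) : star 0 θ = 0 := map_zero (starHom θ)

lemma star_one (θ : Form L (jetSheaf L E) m U) : star 1 θ = θ :=
  ext_apply fun V x => Jet.ext' fun W D => by
    change resFn (I := I) (W.2.trans V.2) 1 • (θ.1 V x : Jet L E V.1).1 W D =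
      (θ.1 V x : Jet L E V.1).1 W D
    rw [map_one, one_smul]

open Classical in
/-- The Poincaré lemma for forms with values in jets. -/
lemma exists_primitive [FiniteDimensional ℝ EM] [IsManifold I ∞ M] [T2Space M]
    [SigmaCompactSpace M] (θ : Form L (jetSheaf L E) (m + 1) U) (hθ : dJet θ = 0) :
    ∃ η : Form L (jetSheaf L E) m U, dJet η = θ := by
  have loc : ∀ y : U, ∃ (W : Opens M) (hW : W ≤ U), y.1 ∈ W ∧
      ∃ η : Form L (jetSheaf L E) m W, dJet η = restrict hW θ := by
    intro y
    obtain ⟨W, hy, n, b, hb⟩ := L.isLocallyFree y.1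
    have hb : IsFrame L.bundle b := hb
    refine ⟨W ⊓ U, inf_le_right, ⟨hy, y.2⟩, exists_primitive_of_frame
      (hb.restrict (inf_le_left : W ⊓ U ≤ W)) _ ?_⟩
    rw [← restrict_d, hθ, map_zero]
  choose W hWU hyW η hη using loc
  obtain ⟨χ, N, hN, F, hyN, hNW, hχ0, hχ1⟩ := exists_partition (I := I) U W hyW
  -- The form `χ_i η_i` is not extended by zero across the boundary of `W i`. It is only used on
  -- open sets `V` inside `W i`, or on which `χ_i` vanishes; in the latter case the default value
  -- `0` is the correct one.
  let term : ∀ V : Opens M, V ≤ U → U → Form L (jetSheaf L E) m V := fun V hV i =>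
    if h : V ≤ W i then star (resFn hV (χ i)) (restrict h (η i)) else 0
  have hterm : ∀ (V V' : Opens M) (hV : V ≤ U) (h : V' ≤ V) (i : U), V ≤ W i →
      restrict h (term V hV i) = term V' (h.trans hV) i := by
    intro V V' hV h i hi
    simp only [term, dif_pos hi, dif_pos (h.trans hi)]
    rfl
  have hterm0 : ∀ (V : Opens M) (hV : V ≤ U) (y i : U), V ≤ N y → i ∉ F y → term V hV i = 0 := by
    intro V hV y i hy hi
    have : resFn hV (χ i) = 0 := by
      rw [← resFn_resFn (hN y) hy, hχ0 y i hi, map_zero]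
    simp only [term]
    split_ifs
    · rw [this, star_zero]
    · rfl
  have hres : ∀ (y : U) (V : Opens M) (h : V ≤ N y) (S : Finset U), F y ⊆ S →
      restrict h (∑ i ∈ F y, term (N y) (hN y) i) = ∑ i ∈ S, term V (h.trans (hN y)) i := by
    intro y V h S hS
    rw [map_sum, Finset.sum_congr rfl fun i hi => hterm (N y) V (hN y) h i (hNW y i hi)]
    exact Finset.sum_subset hS fun i _ hi => hterm0 V _ y i h hi
  have hcov : U ≤ iSup N := fun z hz => Opens.mem_iSup.2 ⟨⟨z, hz⟩, hyN ⟨z, hz⟩⟩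
  obtain ⟨ζ, hζ⟩ := exists_glue N hN hcov (fun y => ∑ i ∈ F y, term (N y) (hN y) i)
    fun y z => by
      rw [hres y _ _ (F y ∪ F z) Finset.subset_union_left,
        hres z _ _ (F y ∪ F z) Finset.subset_union_right]
  refine ⟨ζ, eq_of_restrict_eq N hN hcov fun y => ?_⟩
  -- As `star` commutes with `d`, the differential of `χ_i η_i` is `χ_i θ`, and these sum to `θ`.
  have hd : ∀ i ∈ F y, dJet (term (N y) (hN y) i) =
      starHom (restrict (hN y) θ) (resFn (hN y) (χ i)) := by
    intro i hi
    simp only [term, dif_pos (hNW y i hi)]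
    rw [d_star, ← restrict_d, hη]
    rfl
  rw [restrict_d, hζ, map_sum, Finset.sum_congr rfl hd, ← map_sum, hχ1]
  exact star_one _

end Form
end Gluing
end LieAlgebroidJets

namespace LieAlgebroidJets

/-! ### The quasi-isomorphism and its linearity -/

section Comparison

open CategoryTheory TopologicalSpace Opposite
open scoped Manifold ContDiff TensorProduct

/-- A map from a cochain complex of abelian groups to a group in degree zero is a
quasi-isomorphism if the complex is exact in positive degrees and the map has a section onto the
cocycles of degree zero. -/
lemma quasiIso_toSingle₀ (C : CochainComplex AddCommGrpCat.{0} ℕ) (A : AddCommGrpCat.{0})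
    (f : C ⟶ (CochainComplex.single₀ AddCommGrpCat.{0}).obj A) (g : C.X 0 ⟶ A)
    (hg : CochainComplex.toSingle₀Equiv C A f = g) (s : A ⟶ C.X 0)
    (hs : CategoryStruct.comp s (C.d 0 1) = 0) (hsg : CategoryStruct.comp s g = 𝟙 A)
    (hgs : ∀ z : C.X 0, C.d 0 1 z = 0 → s (g z) = z)
    (hC : ∀ m, ∀ z : C.X (m + 1), C.d (m + 1) (m + 2) z = 0 → ∃ y : C.X m, C.d m (m + 1) y = z) :
    QuasiIso f := by
  let t : (CochainComplex.single₀ AddCommGrpCat.{0}).obj A ⟶ C :=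
    (CochainComplex.fromSingle₀Equiv C A).symm ⟨s, hs⟩
  have ht : t.f 0 = s := CochainComplex.fromSingle₀Equiv_symm_apply_f_zero s hs
  have htf : CategoryStruct.comp t f = 𝟙 _ := by
    apply (CochainComplex.toSingle₀Equiv _ A).injective
    rw [← hg] at hsg
    simp only [CochainComplex.toSingle₀Equiv_apply] at hsg ⊢
    rw [HomologicalComplex.comp_f, ht]
    exact hsg
  -- The map `t` given by the section satisfies `t ≫ f = 𝟙`, so it is enough to treat `t`. In degree
  -- zero this means that `s` identifies `A` with the cocycles.
  suffices QuasiIso t from by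
    have : QuasiIso (CategoryStruct.comp t f) := by rw [htf]; infer_instance
    exact quasiIso_of_comp_left t f
  rw [quasiIso_iff]
  intro i
  cases i with
  | zero =>
    rw [CochainComplex.quasiIsoAt₀_iff, ShortComplex.quasiIso_iff_of_zeros _ (by simp; rfl)
      (by simp; rfl) (by simp; rfl)]
    constructor
    · rw [ShortComplex.ab_exact_iff]
      intro z hz
      exact ⟨g z, (congrArg (fun k => k.hom (g z)) ht).trans (hgs z hz)⟩
    · change Mono (t.f 0)
      rw [ht]
      have : Mono (CategoryStruct.comp s g) := by rw [hsg]; infer_instance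
      exact mono_of_mono s g
  | succ m =>
    rw [quasiIsoAt_iff_exactAt _ _ (CochainComplex.exactAt_succ_single_obj A m),
      HomologicalComplex.exactAt_iff' C m (m + 1) (m + 2) (by simp) (by simp),
      ShortComplex.ab_exact_iff]
    exact hC m

variable {EM : Type*} [NormedAddCommGroup EM] [NormedSpace ℝ EM] {HM : Type*} [TopologicalSpace HM]
  {I : ModelWithCorners ℝ EM HM} {M : Type} [TopologicalSpace M] [ChartedSpace HM M]
  {L : LieAlgebroid I M} {E : SmoothModule I M} {U : Opens M}

/-- Compatibility of the counit with restriction, which makes `Jet.const` a family of the required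
kind; it reduces to the compatibility of the anchor. -/
lemma LieAlgebroid.resFn_counit {V : Opens M} (h : V ≤ U) (D : L.env U) :
    resFn h (Env.counit D) = Env.counit (L.resEnv h D) := by
  induction D using Env.induction with
  | one => rw [Env.counit_one, map_one, map_one, Env.counit_one]
  | add D D' hD hD' => rw [map_add, map_add, map_add, map_add, hD, hD']
  | fn_mul f D hD =>
    rw [← Env.smul_eq, map_smul Env.counit, L.resEnv_smul, map_smul Env.counit, ← hD, smul_eq_mul,
      smul_eq_mul, map_mul]
  | vec_mul x D hD =>
    rw [Env.counit_vec_mul, map_mul, L.resEnv_vec, Env.counit_vec_mul, ← hD]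
    exact L.res_anchor h x _

variable (L E U) in
/-- The jets that vanish on the left ideal generated by the vectors, as determined by their
values. -/
noncomputable def Jet.const : Sec E U →+ Jet L E U where
  toFun e := ⟨fun V => LinearMap.smulRight (Env.counit (A := Fn I V.1) (𝔤 := Sec L.bundle V.1))
    (res E V.2 e), fun V W h D => by
      change res E h (Env.counit (A := Fn I V.1) D • res E V.2 e) =
        Env.counit (A := Fn I W.1) (L.resEnv h D) • res E W.2 e
      rw [res_smul, res_res, L.resFn_counit]⟩
  map_zero' := Jet.ext' fun V D => by
    change Env.counit (A := Fn I V.1) D • res E V.2 0 = 0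
    rw [map_zero, smul_zero]
  map_add' e e' := Jet.ext' fun V D => by
    change Env.counit (A := Fn I V.1) D • res E V.2 (e + e') =
      Env.counit (A := Fn I V.1) D • res E V.2 e + Env.counit (A := Fn I V.1) D • res E V.2 e'
    rw [map_add, smul_add]

namespace Form

/-- A section as a form of degree zero. -/
noncomputable def ofSec (F : SmoothModule I M) : Sec F U →+ Form L F 0 U where
  toFun s := ⟨fun V => AlternatingMap.constOfIsEmpty (Fn I V.1) (Sec L.bundle V.1) (Fin 0)
    (res F V.2 s), fun V _ h _ => res_res F V.2 h s⟩
  map_zero' := ext_apply fun V _ => map_zero (res F V.2)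
  map_add' s t := ext_apply fun V _ => map_add (res F V.2) s t

lemma ofSec_apply (F : SmoothModule I M) (s : Sec F U) (V : {V : Opens M // V ≤ U})
    (x : Fin 0 → Sec L.bundle V.1) : (ofSec F s : Form L F 0 U).1 V x = res F V.2 s := rfl

lemma apply_eq_res {F : SmoothModule I M} (θ : Form L F 0 U) (V : {V : Opens M // V ≤ U})
    (x : Fin 0 → Sec L.bundle V.1) : θ.1 V x = res F V.2 (θ.1 ⟨U, le_rfl⟩ ![]) := by
  rw [θ.2 ⟨U, le_rfl⟩ V V.2]
  congr 1
  exact Subsingleton.elim _ _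

lemma dJet_apply_zero (θ : Form L (jetSheaf L E) 0 U) (V : {V : Opens M // V ≤ U})
    (x : Fin 1 → Sec L.bundle V.1) :
    ((dJet θ).1 V x : Jet L E V.1) = Jet.act (x 0) (θ.1 V ![]) := by
  let ψ : Sec L.bundle V.1 [⋀^Fin 0]→ₗ[Fn I V.1] Sec (jets L E).sheaf V.1 := θ.1 V
  exact (CE.d_apply ψ x).trans (CE.dFun_zero ψ x)

lemma dJet_const (e : Sec E U) : dJet (ofSec (jetSheaf L E) (Jet.const L E U e)) = 0 :=
  ext_apply fun V x => by
    rw [dJet_apply_zero]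
    refine Jet.ext' fun W D => ?_
    change Env.counit (A := Fn I W.1) (D * Env.vec _) • _ = (0 : Sec E W.1)
    rw [Env.counit_mul_vec, zero_smul]

lemma dRProjDeg_const (e : Sec E U) :
    dRProjDeg L E U 0 (ofSec (jetSheaf L E) (Jet.const L E U e)) = e := by
  change Env.counit (A := Fn I U) (𝔤 := Sec L.bundle U) 1 • res E _ e = e
  rw [Env.counit_one, one_smul, res_self]

/-- Closedness says that the jet kills all products `D y` with a vector `y` on the right, so
`Env.eq_counit_smul` applies over each open set. -/
lemma eq_const_of_dJet_eq_zero (θ : Form L (jetSheaf L E) 0 U) (hθ : dJet θ = 0) :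
    ofSec (jetSheaf L E) (Jet.const L E U (dRProjDeg L E U 0 θ)) = θ := by
  refine ext_apply fun V x => ?_
  rw [apply_eq_res θ]
  refine (ofSec_apply (jetSheaf L E) _ V x).trans (congrArg (res (jetSheaf L E) V.2) ?_)
  refine Jet.ext' fun W D => ?_
  let φ : Jet L E U := θ.1 ⟨U, le_rfl⟩ ![]
  change Env.counit (A := Fn I W.1) D • res E W.2 (φ.1 ⟨U, le_rfl⟩ 1) = φ.1 W D
  have e := φ.2 ⟨U, le_rfl⟩ W W.2 1
  rw [(L.resEnv W.2).map_one] at e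
  refine (congrArg (Env.counit (A := Fn I W.1) D • ·) e).trans ?_
  refine (Env.eq_counit_smul (φ.1 W) (fun y D' => ?_) D).symm
  -- The vector `y` is an arbitrary section over `W`, not necessarily a restriction from `U`; hence
  -- the component over `W` of the equation `dθ = 0` is used.
  have h := dJet_apply_zero θ W ![y]
  rw [hθ, apply_eq_res θ] at h
  have h' := congrArg (fun ψ : Jet L E W.1 => ψ.1 ⟨W.1, le_rfl⟩ D') h
  change 0 = φ.1 W (D' * Env.vec (res L.bundle _ y)) at h'
  rw [res_self] at h'
  exact h'.symm

end Form

/-- The projection of the de Rham complex of the jets of `E` to `E` is a quasi-isomorphism. -/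
lemma quasiIso_dRProj [FiniteDimensional ℝ EM] [IsManifold I ∞ M] [T2Space M]
    [SigmaCompactSpace M] (L : LieAlgebroid I M) (E : SmoothModule I M) (U : Opens M) :
    QuasiIso ((dRProj L E).app (op U)) := by
  refine quasiIso_toSingle₀ (dRObj L (jets L E) U) (AddCommGrpCat.of (Sec E U)) _
    (AddCommGrpCat.ofHom (dRProjDeg L E U 0))
    ((CochainComplex.toSingle₀Equiv _ _).apply_symm_apply _)
    (AddCommGrpCat.ofHom ((Form.ofSec (jetSheaf L E)).comp (Jet.const L E U))) ?_ ?_ ?_ ?_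
  · rw [dRObj_d]
    exact AddCommGrpCat.hom_ext (AddMonoidHom.ext fun e => Form.dJet_const e)
  · exact AddCommGrpCat.hom_ext (AddMonoidHom.ext fun e => Form.dRProjDeg_const e)
  · intro z hz
    rw [dRObj_d] at hz
    exact Form.eq_const_of_dJet_eq_zero z hz
  · intro m z hz
    rw [dRObj_d] at hz
    rw [dRObj_d]
    exact Form.exists_primitive z hz

/-- There is a single shuffle of two empty sets, with sign `1`. -/
lemma CE.wedge_zero {A 𝔤 N : Type*} [CommRing A] [LieRing 𝔤] [Module A 𝔤] [AddCommGroup N]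
    [Module A N] (α : 𝔤 [⋀^Fin 0]→ₗ[A] A) (θ : 𝔤 [⋀^Fin 0]→ₗ[A] N) (x : Fin 0 → 𝔤) :
    CE.wedge α θ x = α ![] • θ ![] := by
  change TensorProduct.lid A N ((∑ σ : Equiv.Perm.ModSumCongr (Fin 0) (Fin 0),
    AlternatingMap.domCoprod.summand α θ σ) (fun i => x (finSumFinEquiv i))) = _
  have h : (∑ σ : Equiv.Perm.ModSumCongr (Fin 0) (Fin 0),
      AlternatingMap.domCoprod.summand α θ σ) =
      AlternatingMap.domCoprod.summand α θ (Quotient.mk'' 1) :=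
    Fintype.sum_eq_single (Quotient.mk'' 1) fun σ hσ => absurd (by
      induction σ using Quotient.inductionOn' with | _ σ
      exact congrArg _ (Subsingleton.elim _ _)) hσ
  rw [h, AlternatingMap.domCoprod.summand_mk'']
  simp only [Equiv.Perm.sign_one, one_smul, MultilinearMap.domDomCongr_apply,
    MultilinearMap.domCoprod_apply, TensorProduct.lid_tmul, AlternatingMap.coe_multilinearMap]
  congr 2 <;> exact Subsingleton.elim _ _

/-- The projection of the de Rham complex of the jets of `E` to `E` is linear over the algebra of
`L`-forms. -/
lemma dRProjDeg_wedge (k m : ℕ) (α : Form L (structureSheaf I M) k U)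
    (θ : Form L (jetSheaf L E) m U) :
    dRProjDeg L E U (k + m) (Form.wedge α θ) = aug L U k α • dRProjDeg L E U m θ := by
  cases m with
  | succ m => exact (smul_zero _).symm
  | zero =>
    cases k with
    | succ k => exact (zero_smul (Fn I U) _).symm
    | zero =>
      let a : Fn I U := α.1 ⟨U, le_rfl⟩ ![]
      let s : Sec (jetSheaf L E) U := θ.1 ⟨U, le_rfl⟩ ![]
      have h : (Form.wedge α θ).1 ⟨U, le_rfl⟩ ![] = a • s :=
        CE.wedge_zero (A := Fn I U) (N := Sec (jetSheaf L E) U) (α.1 ⟨U, le_rfl⟩)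
          (θ.1 ⟨U, le_rfl⟩) ![]
      exact (congrArg (secHom (jetProj L E) U) h).trans (map_smul (secHom (jetProj L E) U) a s)

end Comparison

end LieAlgebroidJets

namespace LieAlgebroidJets

/-! ### Jets of `E` as combinations of a lifted frame -/

section Splitting

open CategoryTheory TopologicalSpace Opposite
open scoped Manifold ContDiff TensorProduct

variable {EM : Type*} [NormedAddCommGroup EM] [NormedSpace ℝ EM] {HM : Type*} [TopologicalSpace HM]
  {I : ModelWithCorners ℝ EM HM} {M : Type} [TopologicalSpace M] [ChartedSpace HM M]
  {L : LieAlgebroid I M} {E : SmoothModule I M} {U : Opens M}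

namespace Jet

/-- Linear combinations of jets, with jets of functions as coefficients. -/
noncomputable def combination {n : ℕ} (c : Fin n → Jet L E U) :
    (Fin n → Jet L (structureSheaf I M) U) →ₗ[Fn I U] Jet L E U :=
  ∑ j, (mulHom U).flip (c j) ∘ₗ LinearMap.proj j

lemma combination_eq {n : ℕ} (c : Fin n → Jet L E U)
    (a : Fin n → Jet L (structureSheaf I M) U) :
    combination c a = ∑ j, mulHom U (a j) (c j) := by
  simp [combination]

/-- If the coefficients vanish below order `q`, then in order `q` only the values of the `c j` at
`1` enter. -/
lemma combination_apply_of_mem_vanish {n : ℕ} (c : Fin n → Jet L E U)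
    {a : Fin n → Jet L (structureSheaf I M) U} {q : ℕ}
    (ha : ∀ j, a j ∈ vanish L (structureSheaf I M) U q) (V : {V : Opens M // V ≤ U})
    {D : L.env V.1} (hD : D ∈ Env.filt (Fn I V.1) (Sec L.bundle V.1) (q + 1)) :
    (combination c a).1 V D = ∑ j, fnVal (a j) V D • (c j).1 V 1 := by
  let F : Jet L E U →+ Sec E V.1 := AddMonoidHom.mk' (fun φ => φ.1 V D) (fun _ _ => rfl)
  rw [combination_eq]
  exact (map_sum F _ _).trans
    (Finset.sum_congr rfl fun j _ => mulHom_apply_of_left (ha j) (c j) V hD)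

lemma combination_mem_vanish {n : ℕ} (c : Fin n → Jet L E U)
    {a : Fin n → Jet L (structureSheaf I M) U} {q : ℕ}
    (ha : ∀ j, a j ∈ vanish L (structureSheaf I M) U q) : combination c a ∈ vanish L E U q :=
  fun V D hD => by
    rw [combination_apply_of_mem_vanish c ha V (Env.filt_le_succ q hD)]
    refine Finset.sum_eq_zero fun j _ => ?_
    have : fnVal (a j) V D = 0 := ha j V D hD
    rw [this, zero_smul]

section Frame

variable {n : ℕ} {b : Fin n → Sec E U} (hb : IsFrame E b) (c : Fin n → Jet L E U)
  (hc : ∀ (V : {V : Opens M // V ≤ U}) (j : Fin n), (c j).1 V 1 = hb.basis V.2 j)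

/-- The coordinates of the values of a jet with respect to a frame. -/
noncomputable def coordinate (j : Fin n) (φ : Jet L E U) : Jet L (structureSheaf I M) U :=
  ⟨fun V => (hb.basis V.2).coord j ∘ₗ φ.1 V, fun V W h D => by
    refine (hb.res_repr V.2 h (φ.1 V D) j).trans ?_
    rw [φ.2 V W h]
    rfl⟩

lemma fnVal_coordinate (j : Fin n) (φ : Jet L E U) (V : {V : Opens M // V ≤ U})
    (D : L.env V.1) : fnVal (coordinate hb j φ) V D = (hb.basis V.2).repr (φ.1 V D) j := rfl

lemma coordinate_mem_vanish (j : Fin n) {q : ℕ} {φ : Jet L E U} (hφ : φ ∈ vanish L E U q) :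
    coordinate hb j φ ∈ vanish L (structureSheaf I M) U q := fun V D hD => by
  refine (fnVal_coordinate hb j φ V D).trans ?_
  rw [hφ V D hD, map_zero, Finsupp.zero_apply]
  rfl

include hc

/-- The values `c_j(1)` form the frame, so the combination with coefficients the coordinates of `φ`
has the same leading term as `φ`. -/
lemma sub_combination_coordinate_mem_vanish {q : ℕ} {φ : Jet L E U}
    (hφ : φ ∈ vanish L E U q) :
    φ - combination c (fun j => coordinate hb j φ) ∈ vanish L E U (q + 1) := fun V D hD => by
  change φ.1 V D - (combination c (fun j => coordinate hb j φ)).1 V D = 0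
  rw [combination_apply_of_mem_vanish c (fun j => coordinate_mem_vanish hb j hφ) V hD,
    sub_eq_zero]
  simp only [fnVal_coordinate, hc]
  exact ((hb.basis V.2).sum_repr (φ.1 V D)).symm

/-- Coefficients vanishing below order `q` satisfy a linear relation among frame elements in order
`q`. They therefore vanish there too, and so to all orders. -/
lemma combination_injective : Function.Injective (combination c) := by
  rw [← LinearMap.ker_eq_bot, LinearMap.ker_eq_bot']
  intro a ha
  suffices h : ∀ q j, a j ∈ vanish L (structureSheaf I M) U q from
    funext fun j => eq_zero_of_mem_vanish fun q => h q j
  intro q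
  induction q with
  | zero => exact fun j => mem_vanish_zero _
  | succ q ih =>
    intro j V D hD
    have h := combination_apply_of_mem_vanish c ih V hD
    simp only [ha, hc] at h
    exact Fintype.linearIndependent_iff.1 (hb.basis V.2).linearIndependent
      (fun j => fnVal (a j) V D) h.symm j

/-- Successive approximation: the remainders `r q` vanish below order `q`, hence so do their
coordinates, and the series of coordinates can be summed by completeness. -/
lemma combination_surjective [FiniteDimensional ℝ EM] [IsManifold I ∞ M] [T2Space M]
    [SigmaCompactSpace M] : Function.Surjective (combination c) := by
  intro φ
  let r : (q : ℕ) → vanish L E U q := fun q => Nat.rec ⟨φ, mem_vanish_zero φ⟩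
    (fun _ ψ => ⟨_, sub_combination_coordinate_mem_vanish hb c hc ψ.2⟩) q
  have hr : ∀ q, (r (q + 1)).1 =
    (r q).1 - combination c (fun j => coordinate hb j (r q).1) := fun _ => rfl
  choose ψ hψ using fun j => exists_series (fun q => coordinate hb j (r q).1)
    (fun q => coordinate_mem_vanish hb j (r q).2)
  have hsum : ∀ q, (r q).1 =
      φ - combination c (∑ i ∈ Finset.range q, fun j => coordinate hb j (r i).1) := by
    intro q
    induction q with
    | zero => simp [r]
    | succ q ih => rw [hr, Finset.sum_range_succ, map_add, ← sub_sub, ← ih]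
  refine ⟨ψ, ?_⟩
  rw [← sub_eq_zero]
  refine eq_zero_of_mem_vanish fun q => ?_
  have e : combination c ψ - φ =
      combination c (ψ - ∑ i ∈ Finset.range q, fun j => coordinate hb j (r i).1) - (r q).1 := by
    rw [hsum q, map_sub]
    abel
  rw [e]
  refine sub_mem (combination_mem_vanish c fun j => ?_) (r q).2
  rw [Pi.sub_apply, Finset.sum_apply]
  exact hψ j q

end Frame

end Jet

/-- If `E` has a frame, then `a ⊗ e ↦ a ν(e)` is bijective on sections. -/
lemma bijective_iNuSec [FiniteDimensional ℝ EM] [IsManifold I ∞ M] [T2Space M]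
    [SigmaCompactSpace M] {n : ℕ} {b : Fin n → Sec E U} (hb : IsFrame E b)
    (ν : E ⟶ jetSheaf L E) (hν : CategoryStruct.comp ν (jetProj L E) = 𝟙 E) :
    Function.Bijective (iNuSec ν U) := by
  -- The frame of `E` identifies `J_L ⊗ E` with `n` copies of `J_L`, and the map `a ⊗ e ↦ a ν(e)`
  -- with combinations of the jets `ν(b_j)`. Their values at `1` are the `b_j`, because `p ∘ ν =
  -- id`.
  let c : Fin n → Jet L E U := fun j => secHom ν U (b j)
  have hp : ∀ (V : Opens M) (s : Sec E V), secHom (jetProj L E) V (secHom ν V s) = s := by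
    intro V s
    have h : secHom (CategoryStruct.comp ν (jetProj L E)) V s = s := by rw [hν]; rfl
    exact h
  have hc : ∀ (V : {V : Opens M // V ≤ U}) (j : Fin n), (c j).1 V 1 = hb.basis V.2 j := by
    intro V j
    rw [hb.basis_apply, ← hp V.1 (res E V.2 (b j)), ← res_secHom]
    rfl
  let e := TensorProduct.equivFinsuppOfBasisRight (M := Jet L (structureSheaf I M) U)
    (hb.basis le_rfl)
  let e' := e.trans (Finsupp.linearEquivFunOnFinite (Fn I U) (Jet L (structureSheaf I M) U) (Fin n))
  have he : iNuSec ν U ∘ₗ e'.symm.toLinearMap = Jet.combination c := by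
    refine LinearMap.ext fun a => ?_
    rw [Jet.combination_eq]
    change iNuSec ν U (e.symm _) = _
    rw [TensorProduct.equivFinsuppOfBasisRight_symm_apply, Finsupp.sum_fintype _ _ (by simp),
      map_sum]
    refine Finset.sum_congr rfl fun j _ => ?_
    rw [hb.basis_apply, res_self]
    rfl
  have := (⟨Jet.combination_injective hb c hc, Jet.combination_surjective hb c hc⟩ :
    Function.Bijective (Jet.combination c))
  rw [← he, LinearMap.coe_comp] at this
  exact (Function.Bijective.of_comp_iff _ e'.symm.bijective).1 this

/-- The morphism out of the sheafification of a presheaf of modules that corresponds to a locally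
bijective morphism is an isomorphism. -/
lemma isIso_sheafificationHomEquiv_symm {C : Type*} [Category C] {J : GrothendieckTopology C}
    {R₀ : Cᵒᵖ ⥤ RingCat} {R : Sheaf J RingCat} (α : R₀ ⟶ R.obj)
    [Presheaf.IsLocallyInjective J α] [Presheaf.IsLocallySurjective J α]
    [J.WEqualsLocallyBijective AddCommGrpCat] [HasWeakSheafify J AddCommGrpCat]
    {P : PresheafOfModules R₀} {F : SheafOfModules R}
    (g : P ⟶ (PresheafOfModules.restrictScalars α).obj ((SheafOfModules.forget _).obj F))
    (hg : J.W ((PresheafOfModules.toPresheaf R₀).map g)) :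
    IsIso ((PresheafOfModules.sheafificationHomEquiv α).symm g) := by
  suffices IsIso ((SheafOfModules.toSheaf R).map
      ((PresheafOfModules.sheafificationHomEquiv α).symm g)) from
    isIso_of_reflects_iso _ (SheafOfModules.toSheaf R)
  rw [PresheafOfModules.toSheaf_map_sheafificationHomEquiv_symm]
  have key : ∀ (P : Cᵒᵖ ⥤ AddCommGrpCat) (F : Sheaf J AddCommGrpCat) (g : P ⟶ F.obj), J.W g →
      IsIso (((sheafificationAdjunction J AddCommGrpCat).homEquiv P F).symm g) := by
    intro P F g hg
    rw [Adjunction.homEquiv_counit]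
    have := (J.W_iff g).1 hg
    exact IsIso.comp_isIso
  exact key _ _ _ hg

end Splitting

end LieAlgebroidJets

namespace LieAlgebroidJets

/-! ### The isomorphism `i_ν` by sheafification -/

section Splitting

open CategoryTheory TopologicalSpace Opposite
open scoped Manifold ContDiff TensorProduct

variable {EM : Type*} [NormedAddCommGroup EM] [NormedSpace ℝ EM] {HM : Type*} [TopologicalSpace HM]
  {I : ModelWithCorners ℝ EM HM} {M : Type} [TopologicalSpace M] [ChartedSpace HM M]
  {L : LieAlgebroid I M} {E : SmoothModule I M} {U : Opens M}

/-- The morphism `i_ν` is an isomorphism. -/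
lemma isIso_iNu [FiniteDimensional ℝ EM] [IsManifold I ∞ M] [T2Space M]
    [SigmaCompactSpace M] (hE : IsLocallyFree E)
    (ν : E ⟶ jetSheaf L E) (hν : CategoryStruct.comp ν (jetProj L E) = 𝟙 E) : IsIso (iNu ν) := by
  -- Arbitrarily small neighbourhoods carry a frame of `E`, so the map from the presheaf tensor
  -- product is locally bijective, and its extension to the sheafification is an isomorphism.
  have loc : ∀ (U : Opens M) (x : M), x ∈ U → ∃ V : Opens M, V ≤ U ∧ x ∈ V ∧
      Function.Bijective (iNuSec ν V) := by
    intro U x hx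
    obtain ⟨W, hxW, n, b, hb⟩ := hE x
    have hb : IsFrame E b := hb
    exact ⟨W ⊓ U, inf_le_right, ⟨hxW, hx⟩,
      bijective_iNuSec (hb.restrict (inf_le_left : W ⊓ U ≤ W)) ν hν⟩
  let J := Opens.grothendieckTopology M
  let g := (PresheafOfModules.toPresheaf (CInf I M).obj).map (iNuPre ν)
  have hinj : Presheaf.IsLocallyInjective J g := by
    refine ⟨fun {X} s t h x hx => ?_⟩
    obtain ⟨V, hV, hxV, hbij⟩ := loc X.unop x hx
    refine ⟨V, homOfLE hV, hbij.1 ?_, hxV⟩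
    have := congrArg ((jetPresheaf L E).map (homOfLE hV).op) h
    exact (CategoryTheory.congr_fun (g.naturality (homOfLE hV).op) s).trans
      (this.trans (CategoryTheory.congr_fun (g.naturality (homOfLE hV).op) t).symm)
  have hsurj : Presheaf.IsLocallySurjective J g := by
    refine ⟨fun {X} s x hx => ?_⟩
    obtain ⟨V, hV, hxV, hbij⟩ := loc X x hx
    exact ⟨V, homOfLE hV, hbij.2 _, hxV⟩
  delta iNu
  exact isIso_sheafificationHomEquiv_symm (R := CInf I M) (J := J)
    (P := PresheafOfModules.Monoidal.tensorObj (R := (smoothSheafCommRing I 𝓘(ℝ, ℝ) M ℝ).obj)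
      (jetSheaf L (structureSheaf I M)).val E.val)
    (F := jetSheaf L E) (𝟙 (CInf I M).obj) (iNuPre ν) (J.W_of_isLocallyBijective g)

end Splitting

end LieAlgebroidJets

theorem mainTheorem7
    {EM : Type*} [NormedAddCommGroup EM] [NormedSpace ℝ EM] [FiniteDimensional ℝ EM]
    {HM : Type*} [TopologicalSpace HM] (I : ModelWithCorners ℝ EM HM) [I.Boundaryless]
    (M : Type) [TopologicalSpace M] [ChartedSpace HM M] [IsManifold I ∞ M]
    [T2Space M] [SigmaCompactSpace M]
    (L : LieAlgebroid I M) (E : SmoothModule I M) (hE : IsLocallyFree E)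
    (ν : E ⟶ jetSheaf L E) (hν : ν ≫ jetProj L E = 𝟙 E) :
    (∀ U : Opens M, QuasiIso ((dRProj L E).app (op U))) ∧
    (∀ (U : Opens M) (k m : ℕ) (α : Form L (structureSheaf I M) k U)
      (θ : Form L (jetSheaf L E) m U),
      dRProjDeg L E U (k + m) (Form.wedge α θ) = aug L U k α • dRProjDeg L E U m θ) ∧
    IsIso (iNu ν) :=
  ⟨quasiIso_dRProj L E, fun _ => dRProjDeg_wedge, isIso_iNu hE ν hν⟩
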